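/- **Conventions.** Let $V$ be a set of $n$ vertices. Vectors are indexed by the edges of the complete graph on $V$ (a vector on the edges of a graph on $V$ is extended by zero). For a vector ${\bf x}\ge 0$ put $\|{\bf x}\|=\sum_e x_e$, $x(v)=\sum_{e\ni v}x_e$, $\mathrm{supp}({\bf x})=\{e: x_e>0\}$, and $d_V^{\varepsilon}({\bf x},{\bf y})=\sum_{v\in V}\max(0,|x(v)-y(v)|-\varepsilon)$. The vector ${\bf x}$ is a *fractional matching* if $x(v)\le 1$ for all $v$, and *uniform* if all its nonzero entries are equal. A vector ${\bf x}'\ge 0$ is an *$(\eta,\delta)$-coarsening* of ${\bf x}$ if * $\mathrm{supp}({\bf x}')\subseteq\mathrm{supp}({\bf x})$; * $\big|\|{\bf x}\|-\|{\bf x}'\|\big|\le \eta\|{\bf x}\|+\eta$; * $d_V^{\eta}({\bf x},{\bf x}')\le\eta\|{\bf x}\|+\eta$; * $x'_e\in\{0\}\cup[\delta,2\delta)$ if $x_e<\delta$, and $x'_e=x_e$ otherwise. An *$(\eta,\delta)$-split* of a fractional matching ${\bf z}$ with $\max_e z_e\le\delta$ consists of $(\eta,\delta)$-coarsenings ${\bf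 z}^{(1)},\dots,{\bf z}^{(k)}$ of ${\bf z}$ with pairwise disjoint supports and $\sum_i|\mathrm{supp}({\bf z}^{(i)})|\ge\frac12|\mathrm{supp}({\bf z})|$. The model is the word RAM with $W$-bit words (unit-cost arithmetic, shift, bitwise, comparison and most-significant-bit operations, uniform random numbers, zero-initialized memory, subroutine calls, which are charged for the words passed and returned). All numbers are fixed-point numbers with a common denominator $D$; a vector is given by the list of its nonzero entries, in any order. **Lemma (from static splitting to dynamic coarsening).** There is an absolute constant $K$ such that for every (possibly randomized) program $\mathcal S$ there is a dynamic algorithm $\mathcal C$, that is, a data structure with operations $\mathrm{init}({\bf x})$ and $\mathrm{update}(e,\nu)$ (which sets $x_e\gets\nu$), such that $\mathcal C$ is deterministic if $\mathcal S$ is, and the following holds for all $n\ge 2$, all integers $D\ge 2$, all $\gamma,\varepsilon\in(0,1)$ and $\delta>0$ that are multiples of $1/D$, all word lengths $W$ with $2^W\ge(n+D+\delta D+2)^K$, all real $t_s\ge1$ and all $p\ge0$. The programs $\mathcal S$ and $\mathcal C$ receive $n,D,\gamma,\delta$ (and $\mathcal C$ also $\varepsilon$) as inputs. Suppose that $\mathcal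 S$ is a static $(\gamma,\delta)$-split algorithm with running time $|\mathrm{supp}({\bf z})|\cdot t_s$ on uniform fractional matchings: on every nonzero uniform fractional matching ${\bf z}$ with $\max_e z_e\le\delta$, with probability at least $1-p$ it outputs a $(\gamma,\delta)$-split of ${\bf z}$ within $|\mathrm{supp}({\bf z})|\cdot t_s$ steps. Put $$\eta=K\left(\varepsilon+\gamma\,\varepsilon^{-1}\log(\gamma^{-1}n)\right).$$ Let $\mathcal C$ be initialized with any (possibly non-uniform) fractional matching ${\bf x}_0$ and undergo $T$ updates chosen by an adaptive adversary, that is, each update may depend on all previous internal states, outputs and running times, under the promise that the current vector ${\bf x}$ is always a fractional matching. Then, with probability at least $1-K(|\mathrm{supp}({\bf x}_0)|+T)\,p$: * after $\mathrm{init}$ and after each update, $\mathcal C$ stores explicitly an $(\eta,\delta)$-coarsening of the current ${\bf x}$; * $\mathrm{init}$ takes time at most $K\cdot\max(1,|\mathrm{supp}({\bf x}_0)|)\cdot t_s$; * for every $t\le T$ the first $t$ updates take total time at most $t\cdot K\,\varepsilon^{-1}t_s$ (amortized update time $O(\varepsilon^{-1}t_s)$). In particular, for $p=0$ the guarantees hold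 with probability $1$. -/

import Mathlib

open scoped ENNReal

/-!
Fractional matchings, coarsenings and splits.
-/

/-- The edges of the complete graph on the vertex set `Fin n`; the edge `{u, v}` is stored as the
pair with `u < v`.  A vector indexed by the edges of a graph on `Fin n` is extended by zero. -/
abbrev Edge (n : ℕ) : Type := {e : Fin n × Fin n // e.1 < e.2}

section Vectors

/-- `x(v)`, the sum of `x_e` over the edges `e` at `v`. -/
noncomputable def vertexSum {n : ℕ} (x : Edge n → ℝ) (v : Fin n) : ℝ :=
  ∑ e : Edge n, if e.1.1 = v ∨ e.1.2 = v then x e else 0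

/-- `‖x‖ = ∑_e x_e`. -/
noncomputable def size {n : ℕ} (x : Edge n → ℝ) : ℝ := ∑ e, x e

open Classical in
/-- The support of a non-negative vector. -/
noncomputable def supp {n : ℕ} (x : Edge n → ℝ) : Finset (Edge n) :=
  Finset.univ.filter fun e => 0 < x e

/-- `d_V^ε(x, y) = ∑_v (|x(v) - y(v)| - ε)⁺`. -/
noncomputable def vertexDist {n : ℕ} (ε : ℝ) (x y : Edge n → ℝ) : ℝ :=
  ∑ v : Fin n, max 0 (|vertexSum x v - vertexSum y v| - ε)

structure IsFractionalMatching {n : ℕ} (x : Edge n → ℝ) : Prop where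
  nonneg : ∀ e, 0 ≤ x e
  degree : ∀ v, vertexSum x v ≤ 1

/-- All the nonzero entries are equal. -/
def IsUniform {n : ℕ} (x : Edge n → ℝ) : Prop :=
  ∃ lam : ℝ, ∀ e ∈ supp x, x e = lam

/-- `y` is an `(ε, δ)`-coarsening of `x`. -/
structure IsCoarsening {n : ℕ} (ε δ : ℝ) (x y : Edge n → ℝ) : Prop where
  nonneg : ∀ e, 0 ≤ y e
  containment : supp y ⊆ supp x
  globalSlack : |size x - size y| ≤ ε * size x + ε
  vertexSlack : vertexDist ε x y ≤ ε * size x + ε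
  smallEdges : ∀ e, x e < δ → y e = 0 ∨ (δ ≤ y e ∧ y e < 2 * δ)
  largeEdges : ∀ e, δ ≤ x e → y e = x e

/-- `zs` is an `(ε, δ)`-split of the fractional matching `z`. -/
structure IsSplit {n : ℕ} (ε δ : ℝ) (z : Edge n → ℝ) (zs : List (Edge n → ℝ)) : Prop where
  matching : IsFractionalMatching z
  maxValue : ∀ e, z e ≤ δ
  coarsening : ∀ y ∈ zs, IsCoarsening ε δ z y
  disjoint : zs.Pairwise fun y y' => Disjoint (supp y) (supp y')
  covering : (1 / 2 : ℝ) * (supp z).card ≤ ((zs.map fun y => (supp y).card).sum : ℕ)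

end Vectors

/-!
The machine model: a word RAM with `W`-bit words.  Programs are written in a structured language
with unit-cost instructions on words.  The memory consists of arrays (a program mentions finitely
many of them), each of which is indexed by words; it is zero at the start.
-/

/-- Array name, then index. -/
abbrev Mem : Type := ℕ → ℕ → ℕ

inductive WordOp
  | add | sub | mul | div | mod | shl | land | lor | xor | lt | eq

def WordOp.apply : WordOp → ℕ → ℕ → ℕ
  | .add, x, y => x + y
  | .sub, x, y => x - y
  | .mul, x, y => x * y
  | .div, x, y => x / y
  | .mod, x, y => x % y
  | .shl, x, y => x * 2 ^ y
  | .land, x, y => Nat.land x y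
  | .lor, x, y => Nat.lor x y
  | .xor, x, y => Nat.xor x y
  | .lt, x, y => if x < y then 1 else 0
  | .eq, x, y => if x = y then 1 else 0

inductive Expr
  | const (c : ℕ)
  /-- The word at index `i` of array `a`. -/
  | load (a : ℕ) (i : Expr)
  | op (o : WordOp) (x y : Expr)
  /-- The position of the most significant bit. -/
  | log2 (x : Expr)

/-- The number of operations. -/
def Expr.cost : Expr → ℕ
  | .const _ => 1
  | .load _ i => i.cost + 1
  | .op _ x y => x.cost + y.cost + 1
  | .log2 x => x.cost + 1

/-- `x`, if it fits into a `W`-bit word; an overflow aborts the computation. -/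
def fit (W x : ℕ) : Option ℕ := if x < 2 ^ W then some x else none

def Expr.eval (W : ℕ) (m : Mem) : Expr → Option ℕ
  | .const c => fit W c
  | .load a i => (i.eval W m).map (m a)
  | .op o x y => (x.eval W m).bind fun k => (y.eval W m).bind fun l => fit W (o.apply k l)
  | .log2 x => (x.eval W m).map Nat.log2

inductive Prog
  | skip
  /-- Write the value of `v` to index `i` of array `a`. -/
  | store (a : ℕ) (i v : Expr)
  /-- Append a word to the output. -/
  | emit (v : Expr)
  /-- Write a fresh uniformly random element of `{0, …, N - 1}` to index `i` of array `a`, where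
  `N` is the value of `b`. -/
  | rand (a : ℕ) (i b : Expr)
  | seq (p q : Prog)
  /-- Execute `p` if the value of `c` is nonzero, and `q` otherwise. -/
  | ite (c : Expr) (p q : Prog)
  /-- Execute `p` as long as the value of `c` is nonzero. -/
  | loop (c : Expr) (p : Prog)
  /-- Subroutine call: `p` is executed on a memory of its own; its input is copied from array
  `src` and its output is copied to array `dst`. -/
  | call (p : Prog) (src dst : ℕ)

/-- The program draws no random numbers. -/
def Prog.Deterministic : Prog → Prop
  | .skip => True
  | .store _ _ _ => True
  | .emit _ => True
  | .rand _ _ _ => False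
  | .seq p q => p.Deterministic ∧ q.Deterministic
  | .ite _ p q => p.Deterministic ∧ q.Deterministic
  | .loop _ p => p.Deterministic
  | .call p _ _ => p.Deterministic

/-- Contents of the memory, and the output so far. -/
structure MState where
  mem : Mem
  out : List ℕ

def Mem.set (m : Mem) (a i v : ℕ) : Mem :=
  fun b j => if b = a ∧ j = i then v else m b j

/-- Write the length of `l` to index `0` and its entries to the indices `1, 2, …` of array `a`. -/
def Mem.setList (m : Mem) (a : ℕ) (l : List ℕ) : Mem :=
  fun b j => if b = a then (if j = 0 then l.length else (l[j - 1]?).getD (m b j)) else m b j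

/-- The list that `Mem.setList` writes. -/
def Mem.getList (m : Mem) (a : ℕ) : List ℕ :=
  (List.range (m a 0)).map fun j => m a (j + 1)

/-- The input goes to array `0`; the rest of the memory is kept and the output is emptied. -/
def MState.start (m : Mem) (input : List ℕ) : MState := ⟨m.setList 0 input, []⟩

/-- The final state and the running time; `none` if the computation was aborted. -/
abbrev Outcome : Type := Option (MState × ℕ)

def Outcome.addTime (t : ℕ) : Outcome → Outcome :=
  Option.map fun r => (r.1, r.2 + t)

/-- The distribution of the outcome of a program on a word RAM with `W`-bit words.  The first
natural number bounds the depth of the recursion: a computation that exceeds it is aborted, and any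
other one has the same outcome for all larger bounds. -/
noncomputable def Prog.run (W : ℕ) : ℕ → Prog → MState → PMF Outcome
  | 0, _, _ => PMF.pure none
  | _ + 1, .skip, s => PMF.pure (some (s, 1))
  | _ + 1, .store a i v, s =>
      match i.eval W s.mem, v.eval W s.mem with
      | some k, some x => PMF.pure (some (⟨s.mem.set a k x, s.out⟩, i.cost + v.cost + 1))
      | _, _ => PMF.pure none
  | _ + 1, .emit v, s =>
      match v.eval W s.mem with
      | some x =>
          if s.out.length + 1 < 2 ^ W then
            PMF.pure (some (⟨s.mem, s.out ++ [x]⟩, v.cost + 1))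
          else PMF.pure none
      | none => PMF.pure none
  | _ + 1, .rand a i b, s =>
      match i.eval W s.mem, b.eval W s.mem with
      | some k, some (N + 1) =>
          (PMF.uniformOfFintype (Fin (N + 1))).map fun r =>
            some (⟨s.mem.set a k (r : ℕ), s.out⟩, i.cost + b.cost + 1)
      | _, _ => PMF.pure none
  | f + 1, .seq p q, s =>
      (Prog.run W f p s).bind fun r =>
        match r with
        | some (s₁, t₁) => (Prog.run W f q s₁).map (Outcome.addTime (t₁ + 1))
        | none => PMF.pure none
  | f + 1, .ite c p q, s =>
      match c.eval W s.mem with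
      | some b =>
          (Prog.run W f (if b = 0 then q else p) s).map (Outcome.addTime (c.cost + 1))
      | none => PMF.pure none
  | f + 1, .loop c p, s =>
      match c.eval W s.mem with
      | some 0 => PMF.pure (some (s, c.cost + 1))
      | some (_ + 1) =>
          (Prog.run W f p s).bind fun r =>
            match r with
            | some (s₁, t₁) =>
                (Prog.run W f (.loop c p) s₁).map (Outcome.addTime (t₁ + c.cost + 1))
            | none => PMF.pure none
      | none => PMF.pure none
  | f + 1, .call p src dst, s =>
      (Prog.run W f p (MState.start (fun _ _ => 0) (s.mem.getList src))).map fun r =>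
        r.map fun r₁ =>
          (⟨s.mem.setList dst r₁.1.out, s.out⟩,
            (s.mem.getList src).length + r₁.2 + r₁.1.out.length + 1)

/-!
Encoding.  The word `k` stands for the fixed-point number `k / D`.
-/

/-- The vector with entries `X_e / D`. -/
noncomputable def fixedPoint {n : ℕ} (D : ℕ) (X : Edge n → ℕ) : Edge n → ℝ :=
  fun e => (X e : ℝ) / D

/-- `l` lists the nonzero entries of `X`, each of them once, in any order. -/
def ListsEntries {n : ℕ} (l : List (Edge n × ℕ)) (X : Edge n → ℕ) : Prop :=
  l.Nodup ∧ ∀ e k, (e, k) ∈ l ↔ X e = k ∧ k ≠ 0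

def encodeVec {n : ℕ} (l : List (Edge n × ℕ)) : List ℕ :=
  l.flatMap fun r => [(r.1.1.1 : ℕ), (r.1.1.2 : ℕ), r.2]

/-- The vectors one after the other, each preceded by the number of its nonzero entries. -/
def encodeVecs {n : ℕ} (ls : List (List (Edge n × ℕ))) : List ℕ :=
  ls.flatMap fun l => l.length :: encodeVec l

/-- The output is an `(ε, δ)`-split of `z / D`. -/
def OutputsSplit {n : ℕ} (D : ℕ) (ε δ : ℝ) (z : Edge n → ℕ) (out : List ℕ) : Prop :=
  ∃ (ls : List (List (Edge n × ℕ))) (zs : List (Edge n → ℕ)),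
    out = encodeVecs ls ∧ List.Forall₂ ListsEntries ls zs ∧
      IsSplit ε δ (fixedPoint D z) (zs.map (fixedPoint D))

/-- On `n` vertices and with denominator `D`, the program `S` is a static `(g / D, d / D)`-split
algorithm for uniform fractional matchings `z` with running time `|supp z| * ts`: on every input,
the probability that it does not produce a split within this time is at most `p`. -/
def IsStaticSplitAlgorithm (S : Prog) (W n D g d : ℕ) (ts : ℝ) (p : ℝ≥0∞) : Prop :=
  ∀ (z : Edge n → ℕ) (l : List (Edge n × ℕ)), ListsEntries l z →
    IsFractionalMatching (fixedPoint D z) → IsUniform (fixedPoint D z) →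
    (∀ e, z e ≤ d) → (supp (fixedPoint D z)).Nonempty →
    ∃ fuel : ℕ,
      (S.run W fuel (MState.start (fun _ _ => 0) ([n, D, g, d] ++ encodeVec l))).toOuterMeasure
        {r | ¬ ∃ s t, r = some (s, t) ∧ (t : ℝ) ≤ (supp (fixedPoint D z)).card * ts ∧
          OutputsSplit D ((g : ℝ) / D) ((d : ℝ) / D) z s.out} ≤ p

/-!
Dynamic algorithms against adaptive adversaries.
-/

/-- A data structure: two programs that work on the same memory. -/
structure DynAlg where
  init : Prog
  update : Prog

def DynAlg.Deterministic (C : DynAlg) : Prop := C.init.Deterministic ∧ C.update.Deterministic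

/-- The whole memory after, and the running time of, each operation so far: of `init`, and of the
calls of `update`, with the latest one first. -/
structure Trace where
  first : Mem × ℕ
  later : List (Mem × ℕ)

def Trace.mem (tr : Trace) : Mem := ((tr.later.head?).getD tr.first).1

/-- The total time of the calls of `update`. -/
def Trace.updateTime (tr : Trace) : ℕ := (tr.later.map Prod.snd).sum

/-- An adaptive adversary: the next update `(e, k)`, which sets `x_e` to `k / D`, may depend on
all previous internal states (hence on all previous outputs) and running times. -/
abbrev Adversary (n : ℕ) : Type := Trace → Edge n × ℕ

/-- The current vector, as a function of the trace; `X` is the one given to `init`. -/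
def Adversary.vector {n : ℕ} (A : Adversary n) (X : Edge n → ℕ) (first : Mem × ℕ) :
    List (Mem × ℕ) → Edge n → ℕ
  | [] => X
  | _ :: l => Function.update (A.vector X first l) (A ⟨first, l⟩).1 (A ⟨first, l⟩).2

/-- The promise: the current vector is a fractional matching at all times. -/
def Adversary.Legal {n : ℕ} (A : Adversary n) (D : ℕ) (X : Edge n → ℕ) : Prop :=
  ∀ first l, IsFractionalMatching (fixedPoint D (A.vector X first l))

/-- The distribution of the trace of `init`, on the given input, and `T` updates chosen by the
adversary. -/
noncomputable def DynAlg.play {n : ℕ} (C : DynAlg) (W fuel : ℕ) (input : List ℕ)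
    (A : Adversary n) : ℕ → PMF (Option Trace)
  | 0 =>
      (C.init.run W fuel (MState.start (fun _ _ => 0) input)).map
        (Option.map fun r => ⟨(r.1.mem, r.2), []⟩)
  | T + 1 =>
      (C.play W fuel input A T).bind fun o =>
        match o with
        | some tr =>
            (C.update.run W fuel (MState.start tr.mem
              [((A tr).1.1.1 : ℕ), ((A tr).1.1.2 : ℕ), (A tr).2])).map
              (Option.map fun r => ⟨tr.first, (r.1.mem, r.2) :: tr.later⟩)
        | none => PMF.pure none

/-- The maintained vector is stored explicitly in array `1`: the entry of the edge `{u, v}`, with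
`u < v`, at index `u * n + v`. -/
def outputVector (n : ℕ) (m : Mem) : Edge n → ℕ :=
  fun e => m 1 ((e.1.1 : ℕ) * n + (e.1.2 : ℕ))

/-- `init` took time at most `tI * max 1 |supp x|`; and at each moment up to now the output was an
`(η, δ)`-coarsening of the current vector, and the `t` updates up to this moment took time at most
`t * tU` altogether. -/
structure Trace.Good {n : ℕ} (D : ℕ) (η δ tI tU : ℝ) (A : Adversary n) (X : Edge n → ℕ)
    (tr : Trace) : Prop where
  initTime : (tr.first.2 : ℝ) ≤ tI * max 1 ((supp (fixedPoint D X)).card : ℝ)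
  coarsening : ∀ l, l <:+ tr.later →
    IsCoarsening η δ (fixedPoint D (A.vector X tr.first l))
      (fixedPoint D (outputVector n (Trace.mem ⟨tr.first, l⟩)))
  updateTime : ∀ l, l <:+ tr.later → (Trace.updateTime ⟨tr.first, l⟩ : ℝ) ≤ l.length * tU

/-- On `n` vertices, with denominator `D` and parameters `params`, the data structure `C`
maintains `(η, δ)`-coarsenings of fractional matchings `x` against adaptive adversaries, with
initialization time `tI * max 1 |supp x|` and amortized update time `tU`: the probability that this
fails within `T` updates is at most `q |supp x| T`. -/
def IsDynamicCoarseningAlgorithm (C : DynAlg) (W n D : ℕ) (params : List ℕ)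
    (η δ tI tU : ℝ) (q : ℕ → ℕ → ℝ≥0∞) : Prop :=
  ∀ (X : Edge n → ℕ) (l : List (Edge n × ℕ)), ListsEntries l X →
    IsFractionalMatching (fixedPoint D X) →
    ∀ A : Adversary n, A.Legal D X → ∀ T : ℕ, ∃ fuel : ℕ,
      (C.play W fuel ([n, D] ++ params ++ encodeVec l) A T).toOuterMeasure
        {r | ¬ ∃ tr, r = some tr ∧ tr.Good D η δ tI tU A X} ≤ q (supp (fixedPoint D X)).card T

/-!
Failure probabilities of optional outcomes.
-/

/-! The small entries are treated in buckets. An entry below `δ` with `n² x_e ≥ γ` is rounded down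
to a multiple of a width of about `ε` times its leading power of two, and the edges with the same
rounded value `μ` form bucket `μ`. So the entries of a bucket agree with `μ` up to a factor `1 +
O(ε)`, and there are only `O(ε⁻¹ log(n/γ))` buckets (`Par.card_buckets_le_log`). Entries of at least
`δ` are copied to the output; the remaining, tiny ones have total weight at most `γ`
(`Par.sum_tiny_le`) and are dropped.

When bucket `μ` is rebuilt, the vector that is `μ` on its present edges (its base) is uniform and
dominated by `x`, hence a legal input of `S`, which splits it into disjoint blocks. The output on
the bucket consists of what is left of one block, the current one. An edge that is updated is
touched, and its entry in the current block, if present, is switched off. Two rules keep the bucket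
in order: it is rebuilt when there have been more than `ε|base|` changes, and the next block becomes
current when more than a fraction `2ε` of the current one is dead. The supply of blocks suffices
(`BucketInv.rest_ne`): in every block that was given up more than a fraction `2ε` of the edges is
touched, the blocks are disjoint, and together they contain at least half of the base. Using up all
of them would take more than `ε|base|` changes, and a rebuild would have come first.

For the error, compare `x` on a bucket, the vector `μ` on the base, the current block, and the
output, in this order (`BucketInv.error`). The first and the last step are `ℓ₁`-errors of a fraction
`O(ε)`; the middle one is a `(γ, δ)`-coarsening. Buckets of weight below `4γ` at the rebuild are
left empty, at a cost of `O(γ)`. Summing over the buckets multiplies the additive error `γ` by their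
number, which is the second term of `η`. If `γ` or `ε` is at least `1/4` then `η ≥ 2`, and the zero
vector on the small entries is good enough.

For the time, the blocks of a split have equal lengths up to a factor `6` (`Blocks.of_split`), so
passing on costs `O(1)` per entry of the block that is given up; these entries are at most `1/(2ε)`
times the number of changes. A rebuild costs `O(t_s)` per edge and is preceded by more than
`ε|base|` changes. Both are paid from `potential` (`FixPost.time_le`). During `init` all buckets
grow from nothing, so that every change pays for a single edge and no factor `ε⁻¹` appears
(`tri_fixP_new`).

Adaptivity is harmless because the invariants hold for whatever split `S` returns, and because `S`
fails with probability at most `p` on every single input: given the history, each call still fails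
with probability at most `p`, and a union bound finishes the proof. On the machine level this is
organized by the triples `Tri`, which add up failure probabilities and running times;
`Expr.eval_bounded` excludes overflows. -/

section FailProb

variable {α β : Type*}

/-- The probability that there is no outcome satisfying `Q`. -/
noncomputable def failProb (μ : PMF (Option α)) (Q : α → Prop) : ℝ≥0∞ :=
  μ.toOuterMeasure {r | ¬ ∃ a, r = some a ∧ Q a}

noncomputable def obind (μ : PMF (Option α)) (κ : α → PMF (Option β)) : PMF (Option β) :=
  μ.bind fun r => match r with
    | some a => κ a
    | none => PMF.pure none

/-- Every outcome is at least as likely under `μ'` as under `μ`. -/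
def OptLE (μ μ' : PMF (Option α)) : Prop := ∀ a, μ (some a) ≤ μ' (some a)

theorem failProb_pure {a : α} {Q : α → Prop} (h : Q a) : failProb (PMF.pure (some a)) Q = 0 := by
  simp [failProb, PMF.toOuterMeasure_pure_apply, h]

theorem failProb_mono {μ : PMF (Option α)} {Q Q' : α → Prop} (h : ∀ a, Q a → Q' a) :
    failProb μ Q' ≤ failProb μ Q := by
  apply MeasureTheory.measure_mono
  rintro r hr ⟨a, rfl, ha⟩
  exact hr ⟨a, rfl, h a ha⟩

theorem failProb_map (μ : PMF (Option α)) (g : α → β) (Q : β → Prop) :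
    failProb (μ.map (Option.map g)) Q = failProb μ (fun a => Q (g a)) := by
  unfold failProb
  rw [PMF.toOuterMeasure_map_apply]
  congr 1
  ext r
  cases r <;> simp

/-- Success is a sum over proper outcomes, each of which gains probability; failure is its
complement, since the total mass is `1`. -/
theorem OptLE.failProb_le {μ μ' : PMF (Option α)} (h : OptLE μ μ') (Q : α → Prop) :
    failProb μ' Q ≤ failProb μ Q := by
  have key : ∀ ν : PMF (Option α), failProb ν Q =
      1 - ν.toOuterMeasure {r | ¬ ∃ a, r = some a ∧ Q a}ᶜ := by
    intro ν
    have h1 : ν.toOuterMeasure {r | ¬ ∃ a, r = some a ∧ Q a} +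
        ν.toOuterMeasure {r | ¬ ∃ a, r = some a ∧ Q a}ᶜ = 1 := by
      rw [PMF.toOuterMeasure_apply, PMF.toOuterMeasure_apply, ← ENNReal.tsum_add, ← ν.tsum_coe]
      congr 1
      ext x
      exact congrFun (Set.indicator_self_add_compl _ _) x
    refine ENNReal.eq_sub_of_add_eq ?_ h1
    intro h
    rw [h] at h1
    simp at h1
  rw [key, key]
  apply tsub_le_tsub_left
  rw [PMF.toOuterMeasure_apply, PMF.toOuterMeasure_apply]
  apply ENNReal.tsum_le_tsum
  intro x
  apply Set.indicator_le_indicator'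
  intro hx
  obtain ⟨a, rfl, -⟩ := not_not.1 hx
  exact h a

theorem OptLE.refl (μ : PMF (Option α)) : OptLE μ μ := fun _ => le_rfl

theorem OptLE.map {μ μ' : PMF (Option α)} (h : OptLE μ μ') (g : α → β) :
    OptLE (μ.map (Option.map g)) (μ'.map (Option.map g)) := by
  intro b
  rw [PMF.map_apply, PMF.map_apply]
  apply ENNReal.tsum_le_tsum
  rintro (_ | a)
  · simp
  · split_ifs
    exacts [h a, le_rfl]

theorem OptLE.obind {μ μ' : PMF (Option α)} {κ κ' : α → PMF (Option β)} (h : OptLE μ μ')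
    (hκ : ∀ a, OptLE (κ a) (κ' a)) : OptLE (obind μ κ) (obind μ' κ') := by
  intro b
  unfold _root_.obind
  rw [PMF.bind_apply, PMF.bind_apply]
  apply ENNReal.tsum_le_tsum
  rintro (_ | a)
  · simp
  · exact mul_le_mul' (h a) (hκ a b)

/-- The union bound: either the first stage misses `R`, or the second stage, started from an outcome
with `R`, fails. Only outcomes of positive probability matter, which is what allows a common fuel to
be chosen below. -/
theorem failProb_obind_le {μ : PMF (Option α)} {κ : α → PMF (Option β)} {R : α → Prop}
    {Q : β → Prop} {q : ℝ≥0∞}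
    (h : ∀ a, some a ∈ μ.support → R a → failProb (κ a) Q ≤ q) :
    failProb (obind μ κ) Q ≤ failProb μ R + q := by
  unfold failProb _root_.obind
  rw [PMF.toOuterMeasure_bind_apply]
  have hq : q = ∑' r, μ r * q := by rw [ENNReal.tsum_mul_right, μ.tsum_coe, one_mul]
  conv_rhs => rw [hq, PMF.toOuterMeasure_apply, ← ENNReal.tsum_add]
  apply ENNReal.tsum_le_tsum
  have hle : ∀ (r : Option α) (ν : PMF (Option β)) (s : Set (Option β)),
      μ r * ν.toOuterMeasure s ≤ μ r := by
    intro r ν s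
    have : ν.toOuterMeasure s ≤ 1 := by
      rw [PMF.toOuterMeasure_apply, ← ν.tsum_coe]
      exact ENNReal.tsum_le_tsum fun x => Set.indicator_le_self _ _ x
    simpa using mul_le_mul' (le_refl (μ r)) this
  rintro (_ | a)
  · refine le_trans (hle _ _ _) ?_
    simp
  · by_cases hR : R a
    · by_cases hs : some a ∈ μ.support
      · exact le_trans (mul_le_mul' le_rfl (h a hs hR)) le_add_self
      · have : μ (some a) = 0 := by simpa [PMF.mem_support_iff] using hs
        simp [this]
    · refine le_trans (hle _ _ _) ?_
      simp [hR]

/-- The fuel needed by the second stage depends on the outcome of the first one. The first stage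
with a fixed fuel has only finitely many outcomes, so a maximum exists, and by monotonicity in the
fuel it serves both stages. -/
theorem exists_fuel_obind {μ : ℕ → PMF (Option α)} {κ : ℕ → α → PMF (Option β)}
    {R : α → Prop} {Q : β → Prop} {q₁ q₂ : ℝ≥0∞}
    (hμ : ∀ f f', f ≤ f' → OptLE (μ f) (μ f')) (hfin : ∀ f, (μ f).support.Finite)
    (hκ : ∀ f f', f ≤ f' → ∀ a, OptLE (κ f a) (κ f' a))
    (h₁ : ∃ f, failProb (μ f) R ≤ q₁) (h₂ : ∀ a, R a → ∃ f, failProb (κ f a) Q ≤ q₂) :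
    ∃ f, failProb (obind (μ f) (κ f)) Q ≤ q₁ + q₂ := by
  obtain ⟨f₁, h₁⟩ := h₁
  choose! g hg using h₂
  have hbdd : BddAbove (g '' {a | some a ∈ (μ f₁).support}) := by
    apply Set.Finite.bddAbove
    apply Set.Finite.image
    exact Set.Finite.preimage (fun a _ b _ h => Option.some.inj h) (hfin f₁)
  obtain ⟨F, hF⟩ := hbdd
  refine ⟨max f₁ F, ?_⟩
  refine le_trans (((hμ f₁ _ (le_max_left _ _)).obind fun a => OptLE.refl _).failProb_le Q) ?_
  refine le_trans (failProb_obind_le (R := R) (q := q₂) ?_) (add_le_add h₁ le_rfl)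
  intro a ha hR
  have : g a ≤ F := hF ⟨a, ha, rfl⟩
  exact le_trans ((hκ _ _ (le_trans this (le_max_right _ _)) a).failProb_le Q) (hg a hR)

theorem obind_support_finite {μ : PMF (Option α)} {κ : α → PMF (Option β)}
    (h : μ.support.Finite) (hκ : ∀ a, (κ a).support.Finite) : (obind μ κ).support.Finite := by
  unfold _root_.obind
  rw [PMF.support_bind]
  apply Set.Finite.biUnion h
  rintro (_ | a) _
  · simp [PMF.support_pure]
  · exact hκ a

theorem map_support_finite {μ : PMF α} {g : α → β} (h : μ.support.Finite) :
    (μ.map g).support.Finite := by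
  rw [PMF.support_map]
  exact h.image g

end FailProb

/-!
Runs of programs.
-/

section Run

variable {W : ℕ}

theorem run_seq (f : ℕ) (p q : Prog) (s : MState) :
    (Prog.seq p q).run W (f + 1) s =
      obind (p.run W f s) fun r => (q.run W f r.1).map (Outcome.addTime (r.2 + 1)) := by
  rw [Prog.run, obind]
  congr 1
  funext r
  rcases r with _ | ⟨s, t⟩ <;> rfl

theorem run_ite (f : ℕ) (c : Expr) (p q : Prog) (s : MState) {b : ℕ}
    (h : c.eval W s.mem = some b) :
    (Prog.ite c p q).run W (f + 1) s =
      ((if b = 0 then q else p).run W f s).map (Outcome.addTime (c.cost + 1)) := by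
  rw [Prog.run, h]

theorem run_loop_zero (f : ℕ) (c : Expr) (p : Prog) (s : MState)
    (h : c.eval W s.mem = some 0) :
    (Prog.loop c p).run W (f + 1) s = PMF.pure (some (s, c.cost + 1)) := by
  rw [Prog.run, h]

theorem run_loop_succ (f : ℕ) (c : Expr) (p : Prog) (s : MState) {b : ℕ}
    (h : c.eval W s.mem = some (b + 1)) :
    (Prog.loop c p).run W (f + 1) s =
      obind (p.run W f s) fun r =>
        ((Prog.loop c p).run W f r.1).map (Outcome.addTime (r.2 + c.cost + 1)) := by
  rw [Prog.run, h, obind]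
  change PMF.bind _ _ = _
  congr 1
  funext r
  rcases r with _ | ⟨s, t⟩ <;> rfl

/-- More fuel can only replace an abort by a proper outcome, as every construct is monotone in the
runs of its parts. -/
theorem run_optLE_succ (f : ℕ) : ∀ (p : Prog) (s : MState),
    OptLE (p.run W f s) (p.run W (f + 1) s) := by
  induction f with
  | zero =>
    intro p s a
    rw [Prog.run]
    simp
  | succ f ih =>
    intro p s
    cases p with
    | skip => simp only [Prog.run]; exact OptLE.refl _
    | store a i v => simp only [Prog.run]; exact OptLE.refl _
    | emit v => simp only [Prog.run]; exact OptLE.refl _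
    | rand a i b => simp only [Prog.run]; exact OptLE.refl _
    | seq p q =>
      rw [run_seq, run_seq]
      exact (ih p s).obind fun r => (ih q r.1).map _
    | ite c p q =>
      cases h : c.eval W s.mem with
      | none => rw [Prog.run, Prog.run, h]; exact OptLE.refl _
      | some b =>
        rw [run_ite _ _ _ _ _ h, run_ite _ _ _ _ _ h]
        exact (ih _ s).map _
    | loop c p =>
      cases h : c.eval W s.mem with
      | none => rw [Prog.run, Prog.run, h]; exact OptLE.refl _
      | some b =>
        cases b with
        | zero => rw [run_loop_zero _ _ _ _ h, run_loop_zero _ _ _ _ h]; exact OptLE.refl _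
        | succ b =>
          rw [run_loop_succ _ _ _ _ h, run_loop_succ _ _ _ _ h]
          exact (ih p s).obind fun r => (ih _ r.1).map _
    | call p src dst =>
      rw [Prog.run, Prog.run]
      exact (ih p _).map _

theorem run_optLE {f f' : ℕ} (h : f ≤ f') (p : Prog) (s : MState) :
    OptLE (p.run W f s) (p.run W f' s) := by
  induction h with
  | refl => exact OptLE.refl _
  | step _ ih => exact fun a => le_trans (ih a) (run_optLE_succ _ p s a)

theorem pure_support_finite {α : Type*} (a : α) : (PMF.pure a).support.Finite := by
  rw [PMF.support_pure]; exact Set.finite_singleton a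

theorem run_support_finite (f : ℕ) : ∀ (p : Prog) (s : MState), (p.run W f s).support.Finite := by
  induction f with
  | zero => intro p s; rw [Prog.run]; exact pure_support_finite _
  | succ f ih =>
    intro p s
    cases p with
    | skip => rw [Prog.run]; exact pure_support_finite _
    | store a i v => rw [Prog.run]; split <;> exact pure_support_finite _
    | emit v =>
      rw [Prog.run]
      split
      · split <;> exact pure_support_finite _
      · exact pure_support_finite _
    | rand a i b =>
      rw [Prog.run]
      split
      · refine map_support_finite ?_
        change (PMF.bind _ _).support.Finite
        rw [PMF.support_bind]
        exact Set.Finite.biUnion (Set.toFinite _) fun _ _ => pure_support_finite _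
      · exact pure_support_finite _
    | seq p q =>
      rw [run_seq]
      exact obind_support_finite (ih p s) fun r => map_support_finite (ih q _)
    | ite c p q =>
      cases h : c.eval W s.mem with
      | none => rw [Prog.run, h]; exact pure_support_finite _
      | some b =>
        rw [run_ite _ _ _ _ _ h]
        exact map_support_finite (ih _ s)
    | loop c p =>
      cases h : c.eval W s.mem with
      | none => rw [Prog.run, h]; exact pure_support_finite _
      | some b =>
        cases b with
        | zero => rw [run_loop_zero _ _ _ _ h]; exact pure_support_finite _
        | succ b =>
          rw [run_loop_succ _ _ _ _ h]
          exact obind_support_finite (ih p s) fun r => map_support_finite (ih _ _)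
    | call p src dst =>
      rw [Prog.run]
      exact map_support_finite (ih p _)

end Run

/-!
Evaluation of expressions without overflow.
-/

section Eval

/-- The value of an expression if there is no overflow. -/
def Expr.val (m : Mem) : Expr → ℕ
  | .const c => c
  | .load a i => m a (i.val m)
  | .op o x y => o.apply (x.val m) (y.val m)
  | .log2 x => Nat.log2 (x.val m)

/-- The expression has small constants, and it shifts only in order to compute a power of two that
is bounded by another value. -/
def Expr.safe : Expr → Bool
  | .const c => c ≤ 64
  | .load _ i => i.safe
  | .op .shl (.const 1) (.log2 x) => x.safe
  | .op .shl _ _ => false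
  | .op .land _ _ => false
  | .op .lor _ _ => false
  | .op .xor _ _ => false
  | .op _ x y => x.safe && y.safe
  | .log2 x => x.safe

/-- All words in the memory are at most `M`. -/
def MemBdd (M : ℕ) (m : Mem) : Prop := ∀ a i, m a i ≤ M

/-- Values of short expressions on words bounded by `M` fit into `W`-bit words. -/
structure Fits (W M : ℕ) : Prop where
  large : 64 ≤ M
  fits : M ^ 100 < 2 ^ W

variable {W M : ℕ} {m : Mem}

theorem Fits.pow_lt (hW : Fits W M) {c : ℕ} (hc : c ≤ 100) : M ^ c < 2 ^ W :=
  lt_of_le_of_lt (Nat.pow_le_pow_right (by have := hW.large; omega) hc) hW.fits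

theorem Expr.safe_shl {x y : Expr} (h : (Expr.op .shl x y).safe = true) :
    ∃ z, x = .const 1 ∧ y = .log2 z ∧ z.safe = true := by
  cases x with
  | const c =>
    cases y with
    | log2 z =>
      by_cases hc : c = 1
      · subst hc
        exact ⟨z, rfl, rfl, by simpa [Expr.safe] using h⟩
      · rw [Expr.safe] at h
        · simp at h
        · intro z h1 _; exact hc (Expr.const.inj h1)
    | _ => simp [Expr.safe] at h
  | _ => simp [Expr.safe] at h

/-- Each operation raises the exponent of the bound `M ^ cost` by at least one, which is enough for
sums and products. A shift would exceed any such bound; only `2 ^ log2 z` is allowed, and the third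
conjunct carries the bound for it through the induction. -/
theorem Expr.eval_bounded (hW : Fits W M) (hm : MemBdd M m) (x : Expr) (hs : x.safe = true)
    (hc : x.cost ≤ 100) : x.eval W m = some (x.val m) ∧ x.val m ≤ M ^ x.cost ∧
      ∀ z, x = .log2 z → 2 ^ x.val m ≤ M ^ x.cost := by
  have hM : 2 ≤ M := by have := hW.large; omega
  have hM1 : 1 ≤ M := by omega
  have hfit : ∀ {v c : ℕ}, c ≤ 100 → v ≤ M ^ c → fit W v = some v := by
    intro v c hc hv
    rw [fit, if_pos (lt_of_le_of_lt hv (hW.pow_lt hc))]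
  have hmono : ∀ {a b : ℕ}, a ≤ b → M ^ a ≤ M ^ b := fun h => Nat.pow_le_pow_right hM1 h
  induction x with
  | const c =>
    have h : c ≤ M ^ 1 := by
      have := hW.large
      simp [Expr.safe] at hs
      rw [pow_one]
      omega
    exact ⟨hfit (by norm_num) h, h, by simp⟩
  | load a i ih =>
    simp only [Expr.cost] at hc
    simp only [Expr.safe] at hs
    obtain ⟨h, -⟩ := ih hs (by omega)
    refine ⟨by simp [Expr.eval, h, Expr.val], ?_, by simp⟩
    refine le_trans (hm _ _) ?_
    calc M = M ^ 1 := (pow_one M).symm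
      _ ≤ _ := hmono (by simp [Expr.cost])
  | log2 x ih =>
    simp only [Expr.cost] at hc
    simp only [Expr.safe] at hs
    obtain ⟨h, h', -⟩ := ih hs (by omega)
    refine ⟨by simp [Expr.eval, h, Expr.val], ?_, ?_⟩
    · calc Nat.log2 (x.val m) ≤ x.val m := by
            rw [Nat.log2_eq_log_two]; exact Nat.log_le_self _ _
        _ ≤ M ^ x.cost := h'
        _ ≤ _ := hmono (by simp [Expr.cost])
    · intro _ _
      simp only [Expr.val]
      rcases Nat.eq_zero_or_pos (x.val m) with h0 | h0
      · rw [h0]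
        simpa using Nat.one_le_pow _ _ (by omega)
      · calc 2 ^ Nat.log2 (x.val m) ≤ x.val m := Nat.log2_self_le (by omega)
          _ ≤ M ^ x.cost := h'
          _ ≤ _ := hmono (by simp [Expr.cost])
  | op o x y ihx ihy =>
    have hcx : x.cost ≤ 100 := by simp only [Expr.cost] at hc; omega
    have hcy : y.cost ≤ 100 := by simp only [Expr.cost] at hc; omega
    have reg : x.safe = true → y.safe = true →
        (∀ a b : ℕ, a ≤ M ^ x.cost → b ≤ M ^ y.cost → o.apply a b ≤ M ^ (x.cost + y.cost + 1)) →
        (Expr.op o x y).eval W m = some ((Expr.op o x y).val m) ∧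
          (Expr.op o x y).val m ≤ M ^ (Expr.op o x y).cost ∧
          ∀ z, Expr.op o x y = .log2 z → 2 ^ (Expr.op o x y).val m ≤ M ^ (Expr.op o x y).cost := by
      intro hx hy hb
      obtain ⟨h1, h1', -⟩ := ihx hx hcx
      obtain ⟨h2, h2', -⟩ := ihy hy hcy
      have := hb _ _ h1' h2'
      refine ⟨?_, this, by simp⟩
      simp only [Expr.eval, h1, h2, Option.bind_some, Expr.val]
      exact hfit hc this
    have hle1 : ∀ a : ℕ, a ≤ M ^ x.cost → a ≤ M ^ (x.cost + y.cost + 1) :=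
      fun a h => le_trans h (hmono (by omega))
    have h1le : 1 ≤ M ^ (x.cost + y.cost + 1) := Nat.one_le_pow _ _ (by omega)
    cases o with
    | add =>
      simp only [Expr.safe, Bool.and_eq_true] at hs
      apply reg hs.1 hs.2
      intro a b ha hb
      simp only [WordOp.apply]
      calc a + b ≤ M ^ (x.cost + y.cost) + M ^ (x.cost + y.cost) :=
            add_le_add (le_trans ha (hmono (by omega))) (le_trans hb (hmono (by omega)))
        _ = M ^ (x.cost + y.cost) * 2 := by ring
        _ ≤ M ^ (x.cost + y.cost) * M := Nat.mul_le_mul_left _ hM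
        _ = _ := (pow_succ _ _).symm
    | sub =>
      simp only [Expr.safe, Bool.and_eq_true] at hs
      exact reg hs.1 hs.2 fun a b ha hb => le_trans (Nat.sub_le a b) (hle1 a ha)
    | mul =>
      simp only [Expr.safe, Bool.and_eq_true] at hs
      apply reg hs.1 hs.2
      intro a b ha hb
      calc a * b ≤ M ^ x.cost * M ^ y.cost := Nat.mul_le_mul ha hb
        _ = M ^ (x.cost + y.cost) := (pow_add _ _ _).symm
        _ ≤ _ := hmono (by omega)
    | div =>
      simp only [Expr.safe, Bool.and_eq_true] at hs
      exact reg hs.1 hs.2 fun a b ha hb => le_trans (Nat.div_le_self a b) (hle1 a ha)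
    | mod =>
      simp only [Expr.safe, Bool.and_eq_true] at hs
      exact reg hs.1 hs.2 fun a b ha hb => le_trans (Nat.mod_le a b) (hle1 a ha)
    | lt =>
      simp only [Expr.safe, Bool.and_eq_true] at hs
      apply reg hs.1 hs.2
      intro a b ha hb
      simp only [WordOp.apply]
      split_ifs <;> omega
    | eq =>
      simp only [Expr.safe, Bool.and_eq_true] at hs
      apply reg hs.1 hs.2
      intro a b ha hb
      simp only [WordOp.apply]
      split_ifs <;> omega
    | land => simp [Expr.safe] at hs
    | lor => simp [Expr.safe] at hs
    | xor => simp [Expr.safe] at hs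
    | shl =>
      obtain ⟨z, rfl, rfl, hz⟩ := Expr.safe_shl hs
      obtain ⟨h2, -, h3⟩ := ihy (by simpa [Expr.safe] using hz) hcy
      have h4 := h3 z rfl
      have h5 : 1 * 2 ^ (Expr.log2 z).val m ≤ M ^ (Expr.op .shl (.const 1) (.log2 z)).cost := by
        rw [one_mul]
        exact le_trans h4 (hmono (by simp only [Expr.cost]; omega))
      refine ⟨?_, h5, by simp⟩
      have h6 : fit W 1 = some 1 := hfit (c := 0) (by norm_num) (by simp)
      simp only [Expr.eval, h6, Option.bind_some]
      simp only [Expr.eval] at h2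
      rw [h2]
      exact hfit hc h5

theorem MemBdd.set {M : ℕ} {m : Mem} (hm : MemBdd M m) {a i v : ℕ} (hv : v ≤ M) :
    MemBdd M (m.set a i v) := by
  intro b j
  unfold Mem.set
  split_ifs
  exacts [hv, hm b j]

end Eval

/-!
Programs that fail with small probability.
-/

section Tri

variable {W M : ℕ}

/-- Starting from the memory `m`, with probability at least `1 - q` the program terminates, with a
final memory `m'` and a running time of at most `t` for which `Q m' t` holds. -/
def Tri (W : ℕ) (p : Prog) (m : Mem) (q : ℝ≥0∞) (Q : Mem → ℕ → Prop) : Prop :=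
  ∀ o, ∃ f, failProb (p.run W f ⟨m, o⟩) (fun r => ∃ t, r.2 ≤ t ∧ Q r.1.mem t) ≤ q

/-- The time in a triple is only an upper bound for the true running time, so constants may be
rounded up freely. -/
theorem Tri.mono {p : Prog} {m : Mem} {q q' : ℝ≥0∞} {Q Q' : Mem → ℕ → Prop}
    (h : Tri W p m q Q) (hq : q ≤ q') (hQ : ∀ m' t, Q m' t → ∃ t', t ≤ t' ∧ Q' m' t') :
    Tri W p m q' Q' := by
  intro o
  obtain ⟨f, hf⟩ := h o
  refine ⟨f, le_trans (le_trans (failProb_mono ?_) hf) hq⟩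
  rintro r ⟨t, ht, hr⟩
  obtain ⟨t', ht', hr'⟩ := hQ _ _ hr
  exact ⟨t', le_trans ht ht', hr'⟩

theorem Tri.imp {p : Prog} {m : Mem} {q : ℝ≥0∞} {Q Q' : Mem → ℕ → Prop}
    (h : Tri W p m q Q) (hQ : ∀ m' t, Q m' t → Q' m' t) : Tri W p m q Q' :=
  h.mono le_rfl fun m' t hr => ⟨t, le_rfl, hQ m' t hr⟩

theorem Tri.skip {m : Mem} {Q : Mem → ℕ → Prop} (h : Q m 1) : Tri W .skip m 0 Q := by
  intro o
  refine ⟨1, ?_⟩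
  rw [Prog.run, failProb_pure]
  exact ⟨1, le_rfl, h⟩

theorem failProb_addTime (μ : PMF Outcome) (t : ℕ) (Q : MState × ℕ → Prop) :
    failProb (μ.map (Outcome.addTime t)) Q = failProb μ (fun r => Q (r.1, r.2 + t)) :=
  failProb_map μ (fun r : MState × ℕ => (r.1, r.2 + t)) Q

theorem Tri.seq {p p' : Prog} {m : Mem} {q₁ q₂ : ℝ≥0∞} {R Q : Mem → ℕ → Prop}
    (h₁ : Tri W p m q₁ R)
    (h₂ : ∀ m₁ t₁, R m₁ t₁ → Tri W p' m₁ q₂ (fun m₂ t₂ => Q m₂ (t₁ + t₂ + 1))) :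
    Tri W (.seq p p') m (q₁ + q₂) Q := by
  intro o
  obtain ⟨f, hf⟩ := exists_fuel_obind (μ := fun f => p.run W f ⟨m, o⟩)
    (κ := fun f r => (p'.run W f r.1).map (Outcome.addTime (r.2 + 1)))
    (Q := fun r => ∃ t, r.2 ≤ t ∧ Q r.1.mem t) (q₂ := q₂)
    (fun f f' h => run_optLE h _ _) (fun f => run_support_finite f _ _)
    (fun f f' h r => (run_optLE h _ _).map _) (h₁ o) (by
      rintro ⟨s, t⟩ ⟨t₁, ht₁, hR⟩
      obtain ⟨f, hf⟩ := h₂ _ _ hR s.out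
      refine ⟨f, ?_⟩
      rw [failProb_addTime]
      refine le_trans (failProb_mono ?_) hf
      rintro r ⟨t₂, ht₂, hr⟩
      refine ⟨_, ?_, hr⟩
      simp only at *
      omega)
  refine ⟨f + 1, ?_⟩
  rw [run_seq]
  exact hf

theorem Tri.seq_det {p p' : Prog} {m : Mem} {q : ℝ≥0∞} {R Q : Mem → ℕ → Prop}
    (h₁ : Tri W p m 0 R)
    (h₂ : ∀ m₁ t₁, R m₁ t₁ → Tri W p' m₁ q (fun m₂ t₂ => Q m₂ (t₁ + t₂ + 1))) :
    Tri W (.seq p p') m q Q := by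
  simpa using Tri.seq h₁ h₂

theorem Tri.store (hW : Fits W M) {m : Mem} (hm : MemBdd M m) {a : ℕ} {i v : Expr} (k x : ℕ)
    {Q : Mem → ℕ → Prop} (hk : i.val m = k) (hx : v.val m = x) (hxM : x ≤ M)
    (h : MemBdd M (m.set a k x) → Q (m.set a k x) 201)
    (hi : i.safe = true := by rfl) (hv : v.safe = true := by rfl)
    (ci : i.cost ≤ 100 := by decide) (cv : v.cost ≤ 100 := by decide) :
    Tri W (.store a i v) m 0 Q := by
  subst hk hx
  intro o
  refine ⟨1, ?_⟩
  rw [Prog.run]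
  simp only [(i.eval_bounded hW hm hi ci).1, (v.eval_bounded hW hm hv cv).1]
  rw [failProb_pure]
  -- Two expressions of cost at most `100`, and one step for the store.
  exact ⟨201, by dsimp only; omega, h (hm.set hxM)⟩

theorem Tri.store_seq (hW : Fits W M) {m : Mem} (hm : MemBdd M m) {a : ℕ} {i v : Expr} {p : Prog}
    {q : ℝ≥0∞} (k x : ℕ) {Q : Mem → ℕ → Prop} (hk : i.val m = k) (hx : v.val m = x) (hxM : x ≤ M)
    (h : MemBdd M (m.set a k x) → Tri W p (m.set a k x) q (fun m' t => Q m' (t + 202)))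
    (hi : i.safe = true := by rfl) (hv : v.safe = true := by rfl)
    (ci : i.cost ≤ 100 := by decide) (cv : v.cost ≤ 100 := by decide) :
    Tri W (.seq (.store a i v) p) m q Q := by
  refine Tri.seq_det (R := fun m' t => m' = m.set a k x ∧ t = 201)
    (Tri.store hW hm k x hk hx hxM (fun _ => ⟨rfl, rfl⟩) hi hv ci cv) ?_
  rintro _ _ ⟨rfl, rfl⟩
  refine (h (hm.set hxM)).imp fun m' t h => ?_
  rwa [show 201 + t + 1 = t + 202 by ring]

theorem Tri.ite (hW : Fits W M) {m : Mem} (hm : MemBdd M m) {c : Expr} {p p' : Prog}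
    {q : ℝ≥0∞} {Q : Mem → ℕ → Prop}
    (h₁ : c.val m ≠ 0 → Tri W p m q (fun m' t => Q m' (t + 101)))
    (h₀ : c.val m = 0 → Tri W p' m q (fun m' t => Q m' (t + 101)))
    (hc : c.safe = true := by rfl) (cc : c.cost ≤ 100 := by decide) :
    Tri W (.ite c p p') m q Q := by
  intro o
  have key : ∀ p'' : Prog, Tri W p'' m q (fun m' t => Q m' (t + 101)) →
      ∃ f, failProb ((p''.run W f ⟨m, o⟩).map (Outcome.addTime (c.cost + 1)))
        (fun r => ∃ t, r.2 ≤ t ∧ Q r.1.mem t) ≤ q := by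
    intro p'' h
    obtain ⟨f, hf⟩ := h o
    refine ⟨f, ?_⟩
    rw [failProb_addTime]
    refine le_trans (failProb_mono ?_) hf
    rintro r ⟨t, ht, hr⟩
    exact ⟨_, by dsimp only; omega, hr⟩
  have he := (c.eval_bounded hW hm hc cc).1
  by_cases h : c.val m = 0
  · obtain ⟨f, hf⟩ := key p' (h₀ h)
    refine ⟨f + 1, ?_⟩
    rwa [run_ite _ _ _ _ _ he, if_pos h]
  · obtain ⟨f, hf⟩ := key p (h₁ h)
    refine ⟨f + 1, ?_⟩
    rwa [run_ite _ _ _ _ _ he, if_neg h]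

/-- `k` bounds the number of the remaining iterations, and `t` is the time spent so far. -/
theorem Tri.loop (hW : Fits W M) {c : Expr} {p : Prog} {q : ℝ≥0∞} {Q : Mem → ℕ → Prop}
    {I : ℕ → Mem → ℕ → Prop} (hc : c.safe = true) (cc : c.cost ≤ 100)
    (h : ∀ k m t, I k m t → MemBdd M m ∧ ((c.val m = 0 ∧ Q m (t + 101)) ∨
      (c.val m ≠ 0 ∧ ∃ k₁, k = k₁ + 1 ∧
        Tri W p m q (fun m' t' => ∃ k', k' ≤ k₁ ∧ I k' m' (t + t' + 101)))))
    {k : ℕ} {m : Mem} {t : ℕ} (hI : I k m t) :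
    Tri W (.loop c p) m (k * q) (fun m' t' => Q m' (t + t')) := by
  induction k using Nat.strong_induction_on generalizing m t with
  | _ k ih =>
    obtain ⟨hm, ⟨h0, hQ⟩ | ⟨h0, k₁, rfl, hp⟩⟩ := h _ _ _ hI
    · intro o
      refine ⟨1, ?_⟩
      have he := (c.eval_bounded hW hm hc cc).1
      rw [h0] at he
      rw [run_loop_zero _ _ _ _ he, failProb_pure]
      · exact zero_le
      · exact ⟨101, by dsimp only; omega, hQ⟩
    · intro o
      have he := (c.eval_bounded hW hm hc cc).1
      obtain ⟨b, hb⟩ := Nat.exists_eq_succ_of_ne_zero h0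
      rw [hb] at he
      obtain ⟨f, hf⟩ := exists_fuel_obind (μ := fun f => p.run W f ⟨m, o⟩)
        (κ := fun f r => ((Prog.loop c p).run W f r.1).map (Outcome.addTime (r.2 + c.cost + 1)))
        (Q := fun r => ∃ t', r.2 ≤ t' ∧ Q r.1.mem (t + t')) (q₂ := k₁ * q)
        (fun f f' h => run_optLE h _ _) (fun f => run_support_finite f _ _)
        (fun f f' h r => (run_optLE h _ _).map _) (hp o) (by
          rintro ⟨s, t₀⟩ ⟨t₁, ht₁, k', hk', hI'⟩
          obtain ⟨f, hf⟩ := ih k' (by omega) hI' s.out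
          refine ⟨f, ?_⟩
          rw [failProb_addTime]
          refine le_trans (le_trans (failProb_mono ?_) hf) ?_
          · rintro r ⟨t₂, ht₂, hr⟩
            refine ⟨t₁ + 101 + t₂, ?_, ?_⟩
            · simp only at *
              omega
            · rwa [show t + (t₁ + 101 + t₂) = t + t₁ + 101 + t₂ by ring]
          · gcongr)
      refine ⟨f + 1, ?_⟩
      rw [run_loop_succ _ _ _ _ he]
      refine le_trans hf ?_
      push_cast
      rw [add_mul, one_mul, add_comm]

theorem Tri.loop_det (hW : Fits W M) {c : Expr} {p : Prog} {Q : Mem → ℕ → Prop}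
    {I : ℕ → Mem → ℕ → Prop} (hc : c.safe = true) (cc : c.cost ≤ 100)
    (h : ∀ k m t, I k m t → MemBdd M m ∧ ((c.val m = 0 ∧ Q m (t + 101)) ∨
      (c.val m ≠ 0 ∧ ∃ k₁, k = k₁ + 1 ∧
        Tri W p m 0 (fun m' t' => ∃ k', k' ≤ k₁ ∧ I k' m' (t + t' + 101)))))
    {k : ℕ} {m : Mem} (hI : I k m 0) :
    Tri W (.loop c p) m 0 Q := by
  simpa using Tri.loop hW hc cc h hI

theorem Tri.call {p : Prog} {src dst : ℕ} {m : Mem} {q : ℝ≥0∞} {R : MState → ℕ → Prop}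
    {Q : Mem → ℕ → Prop}
    (h : ∃ f, failProb (p.run W f (MState.start (fun _ _ => 0) (m.getList src)))
      (fun r => R r.1 r.2) ≤ q)
    (hQ : ∀ s t, R s t →
      Q (m.setList dst s.out) ((m.getList src).length + t + s.out.length + 1)) :
    Tri W (.call p src dst) m q Q := by
  intro o
  obtain ⟨f, hf⟩ := h
  refine ⟨f + 1, ?_⟩
  rw [Prog.run]
  refine le_trans (le_of_eq (failProb_map _ _ _)) (le_trans (failProb_mono ?_) hf)
  intro r hr
  exact ⟨_, le_rfl, hQ _ _ hr⟩

end Tri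

/-!
The data structure.
-/

section Expressions

instance : Add Expr := ⟨Expr.op .add⟩
instance : Sub Expr := ⟨Expr.op .sub⟩
instance : Mul Expr := ⟨Expr.op .mul⟩
instance : Div Expr := ⟨Expr.op .div⟩
instance : Mod Expr := ⟨Expr.op .mod⟩

/-- `1` if `x < y`, and `0` otherwise. -/
def ltE (x y : Expr) : Expr := .op .lt x y

/-- `1` if `x = y`, and `0` otherwise. -/
def eqE (x y : Expr) : Expr := .op .eq x y

/-- `2 ^ log2 x`. -/
def topE (x : Expr) : Expr := .op .shl (.const 1) (.log2 x)

variable (m : Mem) (x y : Expr)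

@[simp] theorem val_const (c : ℕ) : (Expr.const c).val m = c := rfl
@[simp] theorem val_load (a : ℕ) : (Expr.load a x).val m = m a (x.val m) := rfl
@[simp] theorem val_add : (x + y).val m = x.val m + y.val m := rfl
@[simp] theorem val_sub : (x - y).val m = x.val m - y.val m := rfl
@[simp] theorem val_mul : (x * y).val m = x.val m * y.val m := rfl
@[simp] theorem val_div : (x / y).val m = x.val m / y.val m := rfl
@[simp] theorem val_mod : (x % y).val m = x.val m % y.val m := rfl
@[simp] theorem val_ltE : (ltE x y).val m = if x.val m < y.val m then 1 else 0 := rfl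
@[simp] theorem val_eqE : (eqE x y).val m = if x.val m = y.val m then 1 else 0 := rfl
@[simp] theorem val_topE : (topE x).val m = 2 ^ Nat.log2 (x.val m) := one_mul _

theorem Mem.set_apply (a i v b : ℕ) :
    m.set a i v b = if b = a then Function.update (m a) i v else m b := by
  funext j
  by_cases h : b = a
  · subst h
    simp [Mem.set, Function.update_apply]
  · simp [Mem.set, h]

end Expressions

/-!
The arrays are: `0` the input, `1` the maintained vector, `2` the parameters, `3` the current vector,
`4` the numbers of edges in the buckets, `5` the edges in the buckets, `6` the positions of the edges
in their buckets, `7` the numbers of edges of the buckets at the last rebuild, `8` the numbers of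
changes since then, `9` the numbers of entries of the current block that are not in use, `10` the
offsets of the current blocks, `11` the blocks, `12` and `13` input and output of the subroutine,
`14` local variables.
-/

section Program

/-- Local variable. -/
def tv (i : ℕ) : Expr := .load 14 (.const i)
/-- Parameter. -/
def pv (i : ℕ) : Expr := .load 2 (.const i)

/-- The bucket of an entry. -/
def bucketE (k : Expr) : Expr :=
  ltE k (pv 3) * (.const 1 - ltE (k * (pv 0 * pv 0)) (pv 2)) *
    (k - k % (pv 4 * topE k / pv 1 + .const 1))

/-- Remove edge `tv 0` from its bucket `tv 2`. -/
def removeP : Prog :=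
  .ite (tv 2)
    (.seq (.store 8 (tv 2) (.load 8 (tv 2) + .const 1))
    (.seq (.store 9 (tv 2) (.load 9 (tv 2) + ltE (.const 0) (.load 1 (tv 0))))
    (.seq (.store 4 (tv 2) (.load 4 (tv 2) - .const 1))
    (.seq (.store 14 (.const 4) (.load 5 (tv 2 * pv 5 + .load 4 (tv 2))))
    (.seq (.store 5 (tv 2 * pv 5 + .load 6 (tv 0)) (tv 4))
    (.store 6 (tv 4) (.load 6 (tv 0))))))))
    .skip

/-- Insert edge `tv 0` into bucket `tv 3`. -/
def insertP : Prog :=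
  .ite (tv 3)
    (.seq (.store 8 (tv 3) (.load 8 (tv 3) + .const 1))
    (.seq (.store 6 (tv 0) (.load 4 (tv 3)))
    (.seq (.store 5 (tv 3 * pv 5 + .load 4 (tv 3)) (tv 0))
    (.store 4 (tv 3) (.load 4 (tv 3) + .const 1)))))
    .skip

/-- Set the entry of edge `tv 0` to `tv 1`. -/
def setP : Prog :=
  .seq (.store 14 (.const 2) (bucketE (.load 3 (tv 0))))
  (.seq removeP
  (.seq (.store 3 (tv 0) (tv 1))
  (.seq (.store 1 (tv 0) ((.const 1 - ltE (tv 1) (pv 3)) * tv 1))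
  (.seq (.store 14 (.const 3) (bucketE (tv 1)))
  insertP))))

/-- The address of the current block of bucket `tv 5`. -/
def blockE : Expr := tv 5 * pv 5 + .load 10 (tv 5)

/-- Write `f` times the current block of bucket `tv 5` to the maintained vector, and count the
entries that do not belong to the bucket any more. -/
def walkP (f : ℕ) : Prog :=
  .seq (.store 9 (tv 5) (.const 0))
  (.seq (.store 14 (.const 6) (.const 0))
  (.loop (ltE (tv 6) (.load 11 blockE))
    (.seq (.store 14 (.const 7) (blockE + .const 1 + .const 3 * tv 6))
    (.seq (.store 14 (.const 8) (.load 11 (tv 7) * pv 0 + .load 11 (tv 7 + .const 1)))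
    (.seq (.ite (eqE (bucketE (.load 3 (tv 8))) (tv 5))
      (.store 1 (tv 8) (.const f * .load 11 (tv 7 + .const 2)))
      (.store 9 (tv 5) (.load 9 (tv 5) + .const 1)))
    (.store 14 (.const 6) (tv 6 + .const 1)))))))

/-- Pass on to the next block of bucket `tv 5`. -/
def advanceP : Prog :=
  .seq (walkP 0)
  (.seq (.store 10 (tv 5) (.load 10 (tv 5) + .const 1 + .const 3 * .load 11 blockE))
  (walkP 1))

/-- Write the content of bucket `tv 5` to the input of the subroutine. -/
def gatherP : Prog :=
  .seq (.store 12 (.const 0) (.const 4 + .const 3 * .load 4 (tv 5)))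
  (.seq (.store 12 (.const 1) (pv 0))
  (.seq (.store 12 (.const 2) (pv 1))
  (.seq (.store 12 (.const 3) (pv 2))
  (.seq (.store 12 (.const 4) (pv 3))
  (.seq (.store 14 (.const 6) (.const 0))
  (.loop (ltE (tv 6) (.load 4 (tv 5)))
    (.seq (.store 14 (.const 8) (.load 5 (tv 5 * pv 5 + tv 6)))
    (.seq (.store 12 (.const 5 + .const 3 * tv 6) (tv 8 / pv 0))
    (.seq (.store 12 (.const 6 + .const 3 * tv 6) (tv 8 % pv 0))
    (.seq (.store 12 (.const 7 + .const 3 * tv 6) (tv 5))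
    (.store 14 (.const 6) (tv 6 + .const 1))))))))))))

/-- Copy the output of the subroutine to the blocks of bucket `tv 5`. -/
def copyP : Prog :=
  .seq (.store 14 (.const 6) (.const 0))
  (.loop (ltE (tv 6) (.load 13 (.const 0)))
    (.seq (.store 11 (tv 5 * pv 5 + tv 6) (.load 13 (tv 6 + .const 1)))
    (.store 14 (.const 6) (tv 6 + .const 1))))

/-- Whether bucket `tv 5` is to be split. -/
def activeE : Expr :=
  ltE (.const 4 * pv 2) (pv 1) * ltE (.const 4 * pv 4) (pv 1) *
    (.const 1 - ltE (tv 5 * .load 4 (tv 5)) (.const 4 * pv 2))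

/-- Compute new blocks for bucket `tv 5`. -/
def rebuildP (S : Prog) : Prog :=
  .seq (walkP 0)
  (.seq (.store 8 (tv 5) (.const 0))
  (.seq (.store 7 (tv 5) (.load 4 (tv 5)))
  (.seq (.store 9 (tv 5) (.const 0))
  (.seq (.store 10 (tv 5) (.const 0))
  (.ite activeE
    (.seq gatherP (.seq (.call S 12 13) (.seq copyP (walkP 1))))
    (.store 11 (tv 5 * pv 5) (.const 0)))))))

/-- Restore the invariants of bucket `tv 5`. -/
def fixP (S : Prog) : Prog :=
  .ite (tv 5)
    (.seq (.ite (ltE (.load 7 (tv 5) * pv 4) (.load 8 (tv 5) * pv 1)) (rebuildP S) .skip)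
    (.loop (ltE (.const 2 * pv 4 * .load 11 blockE) (.load 9 (tv 5) * pv 1)) advanceP))
    .skip

def initP (S : Prog) : Prog :=
  .seq (.store 2 (.const 0) (.load 0 (.const 1)))
  (.seq (.store 2 (.const 1) (.load 0 (.const 2)))
  (.seq (.store 2 (.const 2) (.load 0 (.const 3)))
  (.seq (.store 2 (.const 3) (.load 0 (.const 4)))
  (.seq (.store 2 (.const 4) (.load 0 (.const 5)))
  (.seq (.store 2 (.const 5) (.const 4 * (pv 0 * pv 0) + .const 4))
  (.seq (.store 14 (.const 9) (.const 5))
  (.seq (.loop (ltE (tv 9) (.load 0 (.const 0)))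
    (.seq (.store 14 (.const 0) (.load 0 (tv 9 + .const 1) * pv 0 + .load 0 (tv 9 + .const 2)))
    (.seq (.store 14 (.const 1) (.load 0 (tv 9 + .const 3)))
    (.seq setP
    (.store 14 (.const 9) (tv 9 + .const 3))))))
  (.seq (.store 14 (.const 9) (.const 5))
  (.loop (ltE (tv 9) (.load 0 (.const 0)))
    (.seq (.store 14 (.const 5) (bucketE (.load 0 (tv 9 + .const 3))))
    (.seq (fixP S)
    (.store 14 (.const 9) (tv 9 + .const 3)))))))))))))

def updateP (S : Prog) : Prog :=
  .seq (.store 14 (.const 0) (.load 0 (.const 1) * pv 0 + .load 0 (.const 2)))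
  (.seq (.store 14 (.const 1) (.load 0 (.const 3)))
  (.seq setP
  (.seq (.store 14 (.const 5) (tv 2))
  (.seq (fixP S)
  (.seq (.store 14 (.const 5) (tv 3))
  (fixP S))))))

/-- Maintain a coarsening with the help of the static algorithm `S`. -/
def coarseningAlg (S : Prog) : DynAlg := ⟨initP S, updateP S⟩

theorem walkP_deterministic (f : ℕ) : (walkP f).Deterministic := by
  simp [walkP, Prog.Deterministic]

theorem setP_deterministic : setP.Deterministic := by
  simp [setP, removeP, insertP, Prog.Deterministic]

theorem fixP_deterministic {S : Prog} (h : S.Deterministic) : (fixP S).Deterministic := by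
  simp [fixP, rebuildP, gatherP, copyP, advanceP, Prog.Deterministic, walkP_deterministic, h]

theorem coarseningAlg_deterministic {S : Prog} (h : S.Deterministic) :
    (coarseningAlg S).Deterministic := by
  simp [coarseningAlg, DynAlg.Deterministic, initP, updateP, Prog.Deterministic,
    fixP_deterministic h, setP_deterministic]

end Program

/-! ### Parameters, word bounds and addresses of edges. -/

section Parameters

/-- The parameters, with `γ = g / D`, `δ = d / D` and `ε = e / D`. -/
structure Par where
  n : ℕ
  D : ℕ
  g : ℕ
  d : ℕ
  e : ℕ
  two_le : 2 ≤ n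
  g_pos : 0 < g
  g_lt : g < D
  d_pos : 0 < d
  e_pos : 0 < e
  e_lt : e < D

namespace Par

variable (P : Par)

/-- The space reserved for each bucket. -/
def st : ℕ := 4 * (P.n * P.n) + 4

/-- A bound on all words in the memory. -/
def M : ℕ := 100 * (P.n + P.D + P.d + 2) ^ 4

/-- The width of the buckets, minus `1`, at `k`. -/
def width (k : ℕ) : ℕ := P.e * 2 ^ Nat.log2 k / P.D

/-- The bucket of an entry, which is `0` for large and for tiny entries. -/
def bk (k : ℕ) : ℕ :=
  if k < P.d ∧ P.g ≤ k * (P.n * P.n) then k - k % (P.width k + 1) else 0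

theorem bk_le (k : ℕ) : P.bk k ≤ k := by
  unfold bk
  split_ifs
  exacts [Nat.sub_le _ _, Nat.zero_le _]

theorem bk_lt_of_ne {k : ℕ} (h : P.bk k ≠ 0) : k < P.d := by
  unfold bk at h
  split_ifs at h with h1
  exacts [h1.1, absurd rfl h]

/-- Room for `D + 1` rows of `st` words, with slack for offsets, and for entries below `2d`. All
this is cubic in `n + D + d + 2`, so the fourth power in `M` is ample. -/
theorem bound_poly : (P.D + 1) * (P.st + 5) + P.st + 20 + P.d * 2 ≤ P.M := by
  have h1 := P.two_le
  obtain ⟨b, hb⟩ : ∃ b, b = P.n + P.D + P.d + 2 := ⟨_, rfl⟩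
  unfold M st
  rw [← hb]
  have hn : P.n * P.n ≤ b * b := Nat.mul_le_mul (by omega) (by omega)
  have hD : P.D + 1 ≤ b := by omega
  have hd : P.d ≤ b := by omega
  have hb4 : 4 ≤ b := by omega
  have h2 : b ≤ b ^ 4 := Nat.le_self_pow (by norm_num) b
  have h3 : b * b ≤ b ^ 4 := by rw [← pow_two]; exact Nat.pow_le_pow_right (by omega) (by norm_num)
  have h4 : b * (b * b) ≤ b ^ 4 := by
    calc b * (b * b) = b ^ 3 := by ring
      _ ≤ _ := Nat.pow_le_pow_right (by omega) (by norm_num)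
  have h5 : (P.D + 1) * (4 * (P.n * P.n) + 4 + 5) ≤ b * (4 * (b * b) + 9) :=
    Nat.mul_le_mul hD (by omega)
  have h6 : b * (4 * (b * b) + 9) = 4 * (b * (b * b)) + 9 * b := by ring
  omega

theorem idx_le {μ j : ℕ} (hμ : μ ≤ P.D) (hj : j ≤ P.st + 20) : μ * P.st + j ≤ P.M := by
  have h := P.bound_poly
  have h1 : μ * P.st ≤ P.D * P.st := Nat.mul_le_mul_right _ hμ
  have h2 : (P.D + 1) * (P.st + 5) = P.D * P.st + 5 * P.D + P.st + 5 := by ring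
  omega

theorem D_le : P.D ≤ P.M := by
  have := P.bound_poly
  have h2 : (P.D + 1) * (P.st + 5) = P.D * P.st + 5 * P.D + P.st + 5 := by ring
  have := P.e_lt
  omega

theorem d_le : P.d * 2 ≤ P.M := by
  have := P.bound_poly
  omega

theorem st_le : P.st + 20 ≤ P.M := by
  have := P.bound_poly
  omega

theorem n_le : P.n * P.n ≤ P.st := by unfold st; omega

theorem n_le' : P.n ≤ P.st := le_trans (Nat.le_mul_self _) P.n_le

/-- With `b = n + D + d + 2 ≥ 7` one has `100 ≤ b ^ 3`, hence `M ≤ b ^ 7`, and the hundredth power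
stays below `b ^ K`. -/
theorem fits {K W : ℕ} (hK : 1000 ≤ K) (h : (P.n + P.D + P.d + 2) ^ K ≤ 2 ^ W) :
    Fits W P.M := by
  have h1 := P.two_le
  have h2 := P.g_lt
  have h3 := P.d_pos
  have h4 := P.g_pos
  obtain ⟨b, hb⟩ : ∃ b, b = P.n + P.D + P.d + 2 := ⟨_, rfl⟩
  rw [← hb] at h
  have hb7 : 7 ≤ b := by omega
  have hM : P.M ≤ b ^ 7 := by
    unfold M
    rw [← hb]
    calc 100 * b ^ 4 ≤ b ^ 3 * b ^ 4 := Nat.mul_le_mul_right _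
          (le_trans (by norm_num) (Nat.pow_le_pow_left hb7 3))
      _ = b ^ 7 := by ring
  constructor
  · have := P.st_le
    unfold M
    have : 1 ≤ (P.n + P.D + P.d + 2) ^ 4 := Nat.one_le_pow _ _ (by omega)
    omega
  · calc P.M ^ 100 ≤ (b ^ 7) ^ 100 := Nat.pow_le_pow_left hM _
      _ = b ^ 700 := by rw [← pow_mul]
      _ < b ^ K := Nat.pow_lt_pow_right (by omega) (lt_of_lt_of_le (by norm_num) hK)
      _ ≤ _ := h

/-- Rows of length `st` do not overlap, so data of different buckets cannot interfere. -/
theorem idx_inj {a b i j : ℕ} (hi : i < P.st) (hj : j < P.st)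
    (h : a * P.st + i = b * P.st + j) : a = b ∧ i = j := by
  have h0 : 0 < P.st := by omega
  have h1 : a = b := by
    have := congrArg (· / P.st) h
    simpa [Nat.add_div_of_dvd_right, Nat.mul_div_cancel _ h0, Nat.div_eq_of_lt hi,
      Nat.div_eq_of_lt hj, Nat.add_comm, Nat.add_mul_div_right _ _ h0] using this
  subst h1
  exact ⟨rfl, by omega⟩

/-- The parameters are stored in the memory. -/
structure InMem (m : Mem) : Prop where
  n : m 2 0 = P.n
  D : m 2 1 = P.D
  g : m 2 2 = P.g
  d : m 2 3 = P.d
  e : m 2 4 = P.e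
  st : m 2 5 = P.st

variable {P}

theorem InMem.congr {m m' : Mem} (h : P.InMem m) (h2 : m' 2 = m 2) : P.InMem m' := by
  constructor <;> rw [h2]
  exacts [h.n, h.D, h.g, h.d, h.e, h.st]

/-- The two conditions for a nonzero bucket are multiplied as `0`-`1` values; the second one, `≤`,
is a truncated `1 - lt`. -/
theorem InMem.bucketE {m : Mem} (h : P.InMem m) (x : Expr) :
    (bucketE x).val m = P.bk (x.val m) := by
  simp only [_root_.bucketE, pv, val_mul, val_sub, val_const, val_ltE, val_load, val_mod, val_div,
    val_add, val_topE, h.n, h.D, h.g, h.d, h.e, Par.bk, Par.width]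
  rcases lt_or_ge (x.val m * (P.n * P.n)) P.g with h2 | h2
  · simp [h2, not_le.2 h2]
  · by_cases h1 : x.val m < P.d <;> simp [h1, h2, not_lt.2 h2]

end Par

/-- The index of an edge. -/
def addr {n : ℕ} (e : Edge n) : ℕ := (e.1.1 : ℕ) * n + (e.1.2 : ℕ)

theorem addr_lt {n : ℕ} (e : Edge n) : addr e < n * n := by
  have h1 := e.1.1.2
  have h2 := e.1.2.2
  unfold addr
  calc (e.1.1 : ℕ) * n + e.1.2 < (e.1.1 : ℕ) * n + n := by omega
    _ = ((e.1.1 : ℕ) + 1) * n := by ring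
    _ ≤ n * n := Nat.mul_le_mul_right _ h1

theorem addr_div {n : ℕ} (e : Edge n) : addr e / n = e.1.1 := by
  have h2 := e.1.2.2
  unfold addr
  rw [Nat.add_comm, Nat.add_mul_div_right _ _ (by omega), Nat.div_eq_of_lt h2, zero_add]

theorem addr_mod {n : ℕ} (e : Edge n) : addr e % n = e.1.2 := by
  unfold addr
  rw [Nat.mul_add_mod_self_right, Nat.mod_eq_of_lt e.1.2.2]

theorem addr_inj {n : ℕ} {e e' : Edge n} (h : addr e = addr e') : e = e' := by
  have h1 := addr_div e
  have h2 := addr_mod e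
  rw [h] at h1 h2
  rw [addr_div] at h1
  rw [addr_mod] at h2
  exact Subtype.ext (Prod.ext (Fin.ext h1.symm) (Fin.ext h2.symm))

theorem card_edge_le (n : ℕ) : Fintype.card (Edge n) ≤ n * n := by
  have := Fintype.card_subtype_le fun e : Fin n × Fin n => e.1 < e.2
  simpa using this

end Parameters

/-! ### Edge lists of the buckets with constant-time insertion and deletion. -/

section Listing

/-- The edges of each bucket `μ ≠ 0` are listed in `L` from the index `μ * st` on; `pos` are the
positions of the edges, and `len` the sizes of the buckets. -/
structure Listing {n : ℕ} (st : ℕ) (len L pos : ℕ → ℕ) (β : Edge n → ℕ) : Prop where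
  mem : ∀ e, β e ≠ 0 → pos (addr e) < len (β e) ∧ L (β e * st + pos (addr e)) = addr e
  get : ∀ μ, μ ≠ 0 → ∀ j, j < len μ → ∃ e, β e = μ ∧ L (μ * st + j) = addr e ∧ pos (addr e) = j

variable {P : Par} {len L pos : ℕ → ℕ} {β : Edge P.n → ℕ}

theorem Listing.len_eq (h : Listing P.st len L pos β) {μ : ℕ} (hμ : μ ≠ 0) :
    len μ = (Finset.univ.filter fun e => β e = μ).card := by
  rw [← Finset.card_range (len μ)]
  symm
  refine Finset.card_bij (fun e _ => pos (addr e)) ?_ ?_ ?_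
  · intro e he
    simp only [Finset.mem_filter, Finset.mem_univ, true_and] at he
    subst he
    exact Finset.mem_range.2 (h.mem e hμ).1
  · intro e he e' he' hh
    simp only [Finset.mem_filter, Finset.mem_univ, true_and] at he he'
    subst he
    have h1 := (h.mem e hμ).2
    have h2 := (h.mem e' (by rwa [he'])).2
    rw [he', ← hh, h1] at h2
    exact addr_inj h2
  · intro j hj
    obtain ⟨e, h1, h2, h3⟩ := h.get μ hμ j (Finset.mem_range.1 hj)
    exact ⟨e, by simpa using h1, h3⟩

theorem Listing.len_le (h : Listing P.st len L pos β) {μ : ℕ} (hμ : μ ≠ 0) :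
    len μ ≤ P.n * P.n := by
  rw [h.len_eq hμ]
  exact le_trans (Finset.card_le_univ _) (card_edge_le _)

theorem Listing.len_lt (h : Listing P.st len L pos β) {μ : ℕ} (hμ : μ ≠ 0) : len μ < P.st := by
  have := h.len_le hμ
  unfold Par.st
  omega

/-- The last edge of the bucket moves to the freed position. If the removed edge is itself the last
one, the two writes only concern a position and an edge that no longer count. -/
theorem Listing.remove (h : Listing P.st len L pos β) {e₀ : Edge P.n} {μ₀ last : ℕ}
    (hμ : β e₀ = μ₀) (h0 : μ₀ ≠ 0) (hl : last = L (μ₀ * P.st + (len μ₀ - 1))) :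
    Listing P.st (Function.update len μ₀ (len μ₀ - 1))
      (Function.update L (μ₀ * P.st + pos (addr e₀)) last)
      (Function.update pos last (pos (addr e₀))) (Function.update β e₀ 0) := by
  have hne : β e₀ ≠ 0 := by rwa [hμ]
  obtain ⟨hp, hL⟩ := h.mem e₀ hne
  rw [hμ] at hp hL
  obtain ⟨e₁, hβ₁, hL₁, hp₁⟩ := h.get μ₀ h0 (len μ₀ - 1) (by omega)
  have hlast : last = addr e₁ := by rw [hl, hL₁]
  subst hlast
  have hlt := h.len_lt h0
  constructor
  · intro e he
    by_cases hee : e = e₀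
    · subst hee; simp at he
    rw [Function.update_of_ne hee] at he ⊢
    obtain ⟨h1, h2⟩ := h.mem e he
    have hlt' := h.len_lt he
    by_cases he1 : e = e₁
    · subst he1
      have : pos (addr e₀) ≠ len μ₀ - 1 := by
        intro hh
        rw [hh, hL₁] at hL
        exact hee (addr_inj hL)
      rw [Function.update_self, hβ₁, Function.update_self, Function.update_self]
      exact ⟨by omega, rfl⟩
    · rw [Function.update_of_ne (fun hh => he1 (addr_inj hh))]
      have hidx : β e * P.st + pos (addr e) ≠ μ₀ * P.st + pos (addr e₀) := by
        intro hh
        obtain ⟨ha, hb⟩ := P.idx_inj (by omega) (by omega) hh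
        rw [ha, hb, hL] at h2
        exact hee (addr_inj h2).symm
      rw [Function.update_of_ne hidx]
      refine ⟨?_, h2⟩
      by_cases hb : β e = μ₀
      · rw [hb, Function.update_self]
        have : pos (addr e) ≠ len μ₀ - 1 := by
          intro hh
          rw [hb, hh, hL₁] at h2
          exact he1 (addr_inj h2).symm
        rw [hb] at h1
        omega
      · rwa [Function.update_of_ne hb]
  · intro μ hμ0 j hj
    by_cases hm : μ = μ₀
    · subst hm
      rw [Function.update_self] at hj
      by_cases hj0 : j = pos (addr e₀)
      · subst hj0
        have he10 : e₁ ≠ e₀ := by rintro rfl; omega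
        exact ⟨e₁, by rw [Function.update_of_ne he10, hβ₁], by rw [Function.update_self],
          by rw [Function.update_self]⟩
      · obtain ⟨e, h1, h2, h3⟩ := h.get μ hμ0 j (by omega)
        have he0 : e ≠ e₀ := by rintro rfl; exact hj0 h3.symm
        have he1 : e ≠ e₁ := by rintro rfl; omega
        refine ⟨e, by rw [Function.update_of_ne he0, h1], ?_, ?_⟩
        · rw [Function.update_of_ne (by omega), h2]
        · rw [Function.update_of_ne (fun hh => he1 (addr_inj hh)), h3]
    · rw [Function.update_of_ne hm] at hj
      obtain ⟨e, h1, h2, h3⟩ := h.get μ hμ0 j hj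
      have he0 : e ≠ e₀ := by rintro rfl; exact hm (h1.symm.trans hμ)
      have he1 : e ≠ e₁ := by rintro rfl; exact hm (h1.symm.trans hβ₁)
      have := h.len_lt hμ0
      refine ⟨e, by rw [Function.update_of_ne he0, h1], ?_, ?_⟩
      · rw [Function.update_of_ne, h2]
        intro hh
        exact hm (P.idx_inj (by omega) (by omega) hh).1
      · rw [Function.update_of_ne (fun hh => he1 (addr_inj hh)), h3]

theorem Listing.insert (h : Listing P.st len L pos β) {e₀ : Edge P.n} {μ₀ : ℕ}
    (h0 : β e₀ = 0) (hμ : μ₀ ≠ 0) :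
    Listing P.st (Function.update len μ₀ (len μ₀ + 1))
      (Function.update L (μ₀ * P.st + len μ₀) (addr e₀))
      (Function.update pos (addr e₀) (len μ₀)) (Function.update β e₀ μ₀) := by
  have hlt := h.len_lt hμ
  constructor
  · intro e he
    by_cases hee : e = e₀
    · subst hee
      simp
    rw [Function.update_of_ne hee] at he ⊢
    obtain ⟨h1, h2⟩ := h.mem e he
    have hlt' := h.len_lt he
    rw [Function.update_of_ne (fun hh => hee (addr_inj hh))]
    have hidx : β e * P.st + pos (addr e) ≠ μ₀ * P.st + len μ₀ := by
      intro hh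
      obtain ⟨ha, hb⟩ := P.idx_inj (by omega) (by omega) hh
      rw [ha] at h1
      omega
    rw [Function.update_of_ne hidx]
    refine ⟨?_, h2⟩
    by_cases hb : β e = μ₀
    · rw [hb, Function.update_self]
      rw [hb] at h1
      omega
    · rwa [Function.update_of_ne hb]
  · intro μ hμ0 j hj
    by_cases hm : μ = μ₀ ∧ j = len μ₀
    · obtain ⟨rfl, rfl⟩ := hm
      exact ⟨e₀, by simp, by simp, by simp⟩
    · have hj' : j < len μ := by
        by_cases hm' : μ = μ₀
        · subst hm'
          rw [Function.update_self] at hj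
          have : j ≠ len μ := fun hh => hm ⟨rfl, hh⟩
          omega
        · rwa [Function.update_of_ne hm'] at hj
      obtain ⟨e, h1, h2, h3⟩ := h.get μ hμ0 j hj'
      have he0 : e ≠ e₀ := by rintro rfl; exact hμ0 (h1.symm.trans h0)
      have := h.len_lt hμ0
      refine ⟨e, by rw [Function.update_of_ne he0, h1], ?_, ?_⟩
      · rw [Function.update_of_ne, h2]
        intro hh
        exact hm (P.idx_inj (by omega) (by omega) hh)
      · rw [Function.update_of_ne (fun hh => he0 (addr_inj hh)), h3]

end Listing

/-! ### Changing a single entry. -/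

section SetP

variable {P : Par} {W : ℕ}

theorem tri_removeP (hW : Fits W P.M) {m : Mem} {β : Edge P.n → ℕ} {e : Edge P.n}
    (hp : P.InMem m) (hb : MemBdd P.M m) (hl : Listing P.st (m 4) (m 5) (m 6) β)
    (ha : m 14 0 = addr e) (h2 : m 14 2 = β e)
    (hc : β e ≠ 0 → m 8 (β e) ≤ P.st ∧ m 9 (β e) ≤ P.st) :
    Tri W removeP m 0 fun m' t => t ≤ 1500 ∧ MemBdd P.M m' ∧
      Listing P.st (m' 4) (m' 5) (m' 6) (Function.update β e 0) ∧
      (∀ μ, m' 8 μ = m 8 μ + if β e ≠ 0 ∧ μ = β e then 1 else 0) ∧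
      (∀ μ, m' 9 μ = m 9 μ + if β e ≠ 0 ∧ μ = β e ∧ m 1 (addr e) ≠ 0 then 1 else 0) ∧
      (∀ a, a ∉ [4, 5, 6, 8, 9, 14] → m' a = m a) ∧ ∀ i, i ≠ 4 → m' 14 i = m 14 i := by
  have hst := P.st_le
  unfold removeP
  refine Tri.ite hW hb ?_ ?_
  · intro h
    have h0 : β e ≠ 0 := by simpa [tv, h2] using h
    obtain ⟨hc8, hc9⟩ := hc h0
    have hw := hb
    refine Tri.store_seq hW hb (β e) (m 8 (β e) + 1) (by simp [tv, h2])
      (by simp [tv, h2]) (by omega) fun hb => ?_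
    -- An edge of a bucket has a nonzero output exactly if it is a live entry of the current block,
    -- so this is when its departure creates a new dead entry.
    refine Tri.store_seq hW hb (β e) (m 9 (β e) + if 0 < m 1 (addr e) then 1 else 0)
      (by simp [tv, h2, Mem.set_apply]) (by simp [tv, h2, ha, Mem.set_apply])
      (by split_ifs <;> omega) fun hb => ?_
    refine Tri.store_seq hW hb (β e) (m 4 (β e) - 1)
      (by simp [tv, h2, Mem.set_apply]) (by simp [tv, h2, Mem.set_apply])
      (le_trans (Nat.sub_le _ _) (hw _ _)) fun hb => ?_
    refine Tri.store_seq hW hb 4 (m 5 (β e * P.st + (m 4 (β e) - 1)))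
      (by simp) (by simp [tv, pv, h2, hp.st, Mem.set_apply]) (hw _ _) fun hb => ?_
    refine Tri.store_seq hW hb (β e * P.st + m 6 (addr e)) (m 5 (β e * P.st + (m 4 (β e) - 1)))
      (by simp [tv, pv, h2, ha, hp.st, Mem.set_apply]) (by simp [tv, Mem.set_apply]) (hw _ _)
      fun hb => ?_
    refine Tri.store hW hb (m 5 (β e * P.st + (m 4 (β e) - 1))) (m 6 (addr e))
      (by simp [tv, Mem.set_apply]) (by simp [tv, ha, Mem.set_apply]) (hw _ _)
      fun hb => ⟨by norm_num, hb, ?_, ?_, ?_, ?_, ?_⟩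
    · simpa [Mem.set_apply] using hl.remove rfl h0 rfl
    · intro μ
      by_cases hμ : μ = β e <;> simp [Mem.set_apply, hμ, h0]
    · intro μ
      by_cases hμ : μ = β e <;>
        simp [Mem.set_apply, hμ, h0, Nat.pos_iff_ne_zero]
    · intro a h
      simp only [List.mem_cons, not_or, List.not_mem_nil] at h
      simp [Mem.set_apply, h]
    · intro i hi
      simp [Mem.set_apply, hi]
  · intro h
    have h0 : β e = 0 := by simpa [tv, h2] using h
    refine Tri.skip ⟨by norm_num, hb, ?_, ?_, ?_, ?_, ?_⟩
    · rw [← h0, Function.update_eq_self]; exact hl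
    all_goals simp [h0]

theorem tri_insertP (hW : Fits W P.M) {m : Mem} {β : Edge P.n → ℕ} {e : Edge P.n} {μ₀ : ℕ}
    (hp : P.InMem m) (hb : MemBdd P.M m) (hl : Listing P.st (m 4) (m 5) (m 6) β) (h0 : β e = 0)
    (ha : m 14 0 = addr e) (h3 : m 14 3 = μ₀) (hc : μ₀ ≠ 0 → m 8 μ₀ ≤ P.st + 1) :
    Tri W insertP m 0 fun m' t => t ≤ 1500 ∧ MemBdd P.M m' ∧
      Listing P.st (m' 4) (m' 5) (m' 6) (Function.update β e μ₀) ∧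
      (∀ μ, m' 8 μ = m 8 μ + if μ₀ ≠ 0 ∧ μ = μ₀ then 1 else 0) ∧
      (∀ a, a ∉ [4, 5, 6, 8] → m' a = m a) := by
  have hst := P.st_le
  unfold insertP
  refine Tri.ite hW hb ?_ ?_
  · intro h
    have hμ : μ₀ ≠ 0 := by simpa [tv, h3] using h
    have hc8 := hc hμ
    have hw := hb
    have hlen := hl.len_lt hμ
    refine Tri.store_seq hW hb μ₀ (m 8 μ₀ + 1) (by simp [tv, h3])
      (by simp [tv, h3]) (by omega) fun hb => ?_
    refine Tri.store_seq hW hb (addr e) (m 4 μ₀)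
      (by simp [tv, ha, Mem.set_apply]) (by simp [tv, h3, Mem.set_apply]) (hw _ _) fun hb => ?_
    refine Tri.store_seq hW hb (μ₀ * P.st + m 4 μ₀) (addr e)
      (by simp [tv, pv, h3, hp.st, Mem.set_apply]) (by simp [tv, ha, Mem.set_apply])
      (by rw [← ha]; exact hw _ _) fun hb => ?_
    refine Tri.store hW hb μ₀ (m 4 μ₀ + 1)
      (by simp [tv, h3, Mem.set_apply]) (by simp [tv, h3, Mem.set_apply]) (by omega)
      fun hb => ⟨by norm_num, hb, ?_, ?_, ?_⟩
    · simpa [Mem.set_apply] using hl.insert h0 hμ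
    · intro μ
      by_cases hμ : μ = μ₀ <;> simp_all [Mem.set_apply]
    · intro a h
      simp only [List.mem_cons, not_or, List.not_mem_nil] at h
      simp [Mem.set_apply, h]
  · intro h
    have hμ : μ₀ = 0 := by simpa [tv, h3] using h
    refine Tri.skip ⟨by norm_num, hb, ?_, ?_, ?_⟩
    · rw [hμ, ← h0, Function.update_eq_self]; exact hl
    all_goals simp [hμ]

/-- The effect of `setP` on the memory. -/
structure SetPost (P : Par) (m : Mem) (X : Edge P.n → ℕ) (e : Edge P.n) (ν : ℕ) (m' : Mem) :
    Prop where
  bdd : MemBdd P.M m'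
  frame : ∀ a, a ∉ [1, 3, 4, 5, 6, 8, 9, 14] → m' a = m a
  vec : m' 3 = Function.update (m 3) (addr e) ν
  out : m' 1 = Function.update (m 1) (addr e) (if ν < P.d then 0 else ν)
  list : Listing P.st (m' 4) (m' 5) (m' 6) fun e' => P.bk (Function.update X e ν e')
  cnt : ∀ μ, m' 8 μ = m 8 μ + (if P.bk (X e) ≠ 0 ∧ μ = P.bk (X e) then 1 else 0) +
    if P.bk ν ≠ 0 ∧ μ = P.bk ν then 1 else 0
  dcur : ∀ μ, m' 9 μ = m 9 μ +
    if P.bk (X e) ≠ 0 ∧ μ = P.bk (X e) ∧ m 1 (addr e) ≠ 0 then 1 else 0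
  old : m' 14 2 = P.bk (X e)
  new : m' 14 3 = P.bk ν
  ptr : m' 14 9 = m 14 9

/-- The edge is removed before the output is overwritten, because the removal has to see whether the
entry was in use. A change inside one bucket is treated as removal and insertion, and counts twice.
The bounds `hc` on the counters leave room for these increments. -/
theorem tri_setP (hW : Fits W P.M) {m : Mem} {X : Edge P.n → ℕ} {e : Edge P.n} {ν : ℕ}
    (hp : P.InMem m) (hb : MemBdd P.M m) (hx : ∀ e, m 3 (addr e) = X e) (hX : X e ≤ P.D)
    (hl : Listing P.st (m 4) (m 5) (m 6) fun e => P.bk (X e))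
    (ha : m 14 0 = addr e) (h1 : m 14 1 = ν) (hν : ν ≤ P.D)
    (hc : ∀ μ, μ ≠ 0 → m 8 μ ≤ P.st ∧ m 9 μ ≤ P.st) :
    Tri W setP m 0 fun m' t => t ≤ 5000 ∧ SetPost P m X e ν m' := by
  have hD := P.D_le
  unfold setP
  refine Tri.store_seq hW hb 2 (P.bk (X e)) rfl (by rw [hp.bucketE]; simp [tv, ha, hx])
    (le_trans (P.bk_le _) (by omega)) fun hb => ?_
  refine Tri.seq_det (tri_removeP hW (β := fun e => P.bk (X e)) (e := e)
    (hp.congr (by simp [Mem.set_apply])) hb (by simpa [Mem.set_apply] using hl)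
    (by simp [Mem.set_apply, ha]) (by simp [Mem.set_apply])
    (by simpa [Mem.set_apply] using hc _)) ?_
  rintro m₁ t₁ ⟨ht₁, hb₁, hl₁, h8₁, h9₁, hf₁, h14₁⟩
  simp only [Mem.set_apply] at hf₁ h14₁ h8₁ h9₁
  have hp₁ : P.InMem m₁ := hp.congr (by rw [hf₁ 2 (by decide)]; simp)
  have e0 : m₁ 14 0 = addr e := by rw [h14₁ 0 (by decide)]; simp [ha]
  have e1 : m₁ 14 1 = ν := by rw [h14₁ 1 (by decide)]; simp [h1]
  refine Tri.store_seq hW hb₁ (addr e) ν (by simp [tv, e0]) (by simp [tv, e1])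
    (by omega) fun hb => ?_
  refine Tri.store_seq hW hb (addr e) (if ν < P.d then 0 else ν)
    (by simp [tv, e0, Mem.set_apply])
    (by by_cases hd : ν < P.d <;> simp [tv, pv, e1, hp₁.d, Mem.set_apply, hd])
    (by split_ifs <;> omega) fun hb => ?_
  refine Tri.store_seq hW hb 3 (P.bk ν) rfl
    (by rw [(hp₁.congr (by simp [Mem.set_apply])).bucketE]; simp [tv, e1, Mem.set_apply])
    (le_trans (P.bk_le _) (by omega)) fun hb => ?_
  refine (tri_insertP hW (β := Function.update (fun e => P.bk (X e)) e 0) (e := e) (μ₀ := P.bk ν)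
    (hp₁.congr (by simp [Mem.set_apply])) hb
    (by simpa [Mem.set_apply] using hl₁) (by simp) (by simp [Mem.set_apply, e0])
    (by simp [Mem.set_apply]) ?_).imp ?_
  · intro hne
    have := (hc _ hne).1
    simp only [Mem.set_apply]
    simp [h8₁]
    split_ifs <;> omega
  · rintro m₂ t₂ ⟨ht₂, hb₂, hl₂, h8₂, hf₂⟩
    simp only [Mem.set_apply] at hf₂ h8₂
    refine ⟨by omega, hb₂, ?_, ?_, ?_, ?_, ?_, ?_, ?_, ?_, ?_⟩
    · intro a h
      simp only [List.mem_cons, not_or, List.not_mem_nil] at h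
      rw [hf₂ a (by simp [h]), hf₁ a (by simp [h])]
      simp [h]
    · rw [hf₂ 3 (by decide)]; simp [hf₁]
    · rw [hf₂ 1 (by decide)]; simp [hf₁]
    · convert hl₂ using 1
      funext e'
      by_cases h : e' = e
      · subst h; simp
      · simp [h]
    · intro μ
      rw [h8₂]
      simp [h8₁]
    · intro μ
      rw [hf₂ 9 (by decide)]
      simp [h9₁]
    · rw [hf₂ 14 (by decide)]
      simp [h14₁]
    · rw [hf₂ 14 (by decide)]
      simp
    · rw [hf₂ 14 (by decide)]
      simp [h14₁]

end SetP

/-! ### Lists and encoded vectors in arrays. -/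

section Holds

/-- The array `a` contains the list `l` from the index `off` on. -/
def Holds (a : ℕ → ℕ) (off : ℕ) (l : List ℕ) : Prop :=
  ∀ i (h : i < l.length), a (off + i) = l[i]

theorem Holds.congr {a b : ℕ → ℕ} {off : ℕ} {l : List ℕ} (h : Holds a off l)
    (hab : ∀ i, i < l.length → b (off + i) = a (off + i)) : Holds b off l :=
  fun i hi => (hab i hi).trans (h i hi)

theorem holds_nil (a : ℕ → ℕ) (off : ℕ) : Holds a off [] := by
  intro i h
  simp at h

theorem holds_cons {a : ℕ → ℕ} {off x : ℕ} {l : List ℕ} :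
    Holds a off (x :: l) ↔ a off = x ∧ Holds a (off + 1) l := by
  constructor
  · intro h
    refine ⟨h 0 (Nat.succ_pos _), fun i hi => ?_⟩
    have := h (i + 1) (by simpa using hi)
    rw [show off + 1 + i = off + (i + 1) by ring, this]
    simp
  · rintro ⟨h1, h2⟩ (_ | i) hi
    · simpa using h1
    · rw [show off + (i + 1) = off + 1 + i by ring, h2 i (by simpa using hi)]
      simp

theorem holds_append {a : ℕ → ℕ} {off : ℕ} {l l' : List ℕ} :
    Holds a off (l ++ l') ↔ Holds a off l ∧ Holds a (off + l.length) l' := by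
  induction l generalizing off with
  | nil => simp [holds_nil]
  | cons x l ih =>
    rw [List.cons_append, holds_cons, holds_cons, ih, and_assoc, List.length_cons,
      show off + 1 + l.length = off + (l.length + 1) by ring]

variable {n : ℕ}

theorem encodeVec_length (l : List (Edge n × ℕ)) : (encodeVec l).length = 3 * l.length := by
  induction l with
  | nil => rfl
  | cons x l ih =>
    unfold encodeVec at *
    rw [List.flatMap_cons, List.length_append, ih]
    simp
    ring

theorem holds_encodeVec {a : ℕ → ℕ} {off : ℕ} {l : List (Edge n × ℕ)} :
    Holds a off (encodeVec l) ↔ ∀ i (h : i < l.length),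
      a (off + 3 * i) = l[i].1.1.1 ∧ a (off + 3 * i + 1) = l[i].1.1.2 ∧
        a (off + 3 * i + 2) = l[i].2 := by
  induction l generalizing off with
  | nil => simp [encodeVec, holds_nil]
  | cons x l ih =>
    have h0 : encodeVec (x :: l) = (x.1.1.1 : ℕ) :: (x.1.1.2 : ℕ) :: x.2 :: encodeVec l := by
      simp [encodeVec]
    rw [h0, holds_cons, holds_cons, holds_cons, ih]
    constructor
    · rintro ⟨h1, h2, h3, h4⟩ (_ | i) hi
      · exact ⟨by simpa using h1, by simpa using h2, by simpa using h3⟩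
      · have := h4 i (by simpa using hi)
        rw [show off + 3 * (i + 1) = off + 1 + 1 + 1 + 3 * i by ring]
        simpa using this
    · intro h
      have h1 := h 0 (by simp)
      refine ⟨by simpa using h1.1, by simpa using h1.2.1, by simpa using h1.2.2, fun i hi => ?_⟩
      have := h (i + 1) (by simpa using hi)
      rw [show off + 3 * (i + 1) = off + 1 + 1 + 1 + 3 * i by ring] at this
      simpa using this

theorem encodeVecs_cons (b : List (Edge n × ℕ)) (bs : List (List (Edge n × ℕ))) :
    encodeVecs (b :: bs) = b.length :: (encodeVec b ++ encodeVecs bs) := by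
  simp [encodeVecs]

theorem encodeVecs_length (bs : List (List (Edge n × ℕ))) :
    (encodeVecs bs).length = bs.length + 3 * bs.flatten.length := by
  induction bs with
  | nil => rfl
  | cons b bs ih =>
    rw [encodeVecs_cons, List.length_cons, List.length_append, ih, encodeVec_length,
      List.flatten_cons, List.length_append, List.length_cons]
    ring

theorem getList_eq_of_holds {m : Mem} {a : ℕ} {l : List ℕ} (h : Holds (m a) 0 (l.length :: l)) :
    m.getList a = l := by
  rw [holds_cons] at h
  obtain ⟨h0, h1⟩ := h
  unfold Mem.getList
  apply List.ext_getElem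
  · simp [h0]
  · intro i hi hi'
    have := h1 i hi'
    simp only [List.getElem_map, List.getElem_range]
    rw [← this]
    congr 1
    ring

theorem setList_holds (m : Mem) (a : ℕ) (l : List ℕ) :
    Holds ((m.setList a l) a) 0 (l.length :: l) := by
  rw [holds_cons]
  constructor
  · simp [Mem.setList]
  · intro i hi
    have : l[i]? = some l[i] := List.getElem?_eq_getElem hi
    simp [Mem.setList, hi]

theorem setList_ne (m : Mem) {a b : ℕ} (l : List ℕ) (h : b ≠ a) : (m.setList a l) b = m b := by
  funext j
  simp [Mem.setList, h]

theorem setList_bdd {M : ℕ} {m : Mem} (hm : MemBdd M m) {a : ℕ} {l : List ℕ}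
    (hl : l.length ≤ M) (h : ∀ x ∈ l, x ≤ M) : MemBdd M (m.setList a l) := by
  intro b j
  unfold Mem.setList
  split_ifs
  · exact hl
  · cases hj : l[j - 1]? with
    | none => exact hm b j
    | some x => exact h x (List.mem_of_getElem? hj)
  · exact hm b j

end Holds

/-! ### Walking through a block. -/

section Walk

variable {P : Par} {W : ℕ}

/-- The number of entries of the block `b` whose edges are not in the bucket `μ`. -/
def strayCount (P : Par) (X : Edge P.n → ℕ) (μ : ℕ) (b : List (Edge P.n × ℕ)) : ℕ :=
  b.countP fun r => P.bk (X r.1) ≠ μ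

/-- The effect on the memory of walking through the block `b` of bucket `μ`. -/
structure WalkPost (P : Par) (m : Mem) (X : Edge P.n → ℕ) (μ f : ℕ) (b : List (Edge P.n × ℕ))
    (m' : Mem) : Prop where
  bdd : MemBdd P.M m'
  frame : ∀ a, a ∉ [1, 9, 14] → m' a = m a
  locals : ∀ i, i ∉ [6, 7, 8] → m' 14 i = m 14 i
  stray : m' 9 = Function.update (m 9) μ (strayCount P X μ b)
  hit : ∀ r ∈ b, P.bk (X r.1) = μ → m' 1 (addr r.1) = f * r.2
  miss : ∀ e, (P.bk (X e) = μ → ∀ r ∈ b, r.1 ≠ e) → m' 1 (addr e) = m 1 (addr e)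

/-- The invariant after `i` steps is the claim for the first `i` entries of the block. As the edges
of a block are distinct, a later write never destroys an earlier one. The same walk erases a block
for `f = 0` and writes it for `f = 1`. -/
theorem tri_walkP (hW : Fits W P.M) {m : Mem} {X : Edge P.n → ℕ} {μ f : ℕ} (hf : f ≤ 1)
    (hp : P.InMem m) (hb : MemBdd P.M m) (hx : ∀ e, m 3 (addr e) = X e) (h5 : m 14 5 = μ)
    (hμ : μ ≤ P.D) {b : List (Edge P.n × ℕ)}
    (hh : Holds (m 11) (μ * P.st + m 10 μ) (b.length :: encodeVec b))
    (hroom : m 10 μ + 1 + 3 * b.length ≤ P.st) (hnd : (b.map Prod.fst).Nodup) :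
    Tri W (walkP f) m 0 fun m' t => t ≤ 1600 * (b.length + 1) ∧ WalkPost P m X μ f b m' := by
  have hst := P.st_le
  have hnn := P.n_le
  have hblk : (blockE).val m = μ * P.st + m 10 μ := by simp [blockE, tv, pv, h5, hp.st]
  rw [holds_cons] at hh
  obtain ⟨hlen, hent⟩ := hh
  rw [holds_encodeVec] at hent
  -- As `f` is a variable, safety does not follow by computation; it holds because `f ≤ 1`.
  have hsf : ∀ x : Expr, x.safe = true → (Expr.const f * x).safe = true := by
    intro x hx
    have : f ≤ 64 := by omega
    change ((decide (f ≤ 64)) && x.safe) = true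
    simp [this, hx]
  unfold walkP
  refine Tri.store_seq hW hb μ 0 (by simp [tv, h5]) rfl (by omega) fun hb => ?_
  refine Tri.store_seq hW hb 6 0 rfl rfl (by omega) fun hb => ?_
  let I : ℕ → Mem → ℕ → Prop := fun k m' t => ∃ i, i + k = b.length ∧ t ≤ 1600 * i ∧
    m' 14 6 = i ∧ WalkPost P m X μ f (b.take i) m'
  refine Tri.loop_det hW (I := I) (k := b.length) rfl (by decide) ?_ ?_
  · rintro k m' t ⟨i, hik, ht, h6, hpost⟩
    refine ⟨hpost.bdd, ?_⟩
    have hp' : P.InMem m' := hp.congr (hpost.frame 2 (by decide))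
    have h5' : m' 14 5 = μ := by rw [hpost.locals 5 (by decide), h5]
    have hblk' : (blockE).val m' = μ * P.st + m 10 μ := by
      simp [blockE, tv, pv, h5', hp'.st, hpost.frame 10 (by decide)]
    have hcond : (ltE (tv 6) (.load 11 blockE)).val m' = if i < b.length then 1 else 0 := by
      rw [val_ltE, val_load, hblk', hpost.frame 11 (by decide), hlen]
      simp [tv, h6]
    rw [hcond]
    rcases Nat.lt_or_ge i b.length with hi | hi
    · right
      refine ⟨by simp [hi], k - 1, by omega, ?_⟩
      obtain ⟨e1, e2, e3⟩ := hent i hi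
      have hb := hpost.bdd
      have htake : b.take (i + 1) = b.take i ++ [b[i]] := List.take_succ_eq_append_getElem hi
      have hdist : ∀ r ∈ b.take i, r.1 ≠ b[i].1 := by
        intro r hr
        have h1 : ((b.take (i + 1)).map Prod.fst).Nodup := by
          rw [List.map_take]
          exact hnd.sublist (List.take_sublist _ _)
        rw [htake, List.map_append, List.nodup_append] at h1
        exact h1.2.2 _ (List.mem_map_of_mem hr) _ (by simp)
      have hae := addr_lt b[i].1
      have hstray : strayCount P X μ (b.take (i + 1)) =
          strayCount P X μ (b.take i) + if P.bk (X b[i].1) ≠ μ then 1 else 0 := by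
        unfold strayCount
        rw [htake, List.countP_append, List.countP_singleton]
        simp
      refine Tri.store_seq hW hb 7 (μ * P.st + m 10 μ + 1 + 3 * i) rfl
        (by simp only [val_add, val_mul, val_const, hblk', tv, val_load, h6])
        (by have := P.idx_le hμ (j := m 10 μ + 1 + 3 * i) (by omega); omega) fun hb => ?_
      refine Tri.store_seq hW hb 8 (addr b[i].1) rfl
        (by simp [tv, pv, Mem.set_apply, hp'.n, hpost.frame 11 (by decide), e1, e2, addr])
        (by omega) fun hb => ?_
      refine Tri.seq_det (R := fun m'' t => t ≤ 800 ∧ m'' 14 6 = i ∧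
        WalkPost P m X μ f (b.take (i + 1)) m'') (Tri.ite hW hb ?_ ?_) ?_
      · intro hc
        have hbk : P.bk (X b[i].1) = μ := by
          rw [val_eqE, (hp'.congr (by simp [Mem.set_apply])).bucketE] at hc
          simpa [tv, Mem.set_apply, h5', hpost.frame 3 (by decide), hx] using hc
        have hval : f * b[i].2 ≤ P.M := by
          rw [← e3, ← hpost.frame 11 (by decide)]
          exact le_trans (Nat.mul_le_mul_right _ hf) (by rw [one_mul]; exact hpost.bdd _ _)
        refine Tri.store hW hb (addr b[i].1) (f * b[i].2) (by simp [tv, Mem.set_apply])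
          (by simp [tv, Mem.set_apply, hpost.frame 11 (by decide), e3]) hval
          (fun hb => ⟨by norm_num, by simp [Mem.set_apply, h6], hb, ?_, ?_, ?_, ?_, ?_⟩)
          rfl (hsf _ rfl) (by decide)
          (by exact (by decide : 1 + (Expr.load 11 (tv 7 + .const 2)).cost + 1 ≤ 100))
        · intro a h
          have := hpost.frame a h
          simp only [List.mem_cons, not_or, List.not_mem_nil] at h
          simp [Mem.set_apply, h, this]
        · intro j h
          have := hpost.locals j h
          simp only [List.mem_cons, not_or, List.not_mem_nil] at h
          simp [Mem.set_apply, h, this]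
        · simp [Mem.set_apply, hpost.stray, hstray, hbk]
        · intro r hr hrb
          rw [htake] at hr
          simp only [List.mem_append, List.mem_singleton] at hr
          rcases hr with hr | rfl
          · have hne : addr r.1 ≠ addr b[i].1 := fun h => hdist r hr (addr_inj h)
            simp [Mem.set_apply, hne, hpost.hit r hr hrb]
          · simp [Mem.set_apply]
        · intro e he
          have hne : addr e ≠ addr b[i].1 := by
            intro h
            have := addr_inj h
            subst this
            exact he hbk b[i] (by rw [htake]; exact List.mem_append_right _ (List.mem_singleton.2 rfl)) rfl
          have := hpost.miss e fun h r hr => he h r (by rw [htake]; exact List.mem_append_left _ hr)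
          simp [Mem.set_apply, hne, this]
      · intro hc
        have hbk : P.bk (X b[i].1) ≠ μ := by
          rw [val_eqE, (hp'.congr (by simp [Mem.set_apply])).bucketE] at hc
          simpa [tv, Mem.set_apply, h5', hpost.frame 3 (by decide), hx] using hc
        have hcnt : strayCount P X μ (b.take i) ≤ b.length :=
          le_trans (List.countP_le_length) (by simp)
        refine Tri.store hW hb μ (strayCount P X μ (b.take i) + 1)
          (by simp [tv, Mem.set_apply, h5'])
          (by simp [tv, Mem.set_apply, h5', hpost.stray]) (by omega)
          (fun hb => ⟨by norm_num, by simp [Mem.set_apply, h6], hb, ?_, ?_, ?_, ?_, ?_⟩)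
        · intro a h
          have := hpost.frame a h
          simp only [List.mem_cons, not_or, List.not_mem_nil] at h
          simp [Mem.set_apply, h, this]
        · intro j h
          have := hpost.locals j h
          simp only [List.mem_cons, not_or, List.not_mem_nil] at h
          simp [Mem.set_apply, h, this]
        · simp [Mem.set_apply, hpost.stray, hstray, hbk]
        · intro r hr hrb
          rw [htake] at hr
          simp only [List.mem_append, List.mem_singleton] at hr
          rcases hr with hr | rfl
          · simp [Mem.set_apply, hpost.hit r hr hrb]
          · exact absurd hrb hbk
        · intro e he
          have := hpost.miss e fun h r hr => he h r (by rw [htake]; exact List.mem_append_left _ hr)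
          simp [Mem.set_apply, this]
      · rintro m₁ t₁ ⟨ht₁, h6₁, hq⟩
        refine Tri.store hW hq.bdd 6 (i + 1) rfl (by simp [tv, h6₁]) (by omega) fun hb =>
          ⟨k - 1, le_rfl, i + 1, by omega, by omega, by simp [Mem.set_apply], hb, ?_, ?_, ?_, ?_, ?_⟩
        · intro a h
          have := hq.frame a h
          simp only [List.mem_cons, not_or, List.not_mem_nil] at h
          simp [Mem.set_apply, h, this]
        · intro j h
          have := hq.locals j h
          simp only [List.mem_cons, not_or, List.not_mem_nil] at h
          simp [Mem.set_apply, h, this]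
        · simpa [Mem.set_apply] using hq.stray
        · simpa [Mem.set_apply] using hq.hit
        · simpa [Mem.set_apply] using hq.miss
    · left
      have : i = b.length := by omega
      subst this
      rw [List.take_length] at hpost
      exact ⟨by simp, by omega, hpost⟩
  · refine ⟨0, by simp, by simp, by simp [Mem.set_apply], hb, ?_, ?_, ?_, ?_, ?_⟩
    · intro a h
      simp only [List.mem_cons, not_or, List.not_mem_nil] at h
      simp [Mem.set_apply, h]
    · intro j h
      simp only [List.mem_cons, not_or, List.not_mem_nil] at h
      simp [Mem.set_apply, h]
    · simp [Mem.set_apply, strayCount]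
    · simp
    · simp [Mem.set_apply]

end Walk

/-! ### Supports, sizes and uniform vectors in terms of integer entries. -/

section Entries

variable {n : ℕ}

theorem mem_supp {x : Edge n → ℝ} {e : Edge n} : e ∈ supp x ↔ 0 < x e := by
  simp [supp]

theorem mem_supp_fixedPoint {D : ℕ} (hD : 0 < D) {X : Edge n → ℕ} {e : Edge n} :
    e ∈ supp (fixedPoint D X) ↔ X e ≠ 0 := by
  rw [mem_supp, fixedPoint]
  have : (0 : ℝ) < D := by exact_mod_cast hD
  rw [div_pos_iff_of_pos_right this]
  exact_mod_cast Nat.pos_iff_ne_zero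

theorem ListsEntries.nodup_keys {l : List (Edge n × ℕ)} {X : Edge n → ℕ} (h : ListsEntries l X) :
    (l.map Prod.fst).Nodup := by
  refine List.Nodup.map_on ?_ h.1
  rintro ⟨e, k⟩ hr ⟨e', k'⟩ hr' hee
  simp only at hee
  subst hee
  rw [((h.2 e k).1 hr).1.symm, ((h.2 e k').1 hr').1.symm]

theorem ListsEntries.mem_keys {l : List (Edge n × ℕ)} {X : Edge n → ℕ} (h : ListsEntries l X)
    {e : Edge n} : e ∈ l.map Prod.fst ↔ X e ≠ 0 := by
  constructor
  · intro he
    obtain ⟨⟨e, k⟩, hr, rfl⟩ := List.mem_map.1 he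
    obtain ⟨h1, h2⟩ := (h.2 e k).1 hr
    rwa [h1]
  · intro he
    exact List.mem_map.2 ⟨(e, X e), (h.2 _ _).2 ⟨rfl, he⟩, rfl⟩

theorem ListsEntries.supp_eq {D : ℕ} (hD : 0 < D) {l : List (Edge n × ℕ)} {X : Edge n → ℕ}
    (h : ListsEntries l X) : supp (fixedPoint D X) = (l.map Prod.fst).toFinset := by
  ext e
  rw [mem_supp_fixedPoint hD, List.mem_toFinset, h.mem_keys]

theorem ListsEntries.length_eq {D : ℕ} (hD : 0 < D) {l : List (Edge n × ℕ)} {X : Edge n → ℕ}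
    (h : ListsEntries l X) : (supp (fixedPoint D X)).card = l.length := by
  rw [h.supp_eq hD, List.toFinset_card_of_nodup h.nodup_keys, List.length_map]

theorem size_eq_sum_supp {x : Edge n → ℝ} (h : ∀ e, 0 ≤ x e) : size x = ∑ e ∈ supp x, x e := by
  unfold size
  symm
  apply Finset.sum_subset (Finset.subset_univ _)
  intro e _ he
  rw [mem_supp] at he
  exact le_antisymm (not_lt.1 he) (h e)

theorem fixedPoint_nonneg (D : ℕ) (X : Edge n → ℕ) (e : Edge n) : 0 ≤ fixedPoint D X e := by
  unfold fixedPoint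
  positivity

open Classical in
/-- The vector whose entries are `μ` on `s`, and `0` elsewhere. -/
noncomputable def constVec (μ : ℕ) (s : Finset (Edge n)) : Edge n → ℕ :=
  fun e => if e ∈ s then μ else 0

theorem size_constVec (D μ : ℕ) (s : Finset (Edge n)) :
    size (fixedPoint D (constVec μ s)) = s.card * (μ / D : ℝ) := by
  unfold size fixedPoint constVec
  rw [← Finset.sum_subset (Finset.subset_univ s)]
  · rw [Finset.sum_congr rfl (g := fun _ => (μ / D : ℝ)) (fun e he => by simp [he])]
    simp
  · intro e _ he
    simp [he]

theorem supp_constVec {D μ : ℕ} (hD : 0 < D) (hμ : μ ≠ 0) (s : Finset (Edge n)) :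
    supp (fixedPoint D (constVec μ s)) = s := by
  ext e
  rw [mem_supp_fixedPoint hD]
  simp [constVec, hμ]

end Entries

/-! ### From a split to blocks of comparable length. -/

section Blocks

variable {P : Par}

/-- The blocks `bs` encode a split of the vector that is `μ` on `s`, or else there is only the empty
block. -/
structure Blocks (P : Par) (μ : ℕ) (s : Finset (Edge P.n)) (bs : List (List (Edge P.n × ℕ))) :
    Prop where
  sub : ∀ b ∈ bs, ∀ r ∈ b, r.1 ∈ s ∧ P.d ≤ r.2 ∧ r.2 < 2 * P.d
  nodup : (bs.flatten.map Prod.fst).Nodup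
  alt : (bs = [[]] ∧ (P.D ≤ 4 * P.g ∨ P.D ≤ 4 * P.e ∨ μ * s.card < 4 * P.g)) ∨
    (4 * P.g < P.D ∧ 4 * P.e < P.D ∧ 4 * P.g ≤ μ * s.card ∧ s.card ≤ 2 * bs.flatten.length ∧
      (∀ b ∈ bs, b ≠ []) ∧ (∀ b ∈ bs, ∀ b' ∈ bs, b.length ≤ 6 * b'.length) ∧
      ∀ b ∈ bs, ∃ Y, ListsEntries b Y ∧
        IsCoarsening (P.g / P.D) (P.d / P.D) (fixedPoint P.D (constVec μ s)) (fixedPoint P.D Y))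

theorem forall₂_exists_right {α β : Type*} {R : α → β → Prop} {l : List α} {l' : List β}
    (h : List.Forall₂ R l l') {a : α} (ha : a ∈ l) : ∃ b ∈ l', R a b := by
  induction h with
  | nil => simp at ha
  | cons h _ ih =>
    rcases List.mem_cons.1 ha with rfl | ha
    · exact ⟨_, by simp, h⟩
    · obtain ⟨b, hb, hR⟩ := ih ha
      exact ⟨b, by simp [hb], hR⟩

theorem forall₂_pairwise {α β : Type*} {R : α → β → Prop} {S : α → α → Prop} {S' : β → β → Prop}
    {l : List α} {l' : List β} (h : List.Forall₂ R l l') (hp : l'.Pairwise S')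
    (hS : ∀ a b a' b', R a b → R a' b' → S' b b' → S a a') : l.Pairwise S := by
  induction h with
  | nil => exact List.Pairwise.nil
  | cons h h' ih =>
    rw [List.pairwise_cons] at hp ⊢
    refine ⟨fun a ha => ?_, ih hp.2⟩
    obtain ⟨b, hb, hR⟩ := forall₂_exists_right h' ha
    exact hS _ _ _ _ h hR (hp.1 b hb)

/-- As `μ < d`, every nonzero entry of a part lies in `[d, 2d)`. As `γ < 1/4` and the size `Z` of
the input is at least `4γ`, the slack `γZ + γ` is at most `Z/2`, so each part has a size between
`Z/2` and `3Z/2`. Together these determine the length of a block up to the factor `6`, and show that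
no block is empty. -/
theorem Blocks.of_split {μ : ℕ} {s : Finset (Edge P.n)} {ls : List (List (Edge P.n × ℕ))}
    {zs : List (Edge P.n → ℕ)} (hμ : μ ≠ 0) (hμd : μ < P.d)
    (h4g : 4 * P.g < P.D) (h4e : 4 * P.e < P.D) (hbig : 4 * P.g ≤ μ * s.card)
    (hls : List.Forall₂ ListsEntries ls zs)
    (hsp : IsSplit (P.g / P.D) (P.d / P.D) (fixedPoint P.D (constVec μ s))
      (zs.map (fixedPoint P.D))) :
    Blocks P μ s ls := by
  have hD : 0 < P.D := by omega
  have hDR : (0 : ℝ) < P.D := by exact_mod_cast hD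
  have hdR : (0 : ℝ) < P.d := by exact_mod_cast P.d_pos
  have hex : ∀ b ∈ ls, ∃ Y, ListsEntries b Y ∧
      IsCoarsening (P.g / P.D) (P.d / P.D) (fixedPoint P.D (constVec μ s)) (fixedPoint P.D Y) := by
    intro b hb
    obtain ⟨Y, hY, hl⟩ := forall₂_exists_right hls hb
    exact ⟨Y, hl, hsp.coarsening _ (List.mem_map_of_mem hY)⟩
  have hsub : ∀ b ∈ ls, ∀ r ∈ b, r.1 ∈ s ∧ P.d ≤ r.2 ∧ r.2 < 2 * P.d := by
    intro b hb r hr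
    obtain ⟨Y, hl, hc⟩ := hex b hb
    obtain ⟨h1, h2⟩ := (hl.2 r.1 r.2).1 hr
    have hmem : r.1 ∈ supp (fixedPoint P.D Y) := by rw [mem_supp_fixedPoint hD, h1]; exact h2
    have hms := hc.containment hmem
    rw [supp_constVec hD hμ] at hms
    have hsm := hc.smallEdges r.1 (by
      simp only [fixedPoint, constVec, hms, if_true]
      gcongr)
    simp only [fixedPoint, h1] at hsm
    rcases hsm with h | ⟨h3, h4⟩
    · rw [div_eq_zero_iff] at h
      rcases h with h | h
      · exact absurd (by exact_mod_cast h) h2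
      · exact absurd h hDR.ne'
    · rw [div_le_div_iff_of_pos_right hDR] at h3
      rw [← mul_div_assoc, div_lt_div_iff_of_pos_right hDR] at h4
      exact ⟨hms, by exact_mod_cast h3, by exact_mod_cast h4⟩
  have hlen : (zs.map fun z => (supp (fixedPoint P.D z)).card).sum = ls.flatten.length := by
    rw [List.length_flatten]
    clear hsp hex hsub
    induction hls with
    | nil => rfl
    | cons h _ ih => rw [List.map_cons, List.map_cons, List.sum_cons, List.sum_cons, ih, h.length_eq hD]
  have hcov : s.card ≤ 2 * ls.flatten.length := by
    have h := hsp.covering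
    rw [supp_constVec hD hμ, List.map_map] at h
    have h2 : (zs.map ((fun y => (supp y).card) ∘ fixedPoint P.D)).sum = ls.flatten.length := hlen
    rw [h2] at h
    have : (s.card : ℝ) ≤ 2 * (ls.flatten.length : ℕ) := by linarith
    exact_mod_cast this
  set Z : ℝ := s.card * (μ / P.D : ℝ) with hZ
  have hZsize : size (fixedPoint P.D (constVec μ s)) = Z := size_constVec _ _ _
  have hγZ : 4 * (P.g / P.D : ℝ) ≤ Z := by
    have : (4 * P.g : ℝ) ≤ μ * s.card := by exact_mod_cast hbig
    rw [hZ, ← mul_div_assoc, ← mul_div_assoc]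
    apply div_le_div_of_nonneg_right _ hDR.le
    linarith
  have hγ : 4 * (P.g / P.D : ℝ) < 1 := by
    rw [← mul_div_assoc, div_lt_one hDR]
    exact_mod_cast h4g
  have hγ0 : 0 < (P.g / P.D : ℝ) := div_pos (by exact_mod_cast P.g_pos) hDR
  -- The two bounds pair the extreme sizes with the extreme entries; their quotient is `(3/2) · 2 ·
  -- 2 = 6`.
  have hbd : ∀ b ∈ ls, b.length * (P.d / P.D : ℝ) ≤ 3 / 2 * Z ∧
      1 / 2 * Z ≤ b.length * (2 * (P.d / P.D : ℝ)) := by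
    intro b hb
    obtain ⟨Y, hl, hc⟩ := hex b hb
    have hg := abs_le.1 hc.globalSlack
    rw [hZsize] at hg
    have hYs := size_eq_sum_supp (fixedPoint_nonneg P.D Y)
    have hval : ∀ e ∈ supp (fixedPoint P.D Y), (P.d / P.D : ℝ) ≤ fixedPoint P.D Y e ∧
        fixedPoint P.D Y e ≤ 2 * (P.d / P.D : ℝ) := by
      intro e he
      rw [mem_supp_fixedPoint hD] at he
      obtain ⟨-, h1, h2⟩ := hsub b hb (e, Y e) ((hl.2 _ _).2 ⟨rfl, he⟩)
      unfold fixedPoint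
      rw [← mul_div_assoc]
      constructor <;> apply div_le_div_of_nonneg_right _ hDR.le
      · exact_mod_cast h1
      · exact_mod_cast h2.le
    have hlo := Finset.card_nsmul_le_sum _ _ _ fun e he => (hval e he).1
    have hhi := Finset.sum_le_card_nsmul _ _ _ fun e he => (hval e he).2
    rw [hl.length_eq hD, nsmul_eq_mul, ← hYs] at hlo hhi
    constructor <;> nlinarith
  have hratio : ∀ b ∈ ls, ∀ b' ∈ ls, b.length ≤ 6 * b'.length := by
    intro b hb b' hb'
    have h1 := (hbd b hb).1
    have h2 := (hbd b' hb').2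
    have h3 : (b.length : ℝ) * (P.d / P.D : ℝ) ≤ (6 * b'.length) * (P.d / P.D : ℝ) := by linarith
    have h4 := le_of_mul_le_mul_right h3 (div_pos hdR hDR)
    exact_mod_cast h4
  refine ⟨hsub, ?_, Or.inr ⟨h4g, h4e, hbig, hcov, ?_, hratio, hex⟩⟩
  · rw [List.map_flatten, List.nodup_flatten]
    constructor
    · intro l hl
      obtain ⟨b, hb, rfl⟩ := List.mem_map.1 hl
      obtain ⟨Y, hl, -⟩ := hex b hb
      exact hl.nodup_keys
    · rw [List.pairwise_map]
      refine forall₂_pairwise hls (List.pairwise_map.1 hsp.disjoint) ?_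
      intro b Y b' Y' hb hb' hd
      rw [hb.supp_eq hD, hb'.supp_eq hD] at hd
      exact List.disjoint_toFinset_iff_disjoint.1 hd
  · intro b hb h
    subst h
    have h2 := (hbd _ hb).2
    have h3 : 0 < Z := by linarith
    simp at h2
    linarith

/-- Since the keys are distinct, touched edges are counted at most once over all blocks; this is how
the disjointness of the parts is used. -/
theorem countP_keys_le {bs : List (Edge P.n × ℕ)} {τ : Finset (Edge P.n)}
    (h : (bs.map Prod.fst).Nodup) : (bs.countP fun r => r.1 ∈ τ) ≤ τ.card := by
  have h1 : (bs.countP fun r => r.1 ∈ τ) = ((bs.map Prod.fst).filter (· ∈ τ)).length := by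
    rw [← List.countP_eq_length_filter, List.countP_map]
    rfl
  rw [h1, ← List.toFinset_card_of_nodup (h.filter _)]
  apply Finset.card_le_card
  intro e he
  simpa using (List.mem_filter.1 (List.mem_toFinset.1 he)).2

theorem Blocks.flatten_le {μ : ℕ} {s : Finset (Edge P.n)} {bs : List (List (Edge P.n × ℕ))}
    (h : Blocks P μ s bs) : bs.flatten.length ≤ s.card := by
  rw [← List.length_map (f := Prod.fst), ← List.toFinset_card_of_nodup h.nodup]
  apply Finset.card_le_card
  intro e he
  obtain ⟨r, hr, rfl⟩ := List.mem_map.1 (List.mem_toFinset.1 he)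
  obtain ⟨b, hb, hrb⟩ := List.mem_flatten.1 hr
  exact (h.sub b hb r hrb).1

/-- Nonempty disjoint blocks number at most `s.card`, which accounts for the headers; the entries
take three words each. The extra `1` is the header of the single empty block. This is the reason for
the row length `4n² + 4`. -/
theorem Blocks.encode_le {μ : ℕ} {s : Finset (Edge P.n)} {bs : List (List (Edge P.n × ℕ))}
    (h : Blocks P μ s bs) : (encodeVecs bs).length ≤ 4 * s.card + 1 := by
  rw [encodeVecs_length]
  have h1 := h.flatten_le
  rcases h.alt with ⟨rfl, -⟩ | ⟨-, -, -, -, h2, -⟩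
  · simp
  · have h3 : bs.length ≤ bs.flatten.length := by
      clear h1 h
      induction bs with
      | nil => simp
      | cons b bs ih =>
        have := ih fun b hb => h2 b (by simp [hb])
        have hb : 0 < b.length := List.length_pos_iff.2 (h2 b (by simp))
        simp only [List.length_cons, List.flatten_cons, List.length_append]
        omega
    omega

end Blocks

/-! ### Input and output of the subroutine. -/

section Gather

variable {P : Par} {W : ℕ}

theorem Listing.exists_list {n st : ℕ} {len L pos : ℕ → ℕ} {β : Edge n → ℕ}
    (h : Listing st len L pos β) {μ : ℕ} (hμ : μ ≠ 0) :
    ∃ l : List (Edge n), l.Nodup ∧ l.length = len μ ∧ (∀ e, e ∈ l ↔ β e = μ) ∧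
      ∀ j (hj : j < l.length), L (μ * st + j) = addr l[j] := by
  choose f h1 h2 h3 using fun j : Fin (len μ) => h.get μ hμ j j.2
  refine ⟨List.ofFn f, ?_, by simp, ?_, ?_⟩
  · rw [List.nodup_ofFn]
    intro i j hij
    have := h3 i
    rw [hij, h3 j] at this
    exact Fin.ext this.symm
  · intro e
    rw [List.mem_ofFn]
    constructor
    · rintro ⟨j, rfl⟩
      exact h1 j
    · rintro rfl
      obtain ⟨hp, hL⟩ := h.mem e hμ
      refine ⟨⟨_, hp⟩, ?_⟩
      have := h2 ⟨_, hp⟩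
      simp only [hL] at this
      exact addr_inj this.symm
  · intro j hj
    simp only [List.getElem_ofFn]
    exact h2 ⟨j, by simpa using hj⟩

/-- The subroutine is given the bucket value `μ` for every edge instead of the true entries, which
makes its input uniform. -/
theorem tri_gatherP (hW : Fits W P.M) {m : Mem} {μ : ℕ} {l : List (Edge P.n)}
    (hp : P.InMem m) (hb : MemBdd P.M m) (h5 : m 14 5 = μ) (hμ : μ ≤ P.D)
    (hl : m 4 μ = l.length) (hL : ∀ j (hj : j < l.length), m 5 (μ * P.st + j) = addr l[j])
    (hlen : l.length ≤ P.n * P.n) :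
    Tri W gatherP m 0 fun m' t => t ≤ 2000 * (l.length + 1) ∧ MemBdd P.M m' ∧
      (∀ a, a ∉ [12, 14] → m' a = m a) ∧ (∀ i, i ∉ [6, 8] → m' 14 i = m 14 i) ∧
      m'.getList 12 = [P.n, P.D, P.g, P.d] ++ encodeVec (l.map fun e => (e, μ)) := by
  have hst := P.st_le
  have hst' : P.st = 4 * (P.n * P.n) + 4 := rfl
  have hDM := P.D_le
  have hgD := P.g_lt
  have hdM := P.d_le
  have hnM := P.n_le'
  unfold gatherP
  refine Tri.store_seq hW hb 0 (4 + 3 * l.length) rfl (by simp [tv, h5, hl]) (by omega) fun hb => ?_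
  refine Tri.store_seq hW hb 1 P.n rfl (by simp [pv, Mem.set_apply, hp.n]) (by omega) fun hb => ?_
  refine Tri.store_seq hW hb 2 P.D rfl (by simp [pv, Mem.set_apply, hp.D]) (by omega) fun hb => ?_
  refine Tri.store_seq hW hb 3 P.g rfl (by simp [pv, Mem.set_apply, hp.g]) (by omega) fun hb => ?_
  refine Tri.store_seq hW hb 4 P.d rfl (by simp [pv, Mem.set_apply, hp.d]) (by omega) fun hb => ?_
  refine Tri.store_seq hW hb 6 0 rfl rfl (by omega) fun hb => ?_
  let I : ℕ → Mem → ℕ → Prop := fun k m' t => ∃ i, i + k = l.length ∧ t ≤ 1500 * i ∧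
    m' 14 6 = i ∧ MemBdd P.M m' ∧
    (∀ a, a ∉ [12, 14] → m' a = m a) ∧ (∀ i, i ∉ [6, 8] → m' 14 i = m 14 i) ∧
    m' 12 0 = 4 + 3 * l.length ∧ m' 12 1 = P.n ∧ m' 12 2 = P.D ∧ m' 12 3 = P.g ∧ m' 12 4 = P.d ∧
    ∀ j (hj : j < l.length), j < i → m' 12 (5 + 3 * j) = l[j].1.1 ∧ m' 12 (6 + 3 * j) = l[j].1.2 ∧
      m' 12 (7 + 3 * j) = μ
  refine Tri.loop_det hW (I := I) (k := l.length) rfl (by decide) ?_ ?_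
  · rintro k m' t ⟨i, hik, ht, h6, hb, hf, h14, hw0, hw1, hw2, hw3, hw4, hent⟩
    refine ⟨hb, ?_⟩
    have h5' : m' 14 5 = μ := by rw [h14 5 (by decide), h5]
    have hp' : P.InMem m' := hp.congr (hf 2 (by decide))
    have hcond : (ltE (tv 6) (.load 4 (tv 5))).val m' = if i < l.length then 1 else 0 := by
      simp [tv, h6, h5', hf 4 (by decide), hl]
    rw [hcond]
    rcases Nat.lt_or_ge i l.length with hi | hi
    · right
      refine ⟨by simp [hi], k - 1, by omega, ?_⟩
      have hae := addr_lt l[i]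
      have hu := l[i].1.1.2
      have hv := l[i].1.2.2
      refine Tri.store_seq hW hb 8 (addr l[i]) rfl
        (by simp [tv, pv, h5', h6, hp'.st, hf 5 (by decide), hL i hi]) (by omega) fun hb => ?_
      refine Tri.store_seq hW hb (5 + 3 * i) l[i].1.1 (by simp [tv, Mem.set_apply, h6])
        (by simp [tv, pv, Mem.set_apply, hp'.n, addr_div]) (by omega) fun hb => ?_
      refine Tri.store_seq hW hb (6 + 3 * i) l[i].1.2 (by simp [tv, Mem.set_apply, h6])
        (by simp [tv, pv, Mem.set_apply, hp'.n, addr_mod]) (by omega) fun hb => ?_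
      refine Tri.store_seq hW hb (7 + 3 * i) μ (by simp [tv, Mem.set_apply, h6])
        (by simp [tv, Mem.set_apply, h5']) (by omega) fun hb => ?_
      refine Tri.store hW hb 6 (i + 1) rfl (by simp [tv, Mem.set_apply, h6]) (by omega) fun hb => ?_
      have hset : ∀ j, (((((m'.set 14 8 (addr l[i])).set 12 (5 + 3 * i) l[i].1.1).set 12 (6 + 3 * i)
          l[i].1.2).set 12 (7 + 3 * i) μ).set 14 6 (i + 1)) 12 j = if j = 7 + 3 * i then μ else
            if j = 6 + 3 * i then (l[i].1.2 : ℕ) else if j = 5 + 3 * i then (l[i].1.1 : ℕ) else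
              m' 12 j := by
        intro j
        simp only [Mem.set_apply]
        simp [Function.update_apply]
      refine ⟨k - 1, le_rfl, i + 1, by omega, by omega, by simp [Mem.set_apply], hb, ?_, ?_, ?_, ?_, ?_,
        ?_, ?_, ?_⟩
      · intro a h
        have := hf a h
        simp only [List.mem_cons, not_or, List.not_mem_nil] at h
        simp [Mem.set_apply, h, this]
      · intro j h
        have := h14 j h
        simp only [List.mem_cons, not_or, List.not_mem_nil] at h
        simp [Mem.set_apply, h, this]
      · rw [hset, if_neg (by omega), if_neg (by omega), if_neg (by omega), hw0]
      · rw [hset, if_neg (by omega), if_neg (by omega), if_neg (by omega), hw1]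
      · rw [hset, if_neg (by omega), if_neg (by omega), if_neg (by omega), hw2]
      · rw [hset, if_neg (by omega), if_neg (by omega), if_neg (by omega), hw3]
      · rw [hset, if_neg (by omega), if_neg (by omega), if_neg (by omega), hw4]
      · intro j hj hji
        rw [hset, hset, hset]
        by_cases hjj : j = i
        · subst hjj
          exact ⟨by rw [if_neg (by omega), if_neg (by omega), if_pos rfl],
            by rw [if_neg (by omega), if_pos rfl], if_pos rfl⟩
        · obtain ⟨h1, h2, h3⟩ := hent j hj (by omega)
          exact ⟨by rw [if_neg (by omega), if_neg (by omega), if_neg (by omega), h1],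
            by rw [if_neg (by omega), if_neg (by omega), if_neg (by omega), h2],
            by rw [if_neg (by omega), if_neg (by omega), if_neg (by omega), h3]⟩
    · left
      refine ⟨by simp [hi], by omega, hb, hf, h14, getList_eq_of_holds ?_⟩
      simp only [List.cons_append, List.nil_append, holds_cons, holds_encodeVec, List.length_cons,
        encodeVec_length, List.length_map]
      refine ⟨by rw [hw0]; ring, hw1, hw2, hw3, hw4, ?_⟩
      intro j hj
      obtain ⟨h1, h2, h3⟩ := hent j hj (by omega)
      simp only [List.getElem_map]
      refine ⟨h1, ?_, ?_⟩
      · rw [← h2]; congr 1; ring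
      · rw [← h3]; congr 1; ring
  · refine ⟨0, by simp, by simp, by simp [Mem.set_apply], hb, ?_, ?_, by simp [Mem.set_apply],
      by simp [Mem.set_apply], by simp [Mem.set_apply], by simp [Mem.set_apply],
      by simp [Mem.set_apply], by simp⟩
    · intro a h
      simp only [List.mem_cons, not_or, List.not_mem_nil] at h
      simp [Mem.set_apply, h]
    · intro j h
      simp only [List.mem_cons, not_or, List.not_mem_nil] at h
      simp [Mem.set_apply, h]

theorem tri_copyP (hW : Fits W P.M) {m : Mem} {μ : ℕ} {out : List ℕ}
    (hp : P.InMem m) (hb : MemBdd P.M m) (h5 : m 14 5 = μ)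
    (ho : Holds (m 13) 0 (out.length :: out)) (hlen : out.length ≤ P.st) :
    Tri W copyP m 0 fun m' t => t ≤ 1000 * (out.length + 1) ∧ MemBdd P.M m' ∧
      (∀ a, a ∉ [11, 14] → m' a = m a) ∧ (∀ i, i ≠ 6 → m' 14 i = m 14 i) ∧
      Holds (m' 11) (μ * P.st) out ∧
      ∀ j, j < μ * P.st ∨ μ * P.st + P.st ≤ j → m' 11 j = m 11 j := by
  have hst := P.st_le
  rw [holds_cons] at ho
  obtain ⟨ho0, ho⟩ := ho
  unfold copyP
  refine Tri.store_seq hW hb 6 0 rfl rfl (by omega) fun hb => ?_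
  let I : ℕ → Mem → ℕ → Prop := fun k m' t => ∃ i, i + k = out.length ∧ t ≤ 600 * i ∧
    m' 14 6 = i ∧ MemBdd P.M m' ∧
    (∀ a, a ∉ [11, 14] → m' a = m a) ∧ (∀ i, i ≠ 6 → m' 14 i = m 14 i) ∧
    (∀ j (hj : j < out.length), j < i → m' 11 (μ * P.st + j) = out[j]) ∧
    ∀ j, j < μ * P.st ∨ μ * P.st + P.st ≤ j → m' 11 j = m 11 j
  refine Tri.loop_det hW (I := I) (k := out.length) rfl (by decide) ?_ ?_
  · rintro k m' t ⟨i, hik, ht, h6, hb, hf, h14, hent, hout⟩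
    refine ⟨hb, ?_⟩
    have h5' : m' 14 5 = μ := by rw [h14 5 (by decide), h5]
    have hp' : P.InMem m' := hp.congr (hf 2 (by decide))
    have hcond : (ltE (tv 6) (.load 13 (.const 0))).val m' = if i < out.length then 1 else 0 := by
      simp [tv, h6, hf 13 (by decide), ho0]
    rw [hcond]
    rcases Nat.lt_or_ge i out.length with hi | hi
    · right
      refine ⟨by simp [hi], k - 1, by omega, ?_⟩
      have hval : m' 13 (i + 1) = out[i] := by
        rw [hf 13 (by decide), ← ho i hi, zero_add, Nat.add_comm]
      refine Tri.store_seq hW hb (μ * P.st + i) out[i] (by simp [tv, pv, h5', h6, hp'.st])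
        (by simp [tv, h6, hval]) (by rw [← hval]; exact hb _ _) fun hb => ?_
      refine Tri.store hW hb 6 (i + 1) rfl (by simp [tv, Mem.set_apply, h6]) (by omega) fun hb => ?_
      refine ⟨k - 1, le_rfl, i + 1, by omega, by omega, by simp [Mem.set_apply], hb, ?_, ?_, ?_, ?_⟩
      · intro a h
        have := hf a h
        simp only [List.mem_cons, not_or, List.not_mem_nil] at h
        simp [Mem.set_apply, h, this]
      · intro j h
        simp [Mem.set_apply, h, h14 j h]
      · intro j hj hji
        by_cases hjj : j = i
        · subst hjj
          simp [Mem.set_apply]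
        · simp [Mem.set_apply, hjj, hent j hj (by omega)]
      · intro j hj
        simp [Mem.set_apply, show j ≠ μ * P.st + i by omega, hout j hj]
    · left
      exact ⟨by simp [hi], by omega, hb, hf, h14, fun j hj => hent j hj (by omega), hout⟩
  · refine ⟨0, by simp, by simp, by simp [Mem.set_apply], hb, ?_, ?_, by simp,
      by simp [Mem.set_apply]⟩
    · intro a h
      simp only [List.mem_cons, not_or, List.not_mem_nil] at h
      simp [Mem.set_apply, h]
    · intro j h
      simp [Mem.set_apply, h]

end Gather

/-! ### The invariants of a bucket and the supply of blocks. -/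

section Invariant

variable {P : Par}

/-- The history of a bucket: its edges at the last rebuild, the edges that have been changed since
then, and the blocks that are no more in use, in use, and not yet in use. -/
structure Hist (n : ℕ) where
  base : Finset (Edge n)
  touched : Finset (Edge n)
  passed : List (List (Edge n × ℕ))
  cur : List (Edge n × ℕ)
  rest : List (List (Edge n × ℕ))

/-- The entry `r` of the current block of bucket `μ` is present in the maintained vector. -/
def Live (P : Par) (m : Mem) (X : Edge P.n → ℕ) (μ : ℕ) (r : Edge P.n × ℕ) : Prop :=
  P.bk (X r.1) = μ ∧ m 1 (addr r.1) = r.2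

open Classical in
/-- The number of entries of the block `b` that are not present in the maintained vector. -/
noncomputable def deadCount (P : Par) (m : Mem) (X : Edge P.n → ℕ) (μ : ℕ)
    (b : List (Edge P.n × ℕ)) : ℕ :=
  b.countP fun r => ¬ Live P m X μ r

/-- The invariants of bucket `μ`. -/
structure BucketInv (P : Par) (m : Mem) (X : Edge P.n → ℕ) (μ : ℕ) (G : Hist P.n) : Prop where
  base : m 7 μ = G.base.card
  cnt : G.touched.card ≤ m 8 μ
  same : ∀ e, e ∉ G.touched → (e ∈ G.base ↔ P.bk (X e) = μ)
  holds : Holds (m 11) (μ * P.st + m 10 μ) (encodeVecs (G.cur :: G.rest))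
  room : m 10 μ + (encodeVecs (G.cur :: G.rest)).length ≤ P.st
  blocks : Blocks P μ G.base (G.passed ++ G.cur :: G.rest)
  bad : ∀ b ∈ G.passed, 2 * P.e * b.length < P.D * b.countP fun r => r.1 ∈ G.touched
  out : ∀ e, P.bk (X e) = μ → m 1 (addr e) = 0 ∨ (e, m 1 (addr e)) ∈ G.cur
  fresh : ∀ r ∈ G.cur, r.1 ∉ G.touched → m 1 (addr r.1) = r.2
  dead : m 9 μ = deadCount P m X μ G.cur

/-- The invariants of the data structure. -/
structure DataInv (P : Par) (m : Mem) (X : Edge P.n → ℕ) (G : ℕ → Hist P.n) : Prop where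
  par : P.InMem m
  bdd : MemBdd P.M m
  vec : ∀ e, m 3 (addr e) = X e
  le : ∀ e, X e ≤ P.D
  list : Listing P.st (m 4) (m 5) (m 6) fun e => P.bk (X e)
  large : ∀ e, P.d ≤ X e → m 1 (addr e) = X e
  tiny : ∀ e, X e < P.d → P.bk (X e) = 0 → m 1 (addr e) = 0
  bucket : ∀ μ, μ ≠ 0 → BucketInv P m X μ (G μ)

theorem deadCount_congr {m m' : Mem} {X : Edge P.n → ℕ} {μ : ℕ} {b : List (Edge P.n × ℕ)}
    (h : ∀ e, P.bk (X e) = μ → m' 1 (addr e) = m 1 (addr e)) :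
    deadCount P m' X μ b = deadCount P m X μ b := by
  classical
  unfold deadCount
  apply List.countP_congr
  intro r _
  rw [decide_eq_true_eq, decide_eq_true_eq]
  unfold Live
  by_cases hr : P.bk (X r.1) = μ
  · rw [h _ hr]
  · simp [hr]

/-- The invariants of a bucket depend only on its own row, its own counters and the output on its
own edges. An entry of the current block outside the bucket is dead, whatever its output is. The
counter of changes may grow, because it only has to bound the number of touched edges. -/
theorem BucketInv.congr {m m' : Mem} {X : Edge P.n → ℕ} {μ : ℕ} {G : Hist P.n}
    (h : BucketInv P m X μ G) (h7 : m' 7 μ = m 7 μ) (h8 : m 8 μ ≤ m' 8 μ) (h9 : m' 9 μ = m 9 μ)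
    (h10 : m' 10 μ = m 10 μ) (h11 : ∀ i, i < P.st → m' 11 (μ * P.st + i) = m 11 (μ * P.st + i))
    (h1 : ∀ e, P.bk (X e) = μ → m' 1 (addr e) = m 1 (addr e)) : BucketInv P m' X μ G := by
  refine ⟨by rw [h7, h.base], le_trans h.cnt h8, h.same, ?_, by rw [h10]; exact h.room, h.blocks, h.bad,
    ?_, ?_, by rw [h9, deadCount_congr h1, h.dead]⟩
  · rw [h10]
    refine h.holds.congr fun i hi => ?_
    rw [Nat.add_assoc]
    exact h11 _ (by have := h.room; omega)
  · intro e he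
    rw [h1 e he]
    exact h.out e he
  · intro r hr ht
    rw [h1 _ ((h.same _ ht).1 (h.blocks.sub G.cur (by simp) r hr).1)]
    exact h.fresh r hr ht

/-- An untouched edge of the current block is still in the bucket and has kept its output. Hence
dead entries are touched, but not conversely: a block that is loaded later may use touched edges
that are in the bucket again. -/
theorem BucketInv.dead_le {m : Mem} {X : Edge P.n → ℕ} {μ : ℕ} {G : Hist P.n}
    (h : BucketInv P m X μ G) : m 9 μ ≤ G.cur.countP fun r => r.1 ∈ G.touched := by
  classical
  rw [h.dead, deadCount]
  apply List.countP_mono_left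
  intro r hr hd
  simp only [decide_eq_true_eq] at hd ⊢
  by_contra ht
  exact hd ⟨(h.same _ ht).1 (h.blocks.sub G.cur (by simp) r hr).1, h.fresh r hr ht⟩

theorem flatten_countP_le {bs : List (List (Edge P.n × ℕ))} {τ : Finset (Edge P.n)} {a c : ℕ}
    (h : ∀ b ∈ bs, a * b.length ≤ c * b.countP fun r => r.1 ∈ τ) :
    a * bs.flatten.length ≤ c * bs.flatten.countP fun r => r.1 ∈ τ := by
  induction bs with
  | nil => simp
  | cons b bs ih =>
    rw [List.flatten_cons, List.length_append, List.countP_append, mul_add, mul_add]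
    exact add_le_add (h b (by simp)) (ih fun b hb => h b (by simp [hb]))

/-- A fraction of more than `2ε` of each block given up is touched, and the blocks are disjoint, so
their total length is at most `1/(2ε)` times the number of changes. This bounds the part of the
potential that is spent on passing on. -/
theorem BucketInv.passed_le {m : Mem} {X : Edge P.n → ℕ} {μ : ℕ} {G : Hist P.n}
    (h : BucketInv P m X μ G) : 2 * P.e * G.passed.flatten.length ≤ P.D * m 8 μ := by
  refine le_trans (flatten_countP_le fun b hb => (h.bad b hb).le) (Nat.mul_le_mul_left _ ?_)
  refine le_trans (countP_keys_le ?_) h.cnt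
  have := h.blocks.nodup
  rw [List.flatten_append, List.map_append, List.nodup_append] at this
  exact this.1

/-- If the current block were the last one, then more than `2ε` of all block edges, which are at
least half of the base, would be touched. This exceeds `ε|base|`, contrary to `hc`. The strict
inequality comes from the current block alone, so the case without passed blocks is covered. -/
theorem BucketInv.rest_ne {m : Mem} {X : Edge P.n → ℕ} {μ : ℕ} {G : Hist P.n}
    (h : BucketInv P m X μ G) (hc : m 8 μ * P.D ≤ m 7 μ * P.e)
    (hd : 2 * P.e * G.cur.length < m 9 μ * P.D) : G.rest ≠ [] ∧ G.cur ≠ [] := by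
  have hcur : G.cur ≠ [] := by
    intro hn
    have := h.dead_le
    rw [hn] at this
    simp at this
    rw [this] at hd
    simp at hd
  refine ⟨fun hr => ?_, hcur⟩
  have hdl : 2 * P.e * G.cur.length < P.D * G.cur.countP fun r => r.1 ∈ G.touched := by
    rw [mul_comm P.D]
    exact lt_of_lt_of_le hd (Nat.mul_le_mul_right _ h.dead_le)
  have hb := h.blocks
  rw [hr] at hb
  have h1 := flatten_countP_le (bs := G.passed) (fun b hb => (h.bad b hb).le)
  have h2 := countP_keys_le (τ := G.touched) hb.nodup
  rw [List.flatten_append, List.countP_append] at h2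
  have h3 : (G.passed ++ [G.cur]).flatten.length = G.passed.flatten.length + G.cur.length := by simp
  rw [show [G.cur].flatten = G.cur by simp] at h2
  rcases hb.alt with ⟨h4, -⟩ | ⟨-, -, -, h4, -⟩
  · cases hp : G.passed with
    | nil => rw [hp] at h4; simp at h4; exact hcur h4
    | cons b bs => rw [hp] at h4; simp at h4
  · rw [h3] at h4
    have h5 := h.cnt
    rw [h.base] at hc
    have h6 : P.D * (G.passed.flatten.countP (fun r => r.1 ∈ G.touched) +
        G.cur.countP fun r => r.1 ∈ G.touched) ≤ P.D * m 8 μ :=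
      Nat.mul_le_mul_left _ (le_trans h2 h5)
    have h7 : G.base.card * P.e ≤ 2 * (G.passed.flatten.length + G.cur.length) * P.e :=
      Nat.mul_le_mul_right _ h4
    have h8 : 2 * P.e * G.passed.flatten.length + 2 * P.e * G.cur.length =
      2 * (G.passed.flatten.length + G.cur.length) * P.e := by ring
    rw [mul_add] at h6
    rw [mul_comm (m 8 μ)] at hc
    omega

end Invariant

/-! ### Passing on to the next block. -/

section Reload

variable {P : Par} {W : ℕ}

theorem Par.bk_of_large {P : Par} {k : ℕ} (h : P.d ≤ k) : P.bk k = 0 := by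
  unfold Par.bk
  rw [if_neg]
  omega

/-- The invariants of a bucket whose current block has just been written. -/
theorem BucketInv.of_reload {m : Mem} {X : Edge P.n → ℕ} {μ : ℕ} {G : Hist P.n}
    (base : m 7 μ = G.base.card) (cnt : G.touched.card ≤ m 8 μ)
    (same : ∀ e, e ∉ G.touched → (e ∈ G.base ↔ P.bk (X e) = μ))
    (holds : Holds (m 11) (μ * P.st + m 10 μ) (encodeVecs (G.cur :: G.rest)))
    (room : m 10 μ + (encodeVecs (G.cur :: G.rest)).length ≤ P.st)
    (blocks : Blocks P μ G.base (G.passed ++ G.cur :: G.rest))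
    (bad : ∀ b ∈ G.passed, 2 * P.e * b.length < P.D * b.countP fun r => r.1 ∈ G.touched)
    (stray : m 9 μ = strayCount P X μ G.cur)
    (hit : ∀ r ∈ G.cur, P.bk (X r.1) = μ → m 1 (addr r.1) = r.2)
    (miss : ∀ e, P.bk (X e) = μ → (∀ r ∈ G.cur, r.1 ≠ e) → m 1 (addr e) = 0) :
    BucketInv P m X μ G := by
  classical
  refine ⟨base, cnt, same, holds, room, blocks, bad, ?_, ?_, ?_⟩
  · intro e he
    by_cases h : ∀ r ∈ G.cur, r.1 ≠ e
    · exact Or.inl (miss e he h)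
    · push Not at h
      obtain ⟨⟨e', k⟩, hr, rfl⟩ := h
      right
      rwa [hit _ hr he]
  · intro r hr ht
    exact hit r hr ((same _ ht).1 (blocks.sub G.cur (by simp) r hr).1)
  · rw [stray, strayCount, deadCount]
    apply List.countP_congr
    intro r hr
    rw [decide_eq_true_eq, decide_eq_true_eq]
    unfold Live
    by_cases h : P.bk (X r.1) = μ
    · simp [h, hit r hr h]
    · simp [h]

/-- Work on one bucket affects only its own row, its own counters and the output on its own edges.
Large and tiny entries belong to bucket `0` and are left alone. -/
theorem DataInv.of_bucket {m m' : Mem} {X : Edge P.n → ℕ} {μ : ℕ} {G : ℕ → Hist P.n} {G' : Hist P.n}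
    (h : DataInv P m X G) (hμ : μ ≠ 0) (hb : MemBdd P.M m')
    (hf : ∀ a, a ∈ [2, 3, 4, 5, 6] → m' a = m a)
    (hν : ∀ ν, ν ≠ μ → m' 7 ν = m 7 ν ∧ m' 8 ν = m 8 ν ∧ m' 9 ν = m 9 ν ∧ m' 10 ν = m 10 ν)
    (h11 : ∀ j, j < μ * P.st ∨ μ * P.st + P.st ≤ j → m' 11 j = m 11 j)
    (h1 : ∀ e, P.bk (X e) ≠ μ → m' 1 (addr e) = m 1 (addr e))
    (hG : BucketInv P m' X μ G') : DataInv P m' X (Function.update G μ G') := by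
  refine ⟨h.par.congr (hf 2 (by decide)), hb, ?_, h.le, ?_, ?_, ?_, ?_⟩
  · rw [hf 3 (by decide)]; exact h.vec
  · rw [hf 4 (by decide), hf 5 (by decide), hf 6 (by decide)]; exact h.list
  · intro e he
    rw [h1 e (by rw [Par.bk_of_large he]; exact hμ.symm), h.large e he]
  · intro e he he0
    rw [h1 e (by rw [he0]; exact hμ.symm), h.tiny e he he0]
  · intro ν hν0
    by_cases hνμ : ν = μ
    · subst hνμ
      rw [Function.update_self]
      exact hG
    · rw [Function.update_of_ne hνμ]
      obtain ⟨h7, h8, h9, h10⟩ := hν ν hνμ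
      refine (h.bucket ν hν0).congr h7 h8.ge h9 h10 ?_ ?_
      · intro i hi
        apply h11
        rcases Nat.lt_or_ge ν μ with h | h
        · left
          calc ν * P.st + i < ν * P.st + P.st := by omega
            _ = (ν + 1) * P.st := by ring
            _ ≤ μ * P.st := Nat.mul_le_mul_right _ h
        · right
          have : (μ + 1) * P.st ≤ ν * P.st := Nat.mul_le_mul_right _ (by omega)
          rw [Nat.add_mul, one_mul] at this
          omega
      · intro e he
        exact h1 e (by rw [he]; exact hνμ)

theorem Blocks.nodup_keys {μ : ℕ} {s : Finset (Edge P.n)} {bs : List (List (Edge P.n × ℕ))}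
    (h : Blocks P μ s bs) {b : List (Edge P.n × ℕ)} (hb : b ∈ bs) : (b.map Prod.fst).Nodup := by
  have := h.nodup
  rw [List.map_flatten, List.nodup_flatten] at this
  exact this.1 _ (List.mem_map_of_mem hb)

/-- The memory after clearing the entries of the current block. -/
theorem DataInv.cleared {m m' : Mem} {X : Edge P.n → ℕ} {μ : ℕ} {G : ℕ → Hist P.n}
    (h : DataInv P m X G) (hμ : μ ≠ 0) (hw : WalkPost P m X μ 0 (G μ).cur m') {e : Edge P.n}
    (he : P.bk (X e) = μ) : m' 1 (addr e) = 0 := by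
  by_cases hr : ∀ r ∈ (G μ).cur, r.1 ≠ e
  · rw [hw.miss e fun _ => hr]
    rcases (h.bucket μ hμ).out e he with h0 | h0
    · exact h0
    · exact absurd rfl (hr _ h0)
  · push Not at hr
    obtain ⟨r, hr, rfl⟩ := hr
    rw [hw.hit r hr he, zero_mul]

theorem DataInv.tri_clear (hW : Fits W P.M) {m : Mem} {X : Edge P.n → ℕ} {μ : ℕ}
    {G : ℕ → Hist P.n} (h : DataInv P m X G) (hμ : μ ≠ 0) (hμD : μ ≤ P.D) (h5 : m 14 5 = μ) :
    Tri W (walkP 0) m 0 fun m' t => t ≤ 1600 * ((G μ).cur.length + 1) ∧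
      WalkPost P m X μ 0 (G μ).cur m' := by
  have hb := h.bucket μ hμ
  have hh := hb.holds
  have hr := hb.room
  rw [encodeVecs_cons] at hh hr
  rw [← List.cons_append, holds_append] at hh
  refine tri_walkP hW (by norm_num) h.par h.bdd h.vec h5 hμD hh.1 ?_ (hb.blocks.nodup_keys (by simp))
  simp only [List.length_cons, List.length_append, encodeVec_length] at hr
  omega

/-- The old block is cleared first, so that only the new one is visible on the bucket. It joins the
passed blocks with the required fraction of touched edges because its dead entries are touched. -/
theorem tri_advanceP (hW : Fits W P.M) {m : Mem} {X : Edge P.n → ℕ} {μ : ℕ}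
    {G : ℕ → Hist P.n} (h : DataInv P m X G) (hμ : μ ≠ 0) (hμD : μ ≤ P.D) (h5 : m 14 5 = μ)
    {b : List (Edge P.n × ℕ)} {rest : List (List (Edge P.n × ℕ))} (hrest : (G μ).rest = b :: rest)
    (hdead : 2 * P.e * (G μ).cur.length < m 9 μ * P.D) :
    Tri W advanceP m 0 fun m' t => t ≤ 1600 * ((G μ).cur.length + b.length + 2) + 300 ∧
      DataInv P m' X (Function.update G μ
        ⟨(G μ).base, (G μ).touched, (G μ).passed ++ [(G μ).cur], b, rest⟩) ∧
      (∀ a, a ∉ [1, 9, 10, 14] → m' a = m a) ∧ (∀ ν, ν ≠ μ → m' 9 ν = m 9 ν) ∧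
      ∀ i, i ∉ [6, 7, 8] → m' 14 i = m 14 i := by
  have hst := P.st_le
  have hB := h.bucket μ hμ
  have hh := hB.holds
  have hr := hB.room
  have hbl := hB.blocks
  rw [hrest] at hh hr hbl
  rw [encodeVecs_cons, ← List.cons_append, holds_append, holds_cons, List.length_cons,
    encodeVec_length] at hh
  obtain ⟨⟨hh0, -⟩, hh2⟩ := hh
  rw [encodeVecs_cons, List.length_cons, List.length_append, encodeVec_length] at hr
  have hh3 := hh2
  rw [encodeVecs_cons, ← List.cons_append, holds_append] at hh3
  have hr2 := hr
  rw [encodeVecs_cons, List.length_cons, List.length_append, encodeVec_length] at hr2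
  unfold advanceP
  refine Tri.seq_det (h.tri_clear hW hμ hμD h5) ?_
  rintro m₁ t₁ ⟨ht₁, hw₁⟩
  have hp₁ : P.InMem m₁ := h.par.congr (hw₁.frame 2 (by decide))
  have h5₁ : m₁ 14 5 = μ := by rw [hw₁.locals 5 (by decide), h5]
  refine Tri.store_seq hW hw₁.bdd μ (m 10 μ + 1 + 3 * (G μ).cur.length) (by simp [tv, h5₁])
    (by simp [tv, pv, blockE, h5₁, hp₁.st, hw₁.frame 10 (by decide), hw₁.frame 11 (by decide), hh0])
    (by omega) fun hb₂ => ?_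
  refine (tri_walkP hW (X := X) (μ := μ) (b := b) le_rfl (hp₁.congr (by simp [Mem.set_apply])) hb₂
    (by simpa [Mem.set_apply, hw₁.frame 3 (by decide)] using h.vec) (by simp [Mem.set_apply, h5₁])
    hμD ?_ ?_ (hbl.nodup_keys (by simp))).imp ?_
  · simp only [Mem.set_apply]
    simp only [hw₁.frame 11 (by decide)]
    have := hh3.1
    simpa [Nat.add_assoc, Nat.add_comm, Nat.add_left_comm] using this
  · simp [Mem.set_apply]
    omega
  · rintro m₂ t₂ ⟨ht₂, hw₂⟩
    have hf : ∀ a, a ∉ [1, 9, 10, 14] → m₂ a = m a := by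
      intro a ha
      simp only [List.mem_cons, not_or, List.not_mem_nil] at ha
      rw [hw₂.frame a (by simp [ha])]
      simp [Mem.set_apply, ha, hw₁.frame a (by simp [ha])]
    have h10 : m₂ 10 = Function.update (m 10) μ (m 10 μ + 1 + 3 * (G μ).cur.length) := by
      rw [hw₂.frame 10 (by decide)]
      simp [Mem.set_apply, hw₁.frame 10 (by decide)]
    have h9 : m₂ 9 = Function.update (m 9) μ (strayCount P X μ b) := by
      rw [hw₂.stray]
      simp [Mem.set_apply, hw₁.stray]
    refine ⟨by omega, ?_, hf, ?_, ?_⟩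
    · refine h.of_bucket hμ hw₂.bdd ?_ ?_ ?_ ?_ (BucketInv.of_reload ?_ ?_ hB.same ?_ ?_ ?_ ?_ ?_ ?_ ?_)
      · intro a ha
        apply hf
        fin_cases ha <;> decide
      · intro ν hν
        rw [hf 7 (by decide), hf 8 (by decide), h9, h10]
        simp [hν]
      · intro j _
        rw [hf 11 (by decide)]
      · intro e he
        rw [hw₂.miss e fun h => absurd h he]
        simp only [Mem.set_apply]
        simp [hw₁.miss e fun h => absurd h he]
      · rw [hf 7 (by decide)]; exact hB.base
      · rw [hf 8 (by decide)]; exact hB.cnt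
      · rw [hf 11 (by decide), h10]
        simpa [Nat.add_assoc, Nat.add_comm, Nat.add_left_comm] using hh2
      · rw [h10]
        simp only [Function.update_self]
        omega
      · simpa using hbl
      · intro b' hb'
        rcases List.mem_append.1 hb' with hb' | hb'
        · exact hB.bad b' hb'
        · rw [List.mem_singleton] at hb'
          subst hb'
          refine lt_of_lt_of_le hdead ?_
          rw [mul_comm]
          exact Nat.mul_le_mul_left _ hB.dead_le
      · rw [h9]; simp
      · intro r hr hrμ
        rw [hw₂.hit r hr hrμ, one_mul]
      · intro e he hr
        rw [hw₂.miss e fun _ => hr]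
        simpa [Mem.set_apply] using h.cleared hμ hw₁ he
    · intro ν hν
      rw [h9]; simp [hν]
    · intro i hi
      rw [hw₂.locals i hi]
      simp [Mem.set_apply, hw₁.locals i hi]

end Reload

/-! ### Rebuilding a bucket. -/

section Rebuild

variable {P : Par} {W : ℕ}

/-- The edges in bucket `μ`. -/
def bucketSet (P : Par) (X : Edge P.n → ℕ) (μ : ℕ) : Finset (Edge P.n) :=
  Finset.univ.filter fun e => P.bk (X e) = μ

theorem mem_bucketSet {X : Edge P.n → ℕ} {μ : ℕ} {e : Edge P.n} :
    e ∈ bucketSet P X μ ↔ P.bk (X e) = μ := by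
  simp [bucketSet]

/-- Bucket values are rounded down, so the uniform vector is dominated by `X`. -/
theorem constVec_matching {X : Edge P.n → ℕ} {μ : ℕ}
    (h : IsFractionalMatching (fixedPoint P.D X)) :
    IsFractionalMatching (fixedPoint P.D (constVec μ (bucketSet P X μ))) := by
  refine ⟨fixedPoint_nonneg _ _, fun v => le_trans ?_ (h.degree v)⟩
  unfold vertexSum
  apply Finset.sum_le_sum
  intro e _
  split_ifs
  · unfold fixedPoint constVec
    gcongr
    split_ifs with he
    · rw [← mem_bucketSet.1 he]
      exact P.bk_le _
    · exact Nat.zero_le _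
  · exact le_rfl

theorem constVec_uniform (D μ : ℕ) {n : ℕ} (s : Finset (Edge n)) :
    IsUniform (fixedPoint D (constVec μ s)) := by
  refine ⟨μ / D, fun e he => ?_⟩
  rw [mem_supp] at he
  unfold fixedPoint constVec at *
  split_ifs at he ⊢
  · rfl
  · simp at he

/-- This is the only place where randomness, and thus failure, enters. The time is that of `S` and
of copying: `4 + 3|l|` words in and at most `4|l| + 1` words out, as the split has disjoint
supports. -/
theorem call_split {S : Prog} {ts : ℝ} {p : ℝ≥0∞}
    (hS : IsStaticSplitAlgorithm S W P.n P.D P.g P.d ts p) {m : Mem} (hb : MemBdd P.M m)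
    {X : Edge P.n → ℕ} (hX : IsFractionalMatching (fixedPoint P.D X)) {μ : ℕ} (hμ : μ ≠ 0)
    {l : List (Edge P.n)} (hnd : l.Nodup) (hl : ∀ e, e ∈ l ↔ P.bk (X e) = μ)
    (h4g : 4 * P.g < P.D) (h4e : 4 * P.e < P.D) (hbig : 4 * P.g ≤ μ * l.length)
    (hin : m.getList 12 = [P.n, P.D, P.g, P.d] ++ encodeVec (l.map fun e => (e, μ))) :
    Tri W (.call S 12 13) m p fun m' t => (t : ℝ) ≤ 10 + 7 * l.length + l.length * ts ∧
      MemBdd P.M m' ∧ (∀ a, a ≠ 13 → m' a = m a) ∧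
      ∃ ls, Blocks P μ (bucketSet P X μ) ls ∧
        Holds (m' 13) 0 ((encodeVecs ls).length :: encodeVecs ls) := by
  have hD : 0 < P.D := by omega
  have hs : (bucketSet P X μ).card = l.length := by
    rw [← List.toFinset_card_of_nodup hnd]
    congr 1
    ext e
    rw [mem_bucketSet, List.mem_toFinset, hl]
  have hne : (bucketSet P X μ).Nonempty := by
    rw [← Finset.card_pos, hs]
    have := P.g_pos
    by_contra h0
    have : l.length = 0 := by omega
    rw [this] at hbig
    omega
  have hμd : μ < P.d := by
    obtain ⟨e, he⟩ := hne
    have h1 := mem_bucketSet.1 he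
    have h2 := P.bk_lt_of_ne (k := X e) (by rw [h1]; exact hμ)
    have h3 := P.bk_le (X e)
    omega
  have hle : ListsEntries (l.map fun e => (e, μ)) (constVec μ (bucketSet P X μ)) := by
    constructor
    · exact hnd.map fun a b h => (Prod.mk.inj h).1
    · intro e k
      simp only [List.mem_map, Prod.mk.injEq, constVec, mem_bucketSet]
      constructor
      · rintro ⟨e', he', rfl, rfl⟩
        exact ⟨if_pos ((hl _).1 he'), hμ⟩
      · rintro ⟨h1, h2⟩
        split_ifs at h1 with h3
        · exact ⟨e, (hl e).2 h3, rfl, h1⟩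
        · exact absurd h1.symm h2
  obtain ⟨f, hf⟩ := hS _ _ hle (constVec_matching hX) (constVec_uniform _ _ _) (by
      intro e
      unfold constVec
      split_ifs <;> omega) (by rw [supp_constVec hD hμ]; exact hne)
  rw [supp_constVec hD hμ, hs, ← hin] at hf
  refine Tri.call (R := fun s t => (t : ℝ) ≤ l.length * ts ∧
    OutputsSplit P.D (P.g / P.D) (P.d / P.D) (constVec μ (bucketSet P X μ)) s.out)
    ⟨f, le_trans (le_of_eq ?_) hf⟩ ?_
  · unfold failProb
    congr 1
    ext r
    simp only [Set.mem_ofPred_eq, not_iff_not]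
    constructor
    · rintro ⟨⟨s, t⟩, h1, h2⟩
      exact ⟨s, t, h1, h2⟩
    · rintro ⟨s, t, h1, h2⟩
      exact ⟨(s, t), h1, h2⟩
  · rintro s t ⟨ht, ls, zs, hout, hls, hsp⟩
    have hbl := Blocks.of_split hμ hμd h4g h4e (by rwa [hs]) hls hsp
    have hlen := hbl.encode_le
    have hll : l.length ≤ P.n * P.n := by
      rw [← hs]
      exact le_trans (Finset.card_le_univ _) (card_edge_le _)
    have hst := P.st_le
    have hst' : P.st = 4 * (P.n * P.n) + 4 := rfl
    have hdM := P.d_le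
    have hnM := P.n_le'
    rw [hs] at hlen
    refine ⟨?_, ?_, fun a ha => setList_ne _ _ ha, ls, hbl, ?_⟩
    · rw [hin, hout]
      have h1 : (([P.n, P.D, P.g, P.d] ++ encodeVec (l.map fun e => (e, μ))).length : ℝ) =
          4 + 3 * l.length := by
        rw [List.length_append, encodeVec_length, List.length_map]
        push_cast
        simp
      have h2 : ((encodeVecs ls).length : ℝ) ≤ 4 * l.length + 1 := by exact_mod_cast hlen
      rw [Nat.cast_add, Nat.cast_add, Nat.cast_add, h1, Nat.cast_one]
      linarith
    · refine setList_bdd hb ?_ ?_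
      · rw [hout]; omega
      · intro x hx
        rw [hout] at hx
        unfold encodeVecs at hx
        obtain ⟨b, hb, hx⟩ := List.mem_flatMap.1 hx
        rcases List.mem_cons.1 hx with rfl | hx
        · have h3 := hbl.flatten_le
          rw [hs] at h3
          have h4 : b.length ≤ ls.flatten.length :=
            (List.sublist_flatten_of_mem hb).length_le
          omega
        · obtain ⟨r, hr, hx⟩ := List.mem_flatMap.1 hx
          have h3 := (hbl.sub b hb r hr).2.2
          have h4 := r.1.1.1.2
          have h5 := r.1.1.2.2
          simp only [List.mem_cons, List.not_mem_nil, or_false] at hx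
          rcases hx with rfl | rfl | rfl <;> omega
    · rw [← hout]
      exact setList_holds _ _ _

/-- Erasing the old block is bounded by the old base, and all else by the present number of edges.
Right after the rebuild no edge is touched and no entry of the first block is dead, so all counters
start from `0`. Buckets that are too light, and all buckets for large `γ` or `ε`, get the empty
block without a call. -/
theorem tri_rebuildP {S : Prog} {ts : ℝ} {p : ℝ≥0∞} (hW : Fits W P.M)
    (hS : IsStaticSplitAlgorithm S W P.n P.D P.g P.d ts p) {m : Mem}
    {X : Edge P.n → ℕ} (hX : IsFractionalMatching (fixedPoint P.D X)) {μ : ℕ}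
    {G : ℕ → Hist P.n} (h : DataInv P m X G) (hμ : μ ≠ 0) (hμD : μ ≤ P.D) (h5 : m 14 5 = μ)
    (hts : 0 ≤ ts) :
    Tri W (rebuildP S) m p fun m' t =>
      (t : ℝ) ≤ 20000 * (m 7 μ + m 4 μ + 1) + m 4 μ * ts ∧
      (∃ G', DataInv P m' X (Function.update G μ G') ∧ G'.passed = []) ∧
      m' 7 μ = m 4 μ ∧ m' 8 μ = 0 ∧ m' 9 μ = 0 ∧
      (∀ ν, ν ≠ μ → m' 7 ν = m 7 ν ∧ m' 8 ν = m 8 ν ∧ m' 9 ν = m 9 ν) ∧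
      (∀ a, a ∉ [1, 7, 8, 9, 10, 11, 12, 13, 14] → m' a = m a) ∧
      ∀ i, i ∉ [6, 7, 8] → m' 14 i = m 14 i := by
  have hst := P.st_le
  have hst' : P.st = 4 * (P.n * P.n) + 4 := rfl
  have hB := h.bucket μ hμ
  obtain ⟨l, hnd, hlen, hl, hL⟩ := h.list.exists_list hμ
  have hs : (bucketSet P X μ).card = l.length := by
    rw [← List.toFinset_card_of_nodup hnd]
    congr 1
    ext e
    rw [mem_bucketSet, List.mem_toFinset, hl]
  have hll : l.length ≤ P.n * P.n := by rw [hlen]; exact h.list.len_le hμ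
  have hcur : (G μ).cur.length ≤ m 7 μ := by
    rw [hB.base]
    refine le_trans ?_ hB.blocks.flatten_le
    rw [List.flatten_append, List.flatten_cons, List.length_append, List.length_append]
    omega
  have hh0 := h
  unfold rebuildP
  refine Tri.seq_det (h.tri_clear hW hμ hμD h5) ?_
  rintro m₁ t₁ ⟨ht₁, hw₁⟩
  have hp₁ : P.InMem m₁ := h.par.congr (hw₁.frame 2 (by decide))
  have h5₁ : m₁ 14 5 = μ := by rw [hw₁.locals 5 (by decide), h5]
  refine Tri.store_seq hW hw₁.bdd μ 0 (by simp [tv, h5₁]) rfl (Nat.zero_le _) fun hb => ?_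
  refine Tri.store_seq hW hb μ l.length (by simp [tv, Mem.set_apply, h5₁])
    (by simp [tv, Mem.set_apply, h5₁, hw₁.frame 4 (by decide), hlen]) (by omega) fun hb => ?_
  refine Tri.store_seq hW hb μ 0 (by simp [tv, Mem.set_apply, h5₁]) rfl (Nat.zero_le _) fun hb => ?_
  refine Tri.store_seq hW hb μ 0 (by simp [tv, Mem.set_apply, h5₁]) rfl (Nat.zero_le _) fun hb => ?_
  obtain ⟨m₂, hm₂⟩ : ∃ m₂, m₂ = (((m₁.set 8 μ 0).set 7 μ l.length).set 9 μ 0).set 10 μ 0 := ⟨_, rfl⟩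
  rw [← hm₂] at hb ⊢
  have hf₂ : ∀ a, a ∉ [1, 7, 8, 9, 10, 14] → m₂ a = m a := by
    intro a ha
    simp only [List.mem_cons, not_or, List.not_mem_nil] at ha
    rw [hm₂]
    simp [Mem.set_apply, ha, hw₁.frame a (by simp [ha])]
  have h14₂ : ∀ i, i ∉ [6, 7, 8] → m₂ 14 i = m 14 i := by
    intro i hi
    rw [hm₂]
    simp [Mem.set_apply, hw₁.locals i hi]
  have h1₂ : m₂ 1 = m₁ 1 := by rw [hm₂]; simp [Mem.set_apply]
  have h7₂ : m₂ 7 = Function.update (m 7) μ l.length := by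
    rw [hm₂]; simp [Mem.set_apply, hw₁.frame 7 (by decide)]
  have h8₂ : m₂ 8 = Function.update (m 8) μ 0 := by
    rw [hm₂]; simp [Mem.set_apply, hw₁.frame 8 (by decide)]
  have h9₂ : m₂ 9 = Function.update (m 9) μ 0 := by
    rw [hm₂]; simp [Mem.set_apply, hw₁.stray]
  have h10₂ : m₂ 10 = Function.update (m 10) μ 0 := by
    rw [hm₂]; simp [Mem.set_apply, hw₁.frame 10 (by decide)]
  have hp₂ : P.InMem m₂ := h.par.congr (hf₂ 2 (by decide))
  have h5₂ : m₂ 14 5 = μ := by rw [h14₂ 5 (by decide), h5]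
  have hlenR : (m 4 μ : ℝ) = l.length := by rw [hlen]
  have hcurR : ((G μ).cur.length : ℝ) ≤ m 7 μ := by exact_mod_cast hcur
  have ht₁R : (t₁ : ℝ) ≤ 1600 * ((G μ).cur.length + 1) := by exact_mod_cast ht₁
  have h7R : (0 : ℝ) ≤ m 7 μ := Nat.cast_nonneg _
  have hlR : (0 : ℝ) ≤ l.length := Nat.cast_nonneg _
  have hlts : 0 ≤ l.length * ts := mul_nonneg hlR hts
  have hactive : activeE.val m₂ ≠ 0 ↔
      4 * P.g < P.D ∧ 4 * P.e < P.D ∧ 4 * P.g ≤ μ * l.length := by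
    have h4 : m₂ 4 μ = l.length := by rw [hf₂ 4 (by decide), hlen]
    simp only [activeE, pv, tv, val_mul, val_ltE, val_sub, val_const, val_load, hp₂.D, hp₂.g, hp₂.e,
      h5₂, h4]
    rcases Nat.lt_or_ge (μ * l.length) (4 * P.g) with h1 | h1
    · simp [h1, not_le.2 h1]
    · simp [h1, not_lt.2 h1, and_comm]
  refine Tri.ite hW hb ?_ ?_
  · intro hc
    obtain ⟨h4g, h4e, hbig⟩ := hactive.1 hc
    refine Tri.seq_det (tri_gatherP hW hp₂ hb h5₂ hμD (by rw [hf₂ 4 (by decide), hlen])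
      (by rw [hf₂ 5 (by decide)]; exact hL) hll) ?_
    rintro m₃ t₃ ⟨ht₃, hb₃, hf₃, h14₃, hin⟩
    have ht₃R : (t₃ : ℝ) ≤ 2000 * (l.length + 1) := by exact_mod_cast ht₃
    rw [← add_zero p]
    refine Tri.seq (call_split hS hb₃ hX hμ hnd hl h4g h4e hbig hin) ?_
    rintro m₄ t₄ ⟨ht₄, hb₄, hf₄, ls, hbl, hho⟩
    have hel := hbl.encode_le
    rw [hs] at hel
    have hp₃ : P.InMem m₃ := hp₂.congr (hf₃ 2 (by decide))
    have hp₄ : P.InMem m₄ := hp₃.congr (hf₄ 2 (by decide))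
    have h5₄ : m₄ 14 5 = μ := by rw [hf₄ 14 (by decide), h14₃ 5 (by decide), h5₂]
    refine Tri.seq_det (tri_copyP hW hp₄ hb₄ h5₄ hho (by omega)) ?_
    rintro m₅ t₅ ⟨ht₅, hb₅, hf₅, h14₅, hho₅, h11₅⟩
    have ht₅R : (t₅ : ℝ) ≤ 1000 * ((4 * l.length + 1) + 1) := by
      have : t₅ ≤ 1000 * ((4 * l.length + 1) + 1) := by omega
      exact_mod_cast this
    -- A split without parts would cover nothing, whereas the bucket is nonempty because `4g ≤ μ|l|`
    -- and `g > 0`.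
    obtain ⟨b, rest, rfl⟩ : ∃ b rest, ls = b :: rest := by
      cases ls with
      | nil =>
        exfalso
        rcases hbl.alt with ⟨h1, -⟩ | ⟨-, -, h1, h2, -⟩
        · simp at h1
        · rw [hs] at h1 h2
          simp at h2
          have := P.g_pos
          rw [h2] at h1
          simp at h1
          omega
      | cons b rest => exact ⟨b, rest, rfl⟩
    have hp₅ : P.InMem m₅ := hp₄.congr (hf₅ 2 (by decide))
    have hf₄₂ : ∀ a, a ∉ [12, 13, 14, 11] → m₅ a = m₂ a := by
      intro a ha
      simp only [List.mem_cons, not_or, List.not_mem_nil] at ha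
      rw [hf₅ a (by simp [ha]), hf₄ a ha.2.1, hf₃ a (by simp [ha])]
    have hho₅' := hho₅
    rw [encodeVecs_cons, ← List.cons_append, holds_append] at hho₅'
    have hel' := hel
    rw [encodeVecs_cons, List.length_cons, List.length_append, encodeVec_length] at hel'
    have h10₅ : m₅ 10 μ = 0 := by rw [hf₄₂ 10 (by decide), h10₂]; simp
    refine (tri_walkP hW (X := X) (μ := μ) (b := b) le_rfl hp₅ hb₅
      (by rw [hf₄₂ 3 (by decide), hf₂ 3 (by decide)]; exact h.vec)
      (by rw [h14₅ 5 (by decide), h5₄]) hμD (by rw [h10₅]; exact hho₅'.1) (by omega)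
      (hbl.nodup_keys (by simp))).imp ?_
    rintro m₆ t₆ ⟨ht₆, hw₆⟩
    have hbl' : b.length ≤ l.length := by
      have := hbl.flatten_le
      rw [hs, List.flatten_cons, List.length_append] at this
      omega
    have ht₆R : (t₆ : ℝ) ≤ 1600 * (l.length + 1) := by
      have : t₆ ≤ 1600 * (l.length + 1) := by omega
      exact_mod_cast this
    have hf₆ : ∀ a, a ∉ [1, 9, 12, 13, 14, 11] → m₆ a = m₂ a := by
      intro a ha
      simp only [List.mem_cons, not_or, List.not_mem_nil] at ha
      rw [hw₆.frame a (by simp [ha]), hf₄₂ a (by simp [ha])]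
    have h9₆ : m₆ 9 = Function.update (m 9) μ 0 := by
      rw [hw₆.stray, hf₄₂ 9 (by decide), h9₂]
      have : strayCount P X μ b = 0 := by
        unfold strayCount
        rw [List.countP_eq_zero]
        intro r hr
        simp [mem_bucketSet.1 (hbl.sub b (by simp) r hr).1]
      rw [this, Function.update_idem]
    refine ⟨?_, ⟨⟨bucketSet P X μ, ∅, [], b, rest⟩, ?_, rfl⟩, ?_, ?_, ?_, ?_, ?_, ?_⟩
    · push_cast
      rw [hlenR]
      linarith
    · refine h.of_bucket hμ hw₆.bdd ?_ ?_ ?_ ?_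
        (BucketInv.of_reload ?_ ?_ ?_ ?_ ?_ hbl ?_ ?_ ?_ ?_)
      · intro a ha
        rw [hf₆ a (by fin_cases ha <;> decide), hf₂ a (by fin_cases ha <;> decide)]
      · intro ν hν
        rw [hf₆ 7 (by decide), hf₆ 8 (by decide), h9₆, hf₆ 10 (by decide), h7₂, h8₂, h10₂]
        simp [hν]
      · intro j hj
        rw [hw₆.frame 11 (by decide), h11₅ j hj, hf₄ 11 (by decide), hf₃ 11 (by decide),
          hf₂ 11 (by decide)]
      · intro e he
        rw [hw₆.miss e fun h => absurd h he, hf₄₂ 1 (by decide), h1₂,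
          hw₁.miss e fun h => absurd h he]
      · rw [hf₆ 7 (by decide), h7₂, hs]; simp
      · simp
      · intro e _
        exact mem_bucketSet
      · rw [hw₆.frame 11 (by decide), hf₆ 10 (by decide), h10₂, Function.update_self]
        exact hho₅
      · rw [hf₆ 10 (by decide), h10₂, Function.update_self]
        simp only
        omega
      · simp
      · rw [hw₆.stray]; simp
      · intro r hr hrμ
        rw [hw₆.hit r hr hrμ, one_mul]
      · intro e he hr
        rw [hw₆.miss e fun _ => hr, hf₄₂ 1 (by decide), h1₂]
        exact hh0.cleared hμ hw₁ he
    · rw [hf₆ 7 (by decide), h7₂, hlen]; simp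
    · rw [hf₆ 8 (by decide), h8₂]; simp
    · rw [h9₆]; simp
    · intro ν hν
      rw [hf₆ 7 (by decide), hf₆ 8 (by decide), h9₆, h7₂, h8₂]
      simp [hν]
    · intro a ha
      simp only [List.mem_cons, not_or, List.not_mem_nil] at ha
      rw [hf₆ a (by simp [ha]), hf₂ a (by simp [ha])]
    · intro i hi
      rw [hw₆.locals i hi]
      simp only [List.mem_cons, not_or, List.not_mem_nil] at hi
      rw [h14₅ i hi.1, hf₄ 14 (by decide), h14₃ i (by simp [hi]), h14₂ i (by simp [hi])]
  · intro hc
    have hin : P.D ≤ 4 * P.g ∨ P.D ≤ 4 * P.e ∨ μ * (bucketSet P X μ).card < 4 * P.g := by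
      rw [hs]
      by_contra hn
      push Not at hn
      exact hactive.2 hn hc
    refine (Tri.store hW hb (μ * P.st) 0 (by simp [tv, pv, h5₂, hp₂.st]) rfl (Nat.zero_le _)
      (Q := fun m' t => t = 201 ∧ MemBdd P.M m' ∧ m' = m₂.set 11 (μ * P.st) 0)
      fun hb => ⟨rfl, hb, rfl⟩).mono zero_le ?_
    rintro m₃ t₃ ⟨rfl, hb₃, hm₃⟩
    have hf₃ : ∀ a, a ≠ 11 → m₃ a = m₂ a := by
      intro a ha
      rw [hm₃]
      simp [Mem.set_apply, ha]
    have h11₃ : m₃ 11 = Function.update (m 11) (μ * P.st) 0 := by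
      rw [hm₃]
      simp [Mem.set_apply, hf₂ 11 (by decide)]
    refine ⟨201, le_rfl, ?_, ⟨⟨bucketSet P X μ, ∅, [], [], []⟩, ?_, rfl⟩, ?_, ?_, ?_, ?_, ?_, ?_⟩
    · push_cast
      rw [hlenR]
      linarith
    · refine h.of_bucket hμ hb₃ ?_ ?_ ?_ ?_
        (BucketInv.of_reload ?_ ?_ ?_ ?_ ?_ ?_ ?_ ?_ ?_ ?_)
      · intro a ha
        rw [hf₃ a (by fin_cases ha <;> decide), hf₂ a (by fin_cases ha <;> decide)]
      · intro ν hν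
        rw [hf₃ 7 (by decide), hf₃ 8 (by decide), hf₃ 9 (by decide), hf₃ 10 (by decide), h7₂, h8₂,
          h9₂, h10₂]
        simp [hν]
      · intro j hj
        rw [h11₃, Function.update_of_ne]
        omega
      · intro e he
        rw [hf₃ 1 (by decide), h1₂, hw₁.miss e fun h => absurd h he]
      · rw [hf₃ 7 (by decide), h7₂, hs]; simp
      · simp
      · intro e _
        exact mem_bucketSet
      · rw [h11₃, hf₃ 10 (by decide), h10₂, encodeVecs_cons, holds_cons]
        simp [encodeVec, encodeVecs, holds_nil]
      · rw [hf₃ 10 (by decide), h10₂, encodeVecs_length]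
        simp
        omega
      · exact ⟨by simp, by simp, Or.inl ⟨rfl, hin⟩⟩
      · simp
      · rw [hf₃ 9 (by decide), h9₂]
        simp [strayCount]
      · simp
      · intro e he _
        rw [hf₃ 1 (by decide), h1₂]
        exact hh0.cleared hμ hw₁ he
    · rw [hf₃ 7 (by decide), h7₂, hlen]; simp
    · rw [hf₃ 8 (by decide), h8₂]; simp
    · rw [hf₃ 9 (by decide), h9₂]; simp
    · intro ν hν
      rw [hf₃ 7 (by decide), hf₃ 8 (by decide), hf₃ 9 (by decide), h7₂, h8₂, h9₂]
      simp [hν]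
    · intro a ha
      simp only [List.mem_cons, not_or, List.not_mem_nil] at ha
      rw [hf₃ a (by simp [ha]), hf₂ a (by simp [ha])]
    · intro i hi
      rw [hf₃ 14 (by decide), h14₂ i hi]

end Rebuild

/-! ### Putting a bucket in order. -/

section Fix

variable {P : Par} {W : ℕ}

/-- The effect of `fixP` for bucket `μ`, whose new history is `G'`. -/
structure FixPost (P : Par) (ts : ℝ) (m : Mem) (X : Edge P.n → ℕ) (G : ℕ → Hist P.n) (μ : ℕ)
    (m' : Mem) (G' : Hist P.n) (t : ℕ) : Prop where
  inv : DataInv P m' X (Function.update G μ G')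
  cnt : m' 8 μ * P.D ≤ m' 7 μ * P.e
  dead : m' 9 μ * P.D ≤ 2 * P.e * G'.cur.length
  other : ∀ ν, ν ≠ μ → m' 7 ν = m 7 ν ∧ m' 8 ν = m 8 ν ∧ m' 9 ν = m 9 ν
  frame : ∀ a, a ∉ [1, 7, 8, 9, 10, 11, 12, 13, 14] → m' a = m a
  locals : ∀ i, i ∉ [6, 7, 8] → m' 14 i = m 14 i
  time : (m 7 μ * P.e < m 8 μ * P.D ∧ m' 8 μ = 0 ∧ G'.passed = [] ∧
      (t : ℝ) ≤ 20000 * (m 7 μ + m 4 μ + 2) + m 4 μ * ts) ∨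
    (m 8 μ * P.D ≤ m 7 μ * P.e ∧ m' 8 μ = m 8 μ ∧
      (t : ℝ) ≤ 1000 + 20000 * ((G'.passed.flatten.length : ℝ) - (G μ).passed.flatten.length))

theorem tri_fixP_zero (hW : Fits W P.M) {S : Prog} {m : Mem} (hb : MemBdd P.M m) (h5 : m 14 5 = 0)
    {p : ℝ≥0∞} {Q : Mem → ℕ → Prop} (hQ : Q m 102) : Tri W (fixP S) m p Q := by
  unfold fixP
  refine Tri.ite hW hb ?_ ?_
  · intro h
    exact absurd (by simp [tv, h5]) h
  · intro _
    exact (Tri.skip (Q := fun m' t => Q m' (t + 101)) hQ).mono zero_le fun m' t h => ⟨t, le_rfl, h⟩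

theorem DataInv.fixCond {m : Mem} {X : Edge P.n → ℕ} {μ : ℕ} {G : ℕ → Hist P.n}
    (h : DataInv P m X G) (hμ : μ ≠ 0) (h5 : m 14 5 = μ) :
    (ltE (.const 2 * pv 4 * .load 11 blockE) (.load 9 (tv 5) * pv 1)).val m =
      if 2 * P.e * (G μ).cur.length < m 9 μ * P.D then 1 else 0 := by
  have hh := (h.bucket μ hμ).holds
  rw [encodeVecs_cons, holds_cons] at hh
  simp [pv, tv, blockE, h.par.e, h.par.D, h.par.st, h5, hh.1]

/-- The number of remaining blocks decreases, and `BucketInv.rest_ne` provides a next block as long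
as the loop condition holds. The time is charged to the growth of the total length of the passed
blocks. -/
theorem tri_fixLoop (hW : Fits W P.M) {m : Mem} {X : Edge P.n → ℕ} {μ : ℕ} {G : ℕ → Hist P.n}
    (h : DataInv P m X G) (hμ : μ ≠ 0) (hμD : μ ≤ P.D) (h5 : m 14 5 = μ)
    (hc : m 8 μ * P.D ≤ m 7 μ * P.e) :
    Tri W (.loop (ltE (.const 2 * pv 4 * .load 11 blockE) (.load 9 (tv 5) * pv 1)) advanceP) m 0
      fun m' t => ∃ G', DataInv P m' X (Function.update G μ G') ∧
        m' 9 μ * P.D ≤ 2 * P.e * G'.cur.length ∧ (∀ a, a ∉ [1, 9, 10, 14] → m' a = m a) ∧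
        (∀ ν, ν ≠ μ → m' 9 ν = m 9 ν) ∧ (∀ i, i ∉ [6, 7, 8] → m' 14 i = m 14 i) ∧
        (t : ℝ) ≤ 101 + 20000 * ((G'.passed.flatten.length : ℝ) - (G μ).passed.flatten.length) := by
  let I : ℕ → Mem → ℕ → Prop := fun k m' t => ∃ G' : Hist P.n, k = G'.rest.length ∧
    DataInv P m' X (Function.update G μ G') ∧ (∀ a, a ∉ [1, 9, 10, 14] → m' a = m a) ∧
    (∀ ν, ν ≠ μ → m' 9 ν = m 9 ν) ∧ (∀ i, i ∉ [6, 7, 8] → m' 14 i = m 14 i) ∧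
    (t : ℝ) ≤ 20000 * ((G'.passed.flatten.length : ℝ) - (G μ).passed.flatten.length)
  refine Tri.loop_det hW (I := I) (k := (G μ).rest.length) rfl (by decide) ?_ ?_
  · rintro k m' t ⟨G', hk, hinv, hf, h9, h14, ht⟩
    refine ⟨hinv.bdd, ?_⟩
    have hB := hinv.bucket μ hμ
    have h5' : m' 14 5 = μ := by rw [h14 5 (by decide), h5]
    rw [hinv.fixCond hμ h5', Function.update_self]
    rcases Nat.lt_or_ge (2 * P.e * G'.cur.length) (m' 9 μ * P.D) with hd | hd
    · right
      refine ⟨by simp [hd], k - 1, ?_⟩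
      have hc' : m' 8 μ * P.D ≤ m' 7 μ * P.e := by
        rw [hf 7 (by decide), hf 8 (by decide)]; exact hc
      obtain ⟨hrest, hcur⟩ := hB.rest_ne hc' (by rw [Function.update_self]; exact hd)
      rw [Function.update_self] at hrest hcur
      obtain ⟨b, rest, hbr⟩ := List.exists_cons_of_ne_nil hrest
      refine ⟨by rw [hk, hbr]; simp, ?_⟩
      refine (tri_advanceP hW hinv hμ hμD h5' (b := b) (rest := rest)
        (by rw [Function.update_self]; exact hbr) (by rw [Function.update_self]; exact hd)).imp ?_
      rintro m₁ t₁ ⟨ht₁, hinv₁, hf₁, h9₁, h14₁⟩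
      rw [Function.update_self, Function.update_idem] at hinv₁
      rw [Function.update_self] at ht₁
      have hbl := hB.blocks
      rw [Function.update_self, hbr] at hbl
      have hb6 : b.length ≤ 6 * G'.cur.length := by
        rcases hbl.alt with ⟨h1, -⟩ | ⟨-, -, -, -, -, h2, -⟩
        · have := congrArg List.length h1
          simp at this
          omega
        · exact h2 b (by simp) G'.cur (by simp)
      have hcl : 0 < G'.cur.length := List.length_pos_iff.2 hcur
      refine ⟨rest.length, by rw [hk, hbr]; simp, _, rfl, hinv₁, ?_, ?_, ?_, ?_⟩
      · intro a ha
        rw [hf₁ a ha, hf a ha]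
      · intro ν hν
        rw [h9₁ ν hν, h9 ν hν]
      · intro i hi
        rw [h14₁ i hi, h14 i hi]
      -- The next block is at most `6` times as long as the current one, which is nonempty; so `1600
      -- · (7c + 2) + 401 ≤ 20000c`.
      · have h3 : t₁ + 101 ≤ 20000 * G'.cur.length := by omega
        have h4 : (t₁ : ℝ) + 101 ≤ 20000 * G'.cur.length := by exact_mod_cast h3
        push_cast
        simp only [List.flatten_append, List.length_append, List.flatten_cons, List.flatten_nil,
          List.append_nil]
        push_cast
        linarith
    · left
      refine ⟨by simp [not_lt.2 hd], G', hinv, hd, hf, h9, h14, ?_⟩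
      push_cast
      linarith
  · refine ⟨G μ, rfl, ?_, fun _ _ => rfl, fun _ _ => rfl, fun _ _ => rfl, by simp⟩
    rw [Function.update_eq_self]
    exact h

/-- A rebuild leaves no dead entries, so the loop ends at once after it; otherwise only
deterministic passing on takes place. At most one call of `S` is made, hence the failure probability
`p`. -/
theorem tri_fixP {S : Prog} {ts : ℝ} {p : ℝ≥0∞} (hW : Fits W P.M)
    (hS : IsStaticSplitAlgorithm S W P.n P.D P.g P.d ts p) {m : Mem}
    {X : Edge P.n → ℕ} (hX : IsFractionalMatching (fixedPoint P.D X)) {μ : ℕ}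
    {G : ℕ → Hist P.n} (h : DataInv P m X G) (hμ : μ ≠ 0) (hμD : μ ≤ P.D) (h5 : m 14 5 = μ)
    (hts : 0 ≤ ts) :
    Tri W (fixP S) m p fun m' t => ∃ G', FixPost P ts m X G μ m' G' t := by
  unfold fixP
  refine Tri.ite hW h.bdd ?_ (fun h0 => absurd (by simpa [tv, h5] using h0) hμ)
  intro _
  have hcond : (ltE (.load 7 (tv 5) * pv 4) (.load 8 (tv 5) * pv 1)).val m =
      if m 7 μ * P.e < m 8 μ * P.D then 1 else 0 := by
    simp [pv, tv, h5, h.par.e, h.par.D]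
  rw [← add_zero p]
  rcases Nat.lt_or_ge (m 7 μ * P.e) (m 8 μ * P.D) with hc | hc
  · refine Tri.seq (R := fun m' t => (∃ G', DataInv P m' X (Function.update G μ G') ∧ G'.passed = []) ∧
      (t : ℝ) ≤ 20000 * (m 7 μ + m 4 μ + 1) + m 4 μ * ts + 101 ∧
      m' 7 μ = m 4 μ ∧ m' 8 μ = 0 ∧ m' 9 μ = 0 ∧
      (∀ ν, ν ≠ μ → m' 7 ν = m 7 ν ∧ m' 8 ν = m 8 ν ∧ m' 9 ν = m 9 ν) ∧
      (∀ a, a ∉ [1, 7, 8, 9, 10, 11, 12, 13, 14] → m' a = m a) ∧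
      ∀ i, i ∉ [6, 7, 8] → m' 14 i = m 14 i) (Tri.ite hW h.bdd ?_ ?_) ?_
    · intro _
      refine (tri_rebuildP hW hS hX h hμ hμD h5 hts).imp ?_
      rintro m' t ⟨ht, hG, h7, h8, h9, ho, hf, h14⟩
      refine ⟨hG, ?_, h7, h8, h9, ho, hf, h14⟩
      push_cast
      linarith
    · intro h0
      rw [hcond, if_pos hc] at h0
      simp at h0
    · rintro m₁ t₁ ⟨⟨G₁, hinv, hpass⟩, ht₁, h7, h8, h9, ho, hf, h14⟩
      refine Tri.loop_det hW (I := fun _ m' t => m' = m₁ ∧ t = 0) (k := 0) rfl (by decide) ?_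
        ⟨rfl, rfl⟩
      rintro k m' t ⟨rfl, rfl⟩
      have hd : ¬ 2 * P.e * (Function.update G μ G₁ μ).cur.length < m' 9 μ * P.D := by simp [h9]
      refine ⟨hinv.bdd, Or.inl ⟨?_, G₁, hinv, by simp [h8], by simp [h9], ho, hf, h14,
        Or.inl ⟨hc, h8, hpass, ?_⟩⟩⟩
      · rw [hinv.fixCond hμ (by rw [h14 5 (by decide), h5]), if_neg hd]
      · push_cast
        linarith
  · refine Tri.seq (R := fun m' t => m' = m ∧ t = 102) (Tri.ite hW h.bdd ?_ ?_) ?_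
    · intro h0
      rw [hcond, if_neg (not_lt.2 hc)] at h0
      exact absurd rfl h0
    · intro _
      exact (Tri.skip (Q := fun m' t => m' = m ∧ t + 101 = 102) ⟨rfl, rfl⟩).mono zero_le
        fun m' t h => ⟨t, le_rfl, h⟩
    · rintro _ _ ⟨rfl, rfl⟩
      refine (tri_fixLoop hW h hμ hμD h5 hc).imp ?_
      rintro m' t ⟨G', hinv, hd, hf, h9, h14, ht⟩
      have h7 := hf 7 (by decide)
      have h8 := hf 8 (by decide)
      refine ⟨G', hinv, by rw [h7, h8]; exact hc, hd, ?_, ?_, h14, Or.inr ⟨hc, by rw [h8], ?_⟩⟩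
      · intro ν hν
        rw [h7, h8, h9 ν hν]
        exact ⟨rfl, rfl, rfl⟩
      · intro a ha
        simp only [List.mem_cons, not_or, List.not_mem_nil] at ha
        exact hf a (by simp [ha])
      · push_cast
        linarith

end Fix

/-! ### Invariants under a change of an entry. -/

section Change

variable {P : Par}

/-- The histories after a change of the edge `e` from bucket `μ₁` to bucket `μ₂`. -/
def touch (G : ℕ → Hist P.n) (e : Edge P.n) (μ₁ μ₂ : ℕ) : ℕ → Hist P.n := fun μ =>
  if μ = μ₁ ∨ μ = μ₂ then { G μ with touched := insert e (G μ).touched } else G μ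

theorem countP_touched_mono (b : List (Edge P.n × ℕ)) {s t : Finset (Edge P.n)} (h : s ⊆ t) :
    (b.countP fun r => r.1 ∈ s) ≤ b.countP fun r => r.1 ∈ t := by
  apply List.countP_mono_left
  intro r _ hr
  simp only [decide_eq_true_eq] at hr ⊢
  exact h hr

theorem countP_eq_add_of_unique {α : Type*} {l : List α} {p q : α → Bool} {a : α} (hnd : l.Nodup)
    (ha : a ∈ l) (hpa : p a = false) (hqa : q a = true) (h : ∀ b ∈ l, b ≠ a → p b = q b) :
    l.countP q = l.countP p + 1 := by
  induction l with
  | nil => simp at ha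
  | cons x l ih =>
    rw [List.nodup_cons] at hnd
    by_cases hx : x = a
    · subst hx
      rw [List.countP_cons, List.countP_cons, hpa, hqa]
      have : l.countP q = l.countP p := by
        apply List.countP_congr
        intro b hb
        rw [h b (by simp [hb]) (by rintro rfl; exact hnd.1 hb)]
      simp [this]
    · have hal : a ∈ l := by
        rcases List.mem_cons.1 ha with h | h
        · exact absurd h.symm hx
        · exact h
      rw [List.countP_cons, List.countP_cons, ih hnd.2 hal fun b hb => h b (by simp [hb]),
        h x (by simp) hx]
      ring

/-- In both buckets concerned the edge becomes touched, which removes all claims about it. If it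
goes to a genuine bucket, then its output is now `0`, while block entries are at least `d > 0`: it
is dead even if it stays in the same bucket. So the dead count grows by one exactly if the old
output was nonzero in this bucket. -/
theorem BucketInv.change {m m' : Mem} {X : Edge P.n → ℕ} {e : Edge P.n} {ν μ : ℕ}
    {G : ℕ → Hist P.n} (h : BucketInv P m X μ (G μ)) (hμ : μ ≠ 0)
    (hs : SetPost P m X e ν m') :
    BucketInv P m' (Function.update X e ν) μ (touch G e (P.bk (X e)) (P.bk ν) μ) := by
  classical
  have hf := hs.frame
  have hX : ∀ e', e' ≠ e → Function.update X e ν e' = X e' := fun e' he => by simp [he]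
  have ho : ∀ e', e' ≠ e → m' 1 (addr e') = m 1 (addr e') := by
    intro e' he
    rw [hs.out, Function.update_of_ne fun h => he (addr_inj h)]
  have hoe : P.bk ν ≠ 0 → m' 1 (addr e) = 0 := by
    intro h0
    rw [hs.out, Function.update_self, if_pos (P.bk_lt_of_ne h0)]
  have hbase : (touch G e (P.bk (X e)) (P.bk ν) μ).base = (G μ).base := by
    unfold touch; split_ifs <;> rfl
  have hpassed : (touch G e (P.bk (X e)) (P.bk ν) μ).passed = (G μ).passed := by
    unfold touch; split_ifs <;> rfl
  have hcur : (touch G e (P.bk (X e)) (P.bk ν) μ).cur = (G μ).cur := by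
    unfold touch; split_ifs <;> rfl
  have hrest : (touch G e (P.bk (X e)) (P.bk ν) μ).rest = (G μ).rest := by
    unfold touch; split_ifs <;> rfl
  have htouched : (touch G e (P.bk (X e)) (P.bk ν) μ).touched =
      if μ = P.bk (X e) ∨ μ = P.bk ν then insert e (G μ).touched else (G μ).touched := by
    unfold touch; split_ifs <;> rfl
  have hsubset : (G μ).touched ⊆ (touch G e (P.bk (X e)) (P.bk ν) μ).touched := by
    rw [htouched]
    split_ifs
    exacts [Finset.subset_insert _ _, subset_rfl]
  have hcase : e ∉ (touch G e (P.bk (X e)) (P.bk ν) μ).touched →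
      e ∉ (G μ).touched ∧ μ ≠ P.bk (X e) ∧ μ ≠ P.bk ν := by
    intro he
    refine ⟨fun h => he (hsubset h), ?_, ?_⟩ <;> rintro rfl <;> apply he <;> rw [htouched] <;> simp
  have hsub := h.blocks.sub (G μ).cur (by simp)
  have hd := P.d_pos
  refine ⟨?_, ?_, ?_, ?_, ?_, ?_, ?_, ?_, ?_, ?_⟩
  · rw [hf 7 (by decide), hbase]; exact h.base
  · rw [hs.cnt, htouched]
    have h1 := h.cnt
    have h2 := Finset.card_insert_le e (G μ).touched
    split_ifs with h3 h4 h5 h5 <;> omega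
  · intro e' he'
    rw [hbase]
    by_cases hee : e' = e
    · subst hee
      obtain ⟨h1, h2, h3⟩ := hcase he'
      rw [h.same _ h1, Function.update_self]
      exact ⟨fun h => absurd h.symm h2, fun h => absurd h.symm h3⟩
    · rw [h.same _ fun h => he' (hsubset h), hX _ hee]
  · rw [hf 11 (by decide), hf 10 (by decide), hcur, hrest]; exact h.holds
  · rw [hf 10 (by decide), hcur, hrest]; exact h.room
  · rw [hbase, hpassed, hcur, hrest]; exact h.blocks
  · intro b hb
    rw [hpassed] at hb
    exact lt_of_lt_of_le (h.bad b hb) (Nat.mul_le_mul_left _ (countP_touched_mono b hsubset))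
  · intro e' he'
    rw [hcur]
    by_cases hee : e' = e
    · subst hee
      rw [Function.update_self] at he'
      exact Or.inl (hoe (by rw [he']; exact hμ))
    · rw [hX _ hee] at he'
      rw [ho _ hee]
      exact h.out e' he'
  · intro r hr ht
    rw [hcur] at hr
    have hre : r.1 ≠ e := by
      intro hre
      rw [hre] at ht
      obtain ⟨h1, h2, h3⟩ := hcase ht
      have h4 := (hsub r hr).1
      rw [hre] at h4
      exact h2 ((h.same _ h1).1 h4).symm
    rw [ho _ hre]
    exact h.fresh r hr fun h => ht (hsubset h)
  · rw [hs.dcur, h.dead, hcur]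
    have hlive : ∀ r ∈ (G μ).cur, r.1 ≠ e →
        (Live P m' (Function.update X e ν) μ r ↔ Live P m X μ r) := by
      intro r _ hre
      unfold Live
      rw [hX _ hre, ho _ hre]
    have hdeade : ∀ r ∈ (G μ).cur, r.1 = e → ¬ Live P m' (Function.update X e ν) μ r := by
      rintro r hr rfl ⟨h1, h2⟩
      rw [Function.update_self] at h1
      have h3 := (hsub r hr).2.1
      rw [← h2, hoe (by rw [h1]; exact hμ)] at h3
      omega
    unfold deadCount
    by_cases hc : P.bk (X e) ≠ 0 ∧ μ = P.bk (X e) ∧ m 1 (addr e) ≠ 0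
    · rw [if_pos hc]
      obtain ⟨-, h1, h2⟩ := hc
      have h3 : (e, m 1 (addr e)) ∈ (G μ).cur := (h.out e h1.symm).resolve_left h2
      have hkeys := h.blocks.nodup_keys (b := (G μ).cur) (by simp)
      symm
      refine countP_eq_add_of_unique (List.Nodup.of_map _ hkeys) h3 ?_ ?_ ?_
      · simpa [Live] using h1.symm
      · simpa using hdeade _ h3 rfl
      · intro r hr hre
        have hre' : r.1 ≠ e := by
          intro h4
          exact hre (List.inj_on_of_nodup_map hkeys hr h3 h4)
        simp [hlive r hr hre']
    · rw [if_neg hc, add_zero]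
      apply List.countP_congr
      intro r hr
      rw [decide_eq_true_eq, decide_eq_true_eq]
      by_cases hre : r.1 = e
      · simp only [hdeade r hr hre, not_false_iff, iff_true]
        rintro ⟨h1, h2⟩
        apply hc
        rw [hre] at h1 h2
        have h3 := (hsub r hr).2.1
        exact ⟨by rw [h1]; exact hμ, h1.symm, by omega⟩
      · rw [hlive r hr hre]

theorem DataInv.change {m m' : Mem} {X : Edge P.n → ℕ} {e : Edge P.n} {ν : ℕ}
    {G : ℕ → Hist P.n} (h : DataInv P m X G) (hν : ν ≤ P.D) (hs : SetPost P m X e ν m') :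
    DataInv P m' (Function.update X e ν) (touch G e (P.bk (X e)) (P.bk ν)) := by
  have hf := hs.frame
  have ho : ∀ e', e' ≠ e → m' 1 (addr e') = m 1 (addr e') := by
    intro e' he
    rw [hs.out, Function.update_of_ne fun h => he (addr_inj h)]
  refine ⟨h.par.congr (hf 2 (by decide)), hs.bdd, ?_, ?_, hs.list, ?_, ?_, ?_⟩
  · intro e'
    rw [hs.vec]
    by_cases he : e' = e
    · subst he; simp
    · rw [Function.update_of_ne fun h => he (addr_inj h), Function.update_of_ne he, h.vec]
  · intro e'
    by_cases he : e' = e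
    · subst he; simpa using hν
    · rw [Function.update_of_ne he]; exact h.le e'
  · intro e' he'
    by_cases he : e' = e
    · subst he
      rw [Function.update_self] at he' ⊢
      rw [hs.out, Function.update_self, if_neg (not_lt.2 he')]
    · rw [Function.update_of_ne he] at he' ⊢
      rw [ho _ he]
      exact h.large _ he'
  · intro e' he' h0
    by_cases he : e' = e
    · subst he
      rw [Function.update_self] at he'
      rw [hs.out, Function.update_self, if_pos he']
    · rw [Function.update_of_ne he] at he' h0
      rw [ho _ he]
      exact h.tiny _ he' h0
  · intro μ hμ
    exact (h.bucket μ hμ).change hμ hs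

end Change

/-! ### Calculus of errors. -/

section Small

variable {n : ℕ}

/-- Up to an error of `b`, the vector `w` has size `0` and degrees at most `a`. -/
structure SmallError (a b : ℝ) (w : Edge n → ℝ) : Prop where
  size : |size w| ≤ b
  vertex : ∑ v : Fin n, max 0 (|vertexSum w v| - a) ≤ b

theorem vertexSum_add (w w' : Edge n → ℝ) (v : Fin n) :
    vertexSum (fun e => w e + w' e) v = vertexSum w v + vertexSum w' v := by
  unfold vertexSum
  rw [← Finset.sum_add_distrib]
  refine Finset.sum_congr rfl fun e _ => ?_
  split_ifs <;> simp

theorem vertexSum_sub (w w' : Edge n → ℝ) (v : Fin n) :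
    vertexSum (fun e => w e - w' e) v = vertexSum w v - vertexSum w' v := by
  unfold vertexSum
  rw [← Finset.sum_sub_distrib]
  refine Finset.sum_congr rfl fun e _ => ?_
  split_ifs <;> simp

theorem size_sub (w w' : Edge n → ℝ) : size (fun e => w e - w' e) = size w - size w' := by
  unfold size
  rw [Finset.sum_sub_distrib]

/-- The map `t ↦ (|t| - a)⁺` is subadditive if the thresholds add up too. This additivity of
thresholds is why the number of buckets enters the vertex slack. -/
theorem SmallError.add {a b a' b' : ℝ} {w w' : Edge n → ℝ}
    (h : SmallError a b w) (h' : SmallError a' b' w') :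
    SmallError (a + a') (b + b') fun e => w e + w' e := by
  constructor
  · have : _root_.size (fun e => w e + w' e) = _root_.size w + _root_.size w' := by
      unfold _root_.size
      rw [Finset.sum_add_distrib]
    rw [this]
    exact le_trans (abs_add_le _ _) (add_le_add h.size h'.size)
  · refine le_trans ?_ (add_le_add h.vertex h'.vertex)
    rw [← Finset.sum_add_distrib]
    refine Finset.sum_le_sum fun v _ => ?_
    rw [vertexSum_add]
    have h1 := abs_add_le (vertexSum w v) (vertexSum w' v)
    have h2 := le_max_left 0 (|vertexSum w v| - a)
    have h3 := le_max_right 0 (|vertexSum w v| - a)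
    have h4 := le_max_left 0 (|vertexSum w' v| - a')
    have h5 := le_max_right 0 (|vertexSum w' v| - a')
    exact max_le (by linarith) (by linarith)

theorem SmallError.mono {a b a' b' : ℝ} {w : Edge n → ℝ}
    (h : SmallError a b w) (ha : a ≤ a') (hb : b ≤ b') :
    SmallError a' b' w := by
  refine ⟨h.size.trans hb, le_trans (Finset.sum_le_sum fun v _ => ?_) (h.vertex.trans hb)⟩
  exact max_le_max le_rfl (by linarith)

/-- Every edge has two ends, so the degrees change by at most `2c` in total, and no threshold is
needed. -/
theorem SmallError.of_sum_abs {w : Edge n → ℝ} {c : ℝ} (h : ∑ e, |w e| ≤ c) :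
    SmallError 0 (2 * c) w := by
  have hc : 0 ≤ c := le_trans (Finset.sum_nonneg fun e _ => abs_nonneg _) h
  constructor
  · have : |_root_.size w| ≤ ∑ e, |w e| := Finset.abs_sum_le_sum_abs _ _
    linarith
  · have h1 : ∀ v : Fin n, max 0 (|vertexSum w v| - 0) ≤
        ∑ e : Edge n, ((if e.1.1 = v then |w e| else 0) + if e.1.2 = v then |w e| else 0) := by
      intro v
      rw [sub_zero, max_eq_right (abs_nonneg _)]
      refine le_trans (Finset.abs_sum_le_sum_abs _ _) (Finset.sum_le_sum fun e _ => ?_)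
      have := abs_nonneg (w e)
      by_cases h1 : e.1.1 = v <;> by_cases h2 : e.1.2 = v <;> simp [h1, h2]
    refine le_trans (Finset.sum_le_sum fun v _ => h1 v) ?_
    rw [Finset.sum_comm]
    have h2 : ∀ e : Edge n, (∑ v : Fin n, ((if e.1.1 = v then |w e| else 0) +
        if e.1.2 = v then |w e| else 0)) = 2 * |w e| := by
      intro e
      rw [Finset.sum_add_distrib]
      simp
      ring
    rw [Finset.sum_congr rfl fun e _ => h2 e, ← Finset.mul_sum]
    linarith

theorem SmallError.sum {ι : Type*} {s : Finset ι} {a : ℝ} {b : ι → ℝ} {w : ι → Edge n → ℝ}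
    (h : ∀ i ∈ s, SmallError a (b i) (w i)) :
    SmallError (s.card * a) (∑ i ∈ s, b i) fun e => ∑ i ∈ s, w i e := by
  classical
  induction s using Finset.induction_on with
  | empty => simpa using SmallError.of_sum_abs (n := n) (w := fun _ => 0) (c := 0) (by simp)
  | insert i s hi ih =>
    have h1 := (h i (by simp)).add (ih fun j hj => h j (by simp [hj]))
    have h2 : (fun e => ∑ j ∈ insert i s, w j e) = fun e => w i e + ∑ j ∈ s, w j e := by
      funext e
      rw [Finset.sum_insert hi]
    rw [h2, Finset.sum_insert hi, Finset.card_insert_of_notMem hi]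
    exact h1.mono (by push_cast; linarith) le_rfl

end Small

/-! ### Rounding and the number of buckets. -/

section Buckets

variable {P : Par}

theorem Par.bk_spec {k : ℕ} (h : P.bk k ≠ 0) :
    k < P.d ∧ P.g ≤ k * (P.n * P.n) ∧ P.bk k = k - k % (P.width k + 1) := by
  unfold Par.bk at h ⊢
  split_ifs at h ⊢ with hc
  · exact ⟨hc.1, hc.2, rfl⟩
  · exact absurd rfl h

theorem Par.width_mul_le {k : ℕ} (hk : k ≠ 0) : P.width k * P.D ≤ P.e * k := by
  unfold Par.width
  exact le_trans (Nat.div_mul_le_self _ _) (Nat.mul_le_mul_left _ (Nat.log2_self_le hk))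

/-- A value that is not tiny is never rounded down to `0`: this would require `k ≤ width k ≤ εk`,
but `ε < 1`. -/
theorem Par.tiny_of_bk {k : ℕ} (h : P.bk k = 0) (hd : k < P.d) : k * (P.n * P.n) < P.g := by
  by_contra hg
  rw [not_lt] at hg
  have hk : k ≠ 0 := by
    rintro rfl
    have := P.g_pos
    omega
  unfold Par.bk at h
  rw [if_pos ⟨hd, hg⟩] at h
  have h1 := Nat.mod_lt k (by omega : P.width k + 1 > 0)
  have h2 : k ≤ P.width k := by
    have : k ≤ k % (P.width k + 1) := by omega
    omega
  have h3 := P.width_mul_le hk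
  have h4 : k * P.D ≤ P.e * k := le_trans (Nat.mul_le_mul_right _ h2) h3
  have h5 := P.e_lt
  rw [mul_comm P.e] at h4
  have := Nat.le_of_mul_le_mul_left h4 (Nat.pos_of_ne_zero hk)
  omega

theorem Par.sub_bk_le {k : ℕ} (h : P.bk k ≠ 0) : (k - P.bk k) * P.D ≤ P.e * k := by
  obtain ⟨-, h2, h3⟩ := P.bk_spec h
  have hk : k ≠ 0 := by
    rintro rfl
    have := P.g_pos
    omega
  refine le_trans (Nat.mul_le_mul_right _ ?_) (P.width_mul_le hk)
  have h1 := Nat.mod_lt k (by omega : P.width k + 1 > 0)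
  omega

/-- The buckets in use. -/
def Par.buckets (P : Par) : Finset ℕ := ((Finset.range (P.D + 1)).image P.bk).erase 0

theorem Par.mem_buckets {μ : ℕ} : μ ∈ P.buckets ↔ μ ≠ 0 ∧ ∃ k ≤ P.D, P.bk k = μ := by
  simp [Par.buckets]

/-- The logarithms of the entries in buckets. -/
def Par.octaves (P : Par) : Finset ℕ :=
  (Finset.range (P.D + 1)).filter fun s => 2 ^ s ≤ P.D ∧ P.g < 2 ^ (s + 1) * (P.n * P.n)

/-- A bucket is determined by the logarithm of its entries and the quotient by the width plus one.
Rounding within an octave, the quotient is at most `2 ^ (s + 1) / (ε 2 ^ s) = 2/ε`. -/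
theorem Par.card_buckets_le : P.buckets.card ≤ P.octaves.card * (2 * P.D / P.e + 1) := by
  have hsub : P.buckets ⊆ (P.octaves ×ˢ Finset.range (2 * P.D / P.e + 1)).image
      fun r => r.2 * (P.e * 2 ^ r.1 / P.D + 1) := by
    intro μ hμ
    obtain ⟨h0, k, hkD, rfl⟩ := Par.mem_buckets.1 hμ
    obtain ⟨-, h2, h3⟩ := P.bk_spec h0
    have hk : k ≠ 0 := by
      rintro rfl
      have := P.g_pos
      omega
    have hlo := Nat.log2_self_le hk
    have hhi : k < 2 ^ (Nat.log2 k + 1) := Nat.lt_log2_self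
    rw [Finset.mem_image]
    refine ⟨(Nat.log2 k, k / (P.width k + 1)), ?_, ?_⟩
    · rw [Finset.mem_product, Par.octaves, Finset.mem_filter, Finset.mem_range, Finset.mem_range]
      refine ⟨⟨?_, le_trans hlo hkD, ?_⟩, ?_⟩
      · exact Nat.lt_succ_of_le (le_trans (le_trans Nat.lt_two_pow_self.le hlo) hkD)
      · refine lt_of_le_of_lt h2 (Nat.mul_lt_mul_of_pos_right hhi ?_)
        have := P.two_le
        positivity
      · have hD : 0 < P.D := by have := P.e_lt; omega
        have h4 : P.e * 2 ^ Nat.log2 k < P.D * (P.width k + 1) := by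
          unfold Par.width
          exact Nat.lt_mul_div_succ _ hD
        rw [Nat.lt_succ_iff, Nat.le_div_iff_mul_le P.e_pos]
        have h5 := Nat.div_mul_le_self k (P.width k + 1)
        have h6 : k / (P.width k + 1) * P.e * (P.width k + 1) ≤ 2 * P.D * (P.width k + 1) := by
          calc k / (P.width k + 1) * P.e * (P.width k + 1)
              = k / (P.width k + 1) * (P.width k + 1) * P.e := by ring
            _ ≤ k * P.e := Nat.mul_le_mul_right _ h5
            _ ≤ 2 ^ (Nat.log2 k + 1) * P.e := Nat.mul_le_mul_right _ hhi.le
            _ = 2 * (P.e * 2 ^ Nat.log2 k) := by ring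
            _ ≤ 2 * (P.D * (P.width k + 1)) := Nat.mul_le_mul_left _ h4.le
            _ = 2 * P.D * (P.width k + 1) := by ring
        exact Nat.le_of_mul_le_mul_right h6 (Nat.succ_pos _)
    · show k / (P.width k + 1) * (P.width k + 1) = P.bk k
      rw [h3]
      have := Nat.div_add_mod k (P.width k + 1)
      rw [mul_comm] at this
      omega
  refine le_trans (Finset.card_le_card hsub) (le_trans Finset.card_image_le ?_)
  rw [Finset.card_product, Finset.card_range]

/-- `log (n / γ)`. -/
noncomputable def Par.L (P : Par) : ℝ := Real.log ((P.g / P.D : ℝ)⁻¹ * P.n)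

theorem Par.D_pos (P : Par) : (0 : ℝ) < P.D := by
  have := P.e_lt
  exact_mod_cast (by omega : 0 < P.D)

theorem Par.L_eq (P : Par) : P.L = Real.log P.D - Real.log P.g + Real.log P.n := by
  have hg : (0 : ℝ) < P.g := by exact_mod_cast P.g_pos
  have hn : (0 : ℝ) < P.n := by exact_mod_cast (by have := P.two_le; omega : 0 < P.n)
  have hD := P.D_pos
  rw [Par.L, inv_div, Real.log_mul (by positivity) hn.ne', Real.log_div hD.ne' hg.ne']

theorem Par.log_two_le : Real.log 2 ≤ P.L := by
  have hg : (0 : ℝ) < P.g := by exact_mod_cast P.g_pos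
  have h1 : Real.log P.g ≤ Real.log P.D :=
    Real.log_le_log hg (by exact_mod_cast P.g_lt.le)
  have h2 : Real.log 2 ≤ Real.log P.n :=
    Real.log_le_log two_pos (by exact_mod_cast P.two_le)
  rw [P.L_eq]
  linarith

/-- Entries in buckets are between `g/n²` and `D`, a ratio of at most `(n/γ)²`. The largest and the
smallest octave satisfy `(b - a - 1) log 2 ≤ 2L`; the missing two steps are absorbed by `log 2 ≤ L`,
and `4 / log 2 < 6`. -/
theorem Par.card_octaves_le : (P.octaves.card : ℝ) ≤ 6 * P.L := by
  have hl := P.log_two_le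
  have h2 := Real.log_two_gt_d9
  rcases P.octaves.eq_empty_or_nonempty with he | hne
  · rw [he]
    simp
    linarith
  set a := P.octaves.min' hne with ha
  set b := P.octaves.max' hne with hb
  have hab : a ≤ b := P.octaves.min'_le _ (P.octaves.max'_mem hne)
  have hcard : P.octaves.card ≤ b - a + 1 := by
    have : P.octaves ⊆ Finset.Icc a b := fun s hs =>
      Finset.mem_Icc.2 ⟨P.octaves.min'_le _ hs, P.octaves.le_max' _ hs⟩
    have := Finset.card_le_card this
    rw [Nat.card_Icc] at this
    omega
  have ha' := (Finset.mem_filter.1 (P.octaves.min'_mem hne)).2.2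
  have hb' := (Finset.mem_filter.1 (P.octaves.max'_mem hne)).2.1
  rw [← ha] at ha'
  rw [← hb] at hb'
  have hg : (0 : ℝ) < P.g := by exact_mod_cast P.g_pos
  have hn : (0 : ℝ) < P.n := by exact_mod_cast (by have := P.two_le; omega : 0 < P.n)
  have hla : Real.log P.g ≤ (a + 1) * Real.log 2 + 2 * Real.log P.n := by
    have : (P.g : ℝ) ≤ 2 ^ (a + 1) * (P.n * P.n) := by exact_mod_cast ha'.le
    have := Real.log_le_log hg this
    rw [Real.log_mul (by positivity) (by positivity), Real.log_pow,
      Real.log_mul (by positivity) (by positivity)] at this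
    push_cast at this
    linarith
  have hlb : b * Real.log 2 ≤ Real.log P.D := by
    have : (2 : ℝ) ^ b ≤ P.D := by exact_mod_cast hb'
    have := Real.log_le_log (by positivity) this
    rwa [Real.log_pow] at this
  have hgD : Real.log P.g ≤ Real.log P.D := Real.log_le_log hg (by exact_mod_cast P.g_lt.le)
  have h3 : ((b : ℝ) - a - 1) * Real.log 2 ≤ 2 * P.L := by
    rw [P.L_eq]
    nlinarith
  have h4 : (P.octaves.card : ℝ) ≤ b - a + 1 := by
    have : (P.octaves.card : ℝ) ≤ ((b - a : ℕ) : ℝ) + 1 := by exact_mod_cast hcard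
    rwa [Nat.cast_sub hab] at this
  have h5 : ((b : ℝ) - a + 1) * Real.log 2 ≤ 4 * P.L := by linarith
  have h6 : 0 ≤ (b : ℝ) - a := by
    have : (a : ℝ) ≤ b := by exact_mod_cast hab
    linarith
  nlinarith

theorem Par.card_buckets_le_log :
    (P.buckets.card : ℝ) ≤ 18 * ((P.e / P.D : ℝ)⁻¹ * P.L) := by
  have h1 : (P.buckets.card : ℝ) ≤ P.octaves.card * ((2 * P.D / P.e : ℕ) + 1) := by
    exact_mod_cast P.card_buckets_le
  have he : (0 : ℝ) < P.e := by exact_mod_cast P.e_pos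
  have hle : (P.e : ℝ) ≤ P.D := by exact_mod_cast P.e_lt.le
  have h2 : ((2 * P.D / P.e : ℕ) : ℝ) ≤ 2 * P.D / P.e := by
    refine le_trans Nat.cast_div_le ?_
    push_cast
    exact le_rfl
  have h3 : (1 : ℝ) ≤ P.D / P.e := by rwa [le_div_iff₀ he, one_mul]
  have h4 : ((2 * P.D / P.e : ℕ) : ℝ) + 1 ≤ 3 * (P.D / P.e) := by
    rw [mul_div_assoc] at h2
    linarith
  rw [inv_div]
  have := P.card_octaves_le
  have h0 : (0 : ℝ) ≤ P.octaves.card := Nat.cast_nonneg _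
  have h5 : 0 ≤ P.L := by linarith
  calc (P.buckets.card : ℝ) ≤ P.octaves.card * ((2 * P.D / P.e : ℕ) + 1) := h1
    _ ≤ (6 * P.L) * (3 * (P.D / P.e)) := by gcongr
    _ = 18 * (P.D / P.e * P.L) := by ring

end Buckets

/-! ### The error of one bucket. -/

section Error

variable {P : Par}

open Classical in
/-- The part of `Y` in bucket `μ` of `X`. -/
noncomputable def bucketPart (P : Par) (X : Edge P.n → ℕ) (μ : ℕ) (Y : Edge P.n → ℕ) :
    Edge P.n → ℝ :=
  fun e => if P.bk (X e) = μ then (Y e : ℝ) / P.D else 0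

theorem bucketPart_nonneg {X Y : Edge P.n → ℕ} {μ : ℕ} (e : Edge P.n) :
    0 ≤ bucketPart P X μ Y e := by
  unfold bucketPart
  split_ifs <;> positivity

theorem SmallError.congr {n : ℕ} {a b : ℝ} {w w' : Edge n → ℝ} (h : SmallError a b w)
    (hw : ∀ e, w' e = w e) : SmallError a b w' := by
  rw [funext hw]
  exact h

/-- On untouched edges of the bucket only the rounding error `x_e - μ ≤ ε x_e` occurs. On a touched
edge the difference is crudely at most `3μ`, as `x_e ≤ 2μ` for `ε < 1/4`, and there are at most
`ε|base|` touched edges. -/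
theorem BucketInv.sum_sub_base_le {m : Mem} {X : Edge P.n → ℕ} {μ : ℕ} {G : Hist P.n}
    (h : BucketInv P m X μ G) (hμ : μ ≠ 0) (hc : m 8 μ * P.D ≤ m 7 μ * P.e)
    (he : 4 * P.e < P.D) :
    ∑ e, |bucketPart P X μ X e - fixedPoint P.D (constVec μ G.base) e| ≤
      (P.e / P.D : ℝ) * size (bucketPart P X μ X) +
        3 * (P.e / P.D : ℝ) * size (fixedPoint P.D (constVec μ G.base)) := by
  classical
  have hD := P.D_pos
  have hε : (P.e / P.D : ℝ) < 1 / 4 := by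
    rw [div_lt_iff₀ hD]
    have : (4 * P.e : ℝ) < P.D := by exact_mod_cast he
    linarith
  have hε0 : (0 : ℝ) ≤ P.e / P.D := by positivity
  have hμD : (0 : ℝ) ≤ μ / P.D := by positivity
  have hkey : ∀ e, P.bk (X e) = μ → (μ : ℝ) / P.D ≤ (X e : ℝ) / P.D ∧
      (X e : ℝ) / P.D - μ / P.D ≤ (P.e / P.D : ℝ) * (X e / P.D) := by
    intro e hbe
    have h1 := P.bk_le (X e)
    have h2 := P.sub_bk_le (k := X e) (by rwa [hbe])
    rw [hbe] at h1 h2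
    have h3 : ((X e : ℝ) - μ) * P.D ≤ P.e * X e := by
      rw [← Nat.cast_sub h1]
      exact_mod_cast h2
    refine ⟨by gcongr, ?_⟩
    rw [← sub_div, div_mul_div_comm, div_le_div_iff₀ hD (by positivity)]
    calc ((X e : ℝ) - μ) * (P.D * P.D) = ((X e : ℝ) - μ) * P.D * P.D := by ring
      _ ≤ P.e * X e * P.D := by gcongr
  have hpt : ∀ e, |bucketPart P X μ X e - fixedPoint P.D (constVec μ G.base) e| ≤
      (P.e / P.D : ℝ) * bucketPart P X μ X e +
        if e ∈ G.touched then 3 * (μ / P.D : ℝ) else 0 := by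
    intro e
    by_cases hbe : P.bk (X e) = μ
    · obtain ⟨h1, h2⟩ := hkey e hbe
      have h3 : (X e : ℝ) / P.D ≤ 2 * (μ / P.D) := by
        have : (0 : ℝ) ≤ X e / P.D := by positivity
        nlinarith
      simp only [bucketPart, fixedPoint, constVec, hbe, if_true]
      by_cases ht : e ∈ G.touched
      · rw [if_pos ht]
        have h4 : (0 : ℝ) ≤ (P.e / P.D : ℝ) * (X e / P.D) := by positivity
        split_ifs
        · rw [abs_of_nonneg (by linarith)]
          linarith
        · rw [Nat.cast_zero, zero_div, sub_zero, abs_of_nonneg (by positivity)]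
          linarith
      · rw [if_neg ht, if_pos ((h.same e ht).2 hbe), abs_of_nonneg (by linarith)]
        linarith
    · simp only [bucketPart, fixedPoint, constVec, hbe, if_false]
      by_cases ht : e ∈ G.touched
      · rw [if_pos ht]
        split_ifs
        · rw [zero_sub, abs_neg, abs_of_nonneg hμD]
          linarith
        · simp
          positivity
      · rw [if_neg ht, if_neg fun hb => hbe ((h.same e ht).1 hb)]
        simp
  refine le_trans (Finset.sum_le_sum fun e _ => hpt e) ?_
  rw [Finset.sum_add_distrib, ← Finset.mul_sum, size_constVec]
  refine add_le_add le_rfl ?_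
  rw [← Finset.sum_filter, Finset.sum_const, Finset.filter_mem_eq_inter, Finset.univ_inter,
    nsmul_eq_mul]
  have h1 : (G.touched.card : ℝ) ≤ (P.e / P.D : ℝ) * G.base.card := by
    rw [div_mul_eq_mul_div, le_div_iff₀ hD]
    rw [h.base] at hc
    have := h.cnt
    have : (G.touched.card : ℝ) * P.D ≤ G.base.card * P.e := by
      exact_mod_cast le_trans (Nat.mul_le_mul_right _ this) hc
    linarith
  calc (G.touched.card : ℝ) * (3 * (μ / P.D)) ≤ (P.e / P.D : ℝ) * G.base.card * (3 * (μ / P.D)) := by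
        gcongr
    _ = _ := by ring

theorem ListsEntries.length_mul_le {b : List (Edge P.n × ℕ)} {Y : Edge P.n → ℕ}
    (h : ListsEntries b Y) (hb : ∀ r ∈ b, P.d ≤ r.2) :
    (b.length : ℝ) * (P.d / P.D) ≤ size (fixedPoint P.D Y) := by
  have hD : 0 < P.D := by have := P.e_lt; omega
  rw [size_eq_sum_supp (fixedPoint_nonneg _ _), ← h.length_eq hD, ← nsmul_eq_mul]
  refine Finset.card_nsmul_le_sum _ _ _ fun e he => ?_
  rw [mem_supp_fixedPoint hD] at he
  have := hb (e, Y e) ((h.2 e (Y e)).2 ⟨rfl, he⟩)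
  simp only at this
  unfold fixedPoint
  gcongr

/-- Block and output differ only on dead entries. There are at most `2ε|cur|` of them, each below
`2δ`, whereas every entry of the block contributes at least `δ` to its size. -/
theorem BucketInv.sum_sub_out_le {m : Mem} {X : Edge P.n → ℕ} {μ : ℕ} {G : Hist P.n}
    (h : BucketInv P m X μ G) (hd : m 9 μ * P.D ≤ 2 * P.e * G.cur.length) {Y : Edge P.n → ℕ}
    (hY : ListsEntries G.cur Y) :
    ∑ e, |fixedPoint P.D Y e - bucketPart P X μ (outputVector P.n m) e| ≤
      4 * (P.e / P.D : ℝ) * size (fixedPoint P.D Y) := by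
  classical
  have hD := P.D_pos
  have hb : ∀ r ∈ G.cur, r.1 ∈ G.base ∧ P.d ≤ r.2 ∧ r.2 < 2 * P.d :=
    h.blocks.sub G.cur (by simp)
  set dead := (G.cur.filter fun r => ¬ Live P m X μ r).map Prod.fst with hdead
  have hpt : ∀ e, |fixedPoint P.D Y e - bucketPart P X μ (outputVector P.n m) e| ≤
      if e ∈ dead.toFinset then 2 * (P.d / P.D : ℝ) else 0 := by
    intro e
    have hout : P.bk (X e) = μ → m 1 (addr e) = 0 ∨ (Y e = m 1 (addr e) ∧ m 1 (addr e) ≠ 0) :=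
      fun hbe => (h.out e hbe).imp_right fun h' => (hY.2 _ _).1 h'
    have haddr : outputVector P.n m e = m 1 (addr e) := rfl
    by_cases hYe : Y e = 0
    · have : bucketPart P X μ (outputVector P.n m) e = 0 := by
        unfold bucketPart
        split_ifs with hbe
        · rw [haddr]
          rcases hout hbe with h0 | ⟨h1, h2⟩
          · simp [h0]
          · exact absurd (h1.symm.trans hYe) h2
        · rfl
      rw [this]
      simp only [fixedPoint, hYe]
      simp
      split_ifs <;> positivity
    · have hmem : (e, Y e) ∈ G.cur := (hY.2 _ _).2 ⟨rfl, hYe⟩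
      by_cases hl : Live P m X μ (e, Y e)
      · obtain ⟨h1, h2⟩ := hl
        simp only at h1 h2
        simp only [bucketPart, h1, if_true, haddr, h2, fixedPoint, sub_self, abs_zero]
        split_ifs <;> positivity
      · have hde : e ∈ dead.toFinset := by
          rw [List.mem_toFinset, hdead, List.mem_map]
          exact ⟨(e, Y e), List.mem_filter.2 ⟨hmem, by simpa using hl⟩, rfl⟩
        have : bucketPart P X μ (outputVector P.n m) e = 0 := by
          unfold bucketPart
          split_ifs with hbe
          · rw [haddr]
            rcases hout hbe with h0 | ⟨h1, h2⟩
            · simp [h0]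
            · exact absurd ⟨hbe, h1.symm⟩ hl
          · rfl
        rw [this, if_pos hde, sub_zero, abs_of_nonneg (fixedPoint_nonneg _ _ _)]
        have := (hb _ hmem).2.2
        simp only at this
        have : (Y e : ℝ) ≤ 2 * P.d := by exact_mod_cast this.le
        unfold fixedPoint
        rw [← mul_div_assoc]
        gcongr
  refine le_trans (Finset.sum_le_sum fun e _ => hpt e) ?_
  rw [← Finset.sum_filter, Finset.sum_const, Finset.filter_mem_eq_inter, Finset.univ_inter,
    nsmul_eq_mul]
  have h1 : dead.toFinset.card ≤ m 9 μ := by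
    refine le_trans (List.toFinset_card_le _) ?_
    rw [h.dead, hdead, List.length_map, ← List.countP_eq_length_filter, deadCount]
  have h2 : (m 9 μ : ℝ) ≤ 2 * (P.e / P.D : ℝ) * G.cur.length := by
    rw [mul_assoc, div_mul_eq_mul_div, ← mul_div_assoc, le_div_iff₀ hD, ← mul_assoc]
    exact_mod_cast hd
  have h3 := hY.length_mul_le fun r hr => (hb r hr).2.1
  have h4 : (dead.toFinset.card : ℝ) ≤ m 9 μ := by exact_mod_cast h1
  calc (dead.toFinset.card : ℝ) * (2 * (P.d / P.D))
      ≤ (2 * (P.e / P.D : ℝ) * G.cur.length) * (2 * (P.d / P.D)) := by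
        gcongr
        linarith
    _ = 4 * (P.e / P.D : ℝ) * (G.cur.length * (P.d / P.D)) := by ring
    _ ≤ _ := by gcongr

/-- All sizes are compared with that of `x` on the bucket, where `‖z‖ ≤ 5‖a‖` and `‖y‖ ≤ (3/2)‖z‖`.
The `ℓ₁`-errors, doubled for the degrees, are `2ε‖a‖ + 6ε‖z‖ + 8ε‖y‖ ≤ 92ε‖a‖`, and the coarsening
adds `γ‖z‖ + γ`. For an empty block, the base weight below `4γ` forces `‖a‖ ≤ 12γ`, so the loss is
at most `24γ`. -/
theorem BucketInv.error {m : Mem} {X : Edge P.n → ℕ} {μ : ℕ} {G : Hist P.n}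
    (h : BucketInv P m X μ G) (hμ : μ ≠ 0) (hc : m 8 μ * P.D ≤ m 7 μ * P.e)
    (hd : m 9 μ * P.D ≤ 2 * P.e * G.cur.length) (hg : 4 * P.g < P.D) (he : 4 * P.e < P.D) :
    SmallError (P.g / P.D : ℝ)
      ((92 * (P.e / P.D : ℝ) + 5 * (P.g / P.D : ℝ)) * size (bucketPart P X μ X) +
        24 * (P.g / P.D : ℝ))
      fun e => bucketPart P X μ X e - bucketPart P X μ (outputVector P.n m) e := by
  have hD := P.D_pos
  have hA := h.sum_sub_base_le hμ hc he
  set ε : ℝ := P.e / P.D with hεd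
  set γ : ℝ := P.g / P.D with hγd
  set a := bucketPart P X μ X with ha
  set z := fixedPoint P.D (constVec μ G.base) with hz
  have hε0 : 0 ≤ ε := by positivity
  have hγ0 : 0 ≤ γ := by positivity
  have hε : ε < 1 / 4 := by
    rw [hεd, div_lt_iff₀ hD]
    have : (4 * P.e : ℝ) < P.D := by exact_mod_cast he
    linarith
  have hγ : γ < 1 / 4 := by
    rw [hγd, div_lt_iff₀ hD]
    have : (4 * P.g : ℝ) < P.D := by exact_mod_cast hg
    linarith
  have ha0 : 0 ≤ size a := Finset.sum_nonneg fun e _ => bucketPart_nonneg e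
  have hz0 : 0 ≤ size z := Finset.sum_nonneg fun e _ => fixedPoint_nonneg _ _ e
  have haz : |size a - size z| ≤ ∑ e, |a e - z e| := by
    rw [← size_sub]
    exact Finset.abs_sum_le_sum_abs _ _
  have hz5 : size z ≤ 5 * size a := by
    have := (abs_le.1 (haz.trans hA)).1
    nlinarith
  have hsz : size z = μ * G.base.card / P.D := by
    rw [hz, size_constVec]
    ring
  rcases h.blocks.alt with ⟨h1, h2⟩ | ⟨-, -, h3, -, -, -, h4⟩
  · have hcur : G.cur = [] := by
      have : G.cur ∈ G.passed ++ G.cur :: G.rest := by simp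
      rw [h1] at this
      simpa using this
    have hout : ∀ e, bucketPart P X μ (outputVector P.n m) e = 0 := by
      intro e
      unfold bucketPart
      split_ifs with hbe
      · have := h.out e hbe
        rw [hcur] at this
        have h0 : outputVector P.n m e = 0 := by
          change m 1 (addr e) = 0
          simpa using this
        simp [h0]
      · rfl
    have hzs : size z < 4 * γ := by
      rw [hsz, hγd, ← mul_div_assoc]
      have h2 : μ * G.base.card < 4 * P.g := by omega
      have : (μ * G.base.card : ℝ) < 4 * P.g := by exact_mod_cast h2
      gcongr
    have has : size a ≤ 12 * γ := by
      have := (abs_le.1 (haz.trans hA)).2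
      nlinarith
    have hs : SmallError 0 (2 * size a) a := by
      refine SmallError.of_sum_abs (le_of_eq (Finset.sum_congr rfl fun e _ => ?_))
      exact abs_of_nonneg (bucketPart_nonneg e)
    refine (hs.mono hγ0 ?_).congr fun e => by rw [hout, sub_zero]
    have : 0 ≤ (92 * ε + 5 * γ) * size a := by positivity
    linarith
  · obtain ⟨Y, hY, hco⟩ := h4 G.cur (by simp)
    have hC := h.sum_sub_out_le hd hY
    set y := fixedPoint P.D Y with hy
    have h4z : 4 * γ ≤ size z := by
      rw [hsz, hγd, ← mul_div_assoc]
      have : (4 * P.g : ℝ) ≤ μ * G.base.card := by exact_mod_cast h3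
      gcongr
    have hgs : |size z - size y| ≤ γ * size z + γ := hco.globalSlack
    have hys : size y ≤ 3 / 2 * size z := by
      have := (abs_le.1 hgs).1
      nlinarith
    have e1 : SmallError 0 (2 * (ε * size a + 3 * ε * size z)) fun e => a e - z e :=
      SmallError.of_sum_abs hA
    have e2 : SmallError γ (γ * size z + γ) fun e => z e - y e := by
      constructor
      · rw [size_sub]
        exact hgs
      · have := hco.vertexSlack
        simp only [vertexSum_sub]
        exact this
    have e3 : SmallError 0 (2 * (4 * ε * size y))
        fun e => y e - bucketPart P X μ (outputVector P.n m) e := SmallError.of_sum_abs hC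
    refine (((e1.add e2).add e3).mono (by linarith) ?_).congr fun e => by ring
    nlinarith [mul_nonneg hε0 ha0, mul_nonneg hγ0 ha0, mul_le_mul_of_nonneg_left hz5 hε0,
      mul_le_mul_of_nonneg_left hz5 hγ0, mul_le_mul_of_nonneg_left hys hε0]

end Error

/-! ### The output is a coarsening. -/

section Coarsening

variable {P : Par}

/-- At most `n²` edges with values of at most `γ/n²` each. -/
theorem Par.sum_tiny_le {X : Edge P.n → ℕ} (w : Edge P.n → ℝ)
    (hw : ∀ e, |w e| ≤ if X e < P.d ∧ P.bk (X e) = 0 then (X e : ℝ) / P.D else 0) :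
    ∑ e, |w e| ≤ (P.g / P.D : ℝ) := by
  have hD := P.D_pos
  have hn : (0 : ℝ) < P.n * P.n := by
    have := P.two_le
    exact_mod_cast (by positivity : 0 < P.n * P.n)
  have h1 : ∀ e, |w e| ≤ (P.g / P.D : ℝ) / (P.n * P.n) := by
    intro e
    refine (hw e).trans ?_
    split_ifs with h
    · have := P.tiny_of_bk h.2 h.1
      have : (X e : ℝ) * (P.n * P.n) ≤ P.g := by exact_mod_cast this.le
      rw [div_div, div_le_div_iff₀ hD (by positivity)]
      calc (X e : ℝ) * (P.D * (P.n * P.n)) = X e * (P.n * P.n) * P.D := by ring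
        _ ≤ P.g * P.D := by gcongr
    · positivity
  refine le_trans (Finset.sum_le_sum fun e _ => h1 e) ?_
  rw [Finset.sum_const, nsmul_eq_mul, ← mul_div_assoc, div_le_iff₀ hn, mul_comm]
  have : ((Finset.univ : Finset (Edge P.n)).card : ℝ) ≤ P.n * P.n := by
    have := card_edge_le P.n
    rw [Finset.card_univ]
    exact_mod_cast this
  gcongr

theorem sum_size_bucketPart_le {X : Edge P.n → ℕ} :
    ∑ μ ∈ P.buckets, size (bucketPart P X μ X) ≤ size (fixedPoint P.D X) := by
  unfold size
  rw [Finset.sum_comm]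
  refine Finset.sum_le_sum fun e _ => ?_
  unfold bucketPart
  rw [Finset.sum_ite_eq]
  split_ifs
  · exact le_rfl
  · exact fixedPoint_nonneg _ _ e

/-- Every edge is large, tiny, or in exactly one bucket. Large entries have no error, the tiny ones
contribute `2γ`, and the buckets contribute their errors, with thresholds `γ` adding up over the
buckets. -/
theorem DataInv.error {m : Mem} {X : Edge P.n → ℕ} {G : ℕ → Hist P.n} (h : DataInv P m X G)
    (hc : ∀ μ, μ ≠ 0 → m 8 μ * P.D ≤ m 7 μ * P.e)
    (hd : ∀ μ, μ ≠ 0 → m 9 μ * P.D ≤ 2 * P.e * (G μ).cur.length)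
    (hg : 4 * P.g < P.D) (he : 4 * P.e < P.D) :
    SmallError (P.buckets.card * (P.g / P.D : ℝ))
      ((92 * (P.e / P.D : ℝ) + 5 * (P.g / P.D : ℝ)) * size (fixedPoint P.D X) +
        (24 * P.buckets.card + 2) * (P.g / P.D : ℝ))
      fun e => fixedPoint P.D X e - fixedPoint P.D (outputVector P.n m) e := by
  classical
  have hD := P.D_pos
  have h1 := SmallError.sum (s := P.buckets) fun μ hμ =>
    (h.bucket μ (Par.mem_buckets.1 hμ).1).error (Par.mem_buckets.1 hμ).1
      (hc μ (Par.mem_buckets.1 hμ).1) (hd μ (Par.mem_buckets.1 hμ).1) hg he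
  let w : Edge P.n → ℝ := fun e => if X e < P.d ∧ P.bk (X e) = 0 then (X e : ℝ) / P.D else 0
  have h2 : SmallError 0 (2 * (P.g / P.D : ℝ)) w := by
    refine SmallError.of_sum_abs (P.sum_tiny_le (X := X) w fun e => ?_)
    rw [abs_of_nonneg]
    simp only [w]
    split_ifs <;> positivity
  refine ((h1.add h2).mono (by simp) ?_).congr fun e => ?_
  · rw [Finset.sum_add_distrib, ← Finset.mul_sum, Finset.sum_const, nsmul_eq_mul]
    have h3 := sum_size_bucketPart_le (P := P) (X := X)
    have h4 : (92 * (P.e / P.D : ℝ) + 5 * (P.g / P.D : ℝ)) *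
        ∑ μ ∈ P.buckets, size (bucketPart P X μ X) ≤
        (92 * (P.e / P.D : ℝ) + 5 * (P.g / P.D : ℝ)) * size (fixedPoint P.D X) := by gcongr
    linarith
  · have haddr : outputVector P.n m e = m 1 (addr e) := rfl
    have h5 : ∀ Y : Edge P.n → ℕ, ∀ μ, bucketPart P X μ Y e =
        if P.bk (X e) = μ then (Y e : ℝ) / P.D else 0 := by
      intro Y μ
      unfold bucketPart
      split_ifs <;> rfl
    simp only [h5]
    rw [Finset.sum_sub_distrib, Finset.sum_ite_eq, Finset.sum_ite_eq]
    simp only [w, fixedPoint]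
    by_cases hb : P.bk (X e) = 0
    · have hm : P.bk (X e) ∉ P.buckets := fun hm => (Par.mem_buckets.1 hm).1 hb
      rw [if_neg hm, if_neg hm]
      by_cases hl : X e < P.d
      · rw [if_pos ⟨hl, hb⟩, haddr, h.tiny e hl hb]
        simp
      · rw [if_neg fun h' => hl h'.1, haddr, h.large e (not_lt.1 hl)]
        simp
    · have hm : P.bk (X e) ∈ P.buckets := Par.mem_buckets.2 ⟨hb, X e, h.le e, rfl⟩
      rw [if_pos hm, if_pos hm, if_neg fun h' => hb h'.2, add_zero]

theorem DataInv.out_eq_zero {m : Mem} {X : Edge P.n → ℕ} {G : ℕ → Hist P.n} (h : DataInv P m X G)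
    (hdeg : P.D ≤ 4 * P.g ∨ P.D ≤ 4 * P.e) {e : Edge P.n} (hl : X e < P.d) :
    m 1 (addr e) = 0 := by
  by_cases hb : P.bk (X e) = 0
  · exact h.tiny e hl hb
  have hB := h.bucket _ hb
  rcases hB.blocks.alt with ⟨h1, h2⟩ | ⟨h3, h4, -⟩
  · have hcur : (G (P.bk (X e))).cur = [] := by
      have : (G (P.bk (X e))).cur ∈
        (G (P.bk (X e))).passed ++ (G (P.bk (X e))).cur :: (G (P.bk (X e))).rest := by simp
      rw [h1] at this
      simpa using this
    simpa [hcur] using hB.out e rfl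
  · omega

/-- With `c = γ ε⁻¹ L`, the number of buckets times `γ` is at most `18c`, and `γ ≤ (3/2)c` because
`ε⁻¹ L ≥ log 2 > 2/3`; so all terms of `DataInv.error` fit into `K(ε + c)`. The conditions on single
edges hold by the range of block entries. -/
theorem DataInv.isCoarsening {m : Mem} {X : Edge P.n → ℕ} {G : ℕ → Hist P.n} (h : DataInv P m X G)
    (hc : ∀ μ, μ ≠ 0 → m 8 μ * P.D ≤ m 7 μ * P.e)
    (hd : ∀ μ, μ ≠ 0 → m 9 μ * P.D ≤ 2 * P.e * (G μ).cur.length) {K : ℝ} (hK : 1000 ≤ K) :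
    IsCoarsening (K * (P.e / P.D + P.g / P.D * (P.e / P.D : ℝ)⁻¹ * P.L)) (P.d / P.D)
      (fixedPoint P.D X) (fixedPoint P.D (outputVector P.n m)) := by
  have hD := P.D_pos
  have hDn : 0 < P.D := by exact_mod_cast hD
  have hL := P.log_two_le
  have hlog := Real.log_two_gt_d9
  have hB := P.card_buckets_le_log
  have hsmall : ∀ e, X e < P.d → outputVector P.n m e = 0 ∨
      (P.bk (X e) ≠ 0 ∧ P.d ≤ outputVector P.n m e ∧ outputVector P.n m e < 2 * P.d) := by
    intro e hl
    by_cases hb : P.bk (X e) = 0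
    · exact Or.inl (h.tiny e hl hb)
    · rcases (h.bucket _ hb).out e rfl with h0 | h1
      · exact Or.inl h0
      · have := (h.bucket _ hb).blocks.sub _ (by simp) _ h1
        exact Or.inr ⟨hb, this.2⟩
  set ε : ℝ := P.e / P.D with hεd
  set γ : ℝ := P.g / P.D with hγd
  have hε0 : 0 < ε := div_pos (by exact_mod_cast P.e_pos) hD
  have hγ0 : 0 < γ := div_pos (by exact_mod_cast P.g_pos) hD
  have hε1 : ε < 1 := by
    rw [hεd, div_lt_one hD]
    exact_mod_cast P.e_lt
  have hεinv : 1 ≤ ε⁻¹ := (one_le_inv₀ hε0).2 hε1.le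
  set x := fixedPoint P.D X with hx
  have hx0 : 0 ≤ size x := Finset.sum_nonneg fun e _ => fixedPoint_nonneg _ _ e
  set c := γ * ε⁻¹ * P.L with hcd
  have hγc : γ ≤ 3 / 2 * c := by
    have h1 : 2 / 3 ≤ ε⁻¹ * P.L := by nlinarith
    have : c = γ * (ε⁻¹ * P.L) := by rw [hcd]; ring
    rw [this]
    nlinarith
  have hc0 : 0 < c := by linarith
  have hBc : P.buckets.card * γ ≤ 18 * c := by
    calc P.buckets.card * γ ≤ 18 * (ε⁻¹ * P.L) * γ := by gcongr
      _ = 18 * c := by rw [hcd]; ring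
  have hse : ∃ a b, a ≤ K * (ε + c) ∧
      b ≤ K * (ε + c) * size x + K * (ε + c) ∧
      SmallError a b fun e => x e - fixedPoint P.D (outputVector P.n m) e := by
    by_cases hdeg : 4 * P.g < P.D ∧ 4 * P.e < P.D
    · refine ⟨_, _, ?_, ?_, h.error hc hd hdeg.1 hdeg.2⟩
      · nlinarith
      · have h1 : 92 * ε + 5 * γ ≤ K * (ε + c) := by nlinarith
        have h2 : (24 * (P.buckets.card : ℝ) + 2) * γ ≤ K * (ε + c) := by nlinarith
        exact add_le_add (mul_le_mul_of_nonneg_right h1 hx0) h2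
    · have hdeg' : P.D ≤ 4 * P.g ∨ P.D ≤ 4 * P.e := by omega
      have h14 : 1 / 4 ≤ γ ∨ 1 / 4 ≤ ε := by
        rcases hdeg' with h1 | h1
        · left
          rw [hγd, le_div_iff₀ hD]
          have : (P.D : ℝ) ≤ 4 * P.g := by exact_mod_cast h1
          linarith
        · right
          rw [hεd, le_div_iff₀ hD]
          have : (P.D : ℝ) ≤ 4 * P.e := by exact_mod_cast h1
          linarith
      -- In the degenerate case the output vanishes on small entries, so the `ℓ₁`-error is at most
      -- `‖x‖`, hence the error in the sense of `SmallError` is at most `2‖x‖`, which is below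
      -- `η‖x‖`.
      have h2 : 2 ≤ K * (ε + c) := by
        rcases h14 with h1 | h1 <;> nlinarith
      refine ⟨0, 2 * size x, by linarith, ?_, SmallError.of_sum_abs ?_⟩
      · have := mul_le_mul_of_nonneg_right h2 hx0
        linarith
      · refine Finset.sum_le_sum fun e _ => ?_
        have haddr : outputVector P.n m e = m 1 (addr e) := rfl
        have h3 : 0 ≤ (X e : ℝ) / P.D := by positivity
        simp only [hx, fixedPoint, haddr]
        rcases Nat.lt_or_ge (X e) P.d with hl | hl
        · rw [h.out_eq_zero hdeg' hl]
          simp [abs_of_nonneg h3]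
        · rw [h.large e hl]
          simpa using h3
  obtain ⟨a, b, ha, hb, hs⟩ := hse
  have hs := hs.mono ha hb
  refine ⟨fixedPoint_nonneg _ _, ?_, ?_, ?_, ?_, ?_⟩
  · intro e he
    rw [mem_supp_fixedPoint hDn] at he ⊢
    intro h0
    rcases hsmall e (by rw [h0]; exact P.d_pos) with h1 | ⟨h1, -⟩
    · exact he h1
    · have := P.bk_le (X e)
      omega
  · rw [← size_sub]
    exact hs.size
  · have := hs.vertex
    simp only [vertexSum_sub] at this
    exact this
  · intro e he
    simp only [hx, fixedPoint] at he ⊢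
    rw [div_lt_div_iff_of_pos_right hD] at he
    rcases hsmall e (by exact_mod_cast he) with h1 | ⟨-, h1, h2⟩
    · left
      simp [h1]
    · right
      rw [← mul_div_assoc, div_le_div_iff_of_pos_right hD, div_lt_div_iff_of_pos_right hD]
      exact ⟨by exact_mod_cast h1, by exact_mod_cast h2⟩
  · intro e he
    simp only [hx, fixedPoint] at he ⊢
    rw [div_le_div_iff_of_pos_right hD] at he
    have haddr : outputVector P.n m e = m 1 (addr e) := rfl
    rw [haddr, h.large e (by exact_mod_cast he)]

end Coarsening

/-! ### Amortized cost of an update. -/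

section Amortization

variable {P : Par} {W : ℕ}

theorem DataInv.frame {m m' : Mem} {X : Edge P.n → ℕ} {G : ℕ → Hist P.n} (h : DataInv P m X G)
    (hb : MemBdd P.M m') (hf : ∀ a, a ∉ [0, 14] → m' a = m a) : DataInv P m' X G := by
  refine ⟨h.par.congr (hf 2 (by decide)), hb, ?_, h.le, ?_, ?_, ?_, ?_⟩
  · rw [hf 3 (by decide)]
    exact h.vec
  · rw [hf 4 (by decide), hf 5 (by decide), hf 6 (by decide)]
    exact h.list
  · rw [hf 1 (by decide)]
    exact h.large
  · rw [hf 1 (by decide)]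
    exact h.tiny
  · intro μ hμ
    refine (h.bucket μ hμ).congr (by rw [hf 7 (by decide)]) (by rw [hf 8 (by decide)])
      (by rw [hf 9 (by decide)]) (by rw [hf 10 (by decide)]) ?_ ?_
    · intro i _
      rw [hf 11 (by decide)]
    · intro e _
      rw [hf 1 (by decide)]

/-- An edge that has entered the bucket since the last rebuild is touched. -/
theorem DataInv.len_le_add {m : Mem} {X : Edge P.n → ℕ} {G : ℕ → Hist P.n} (h : DataInv P m X G)
    {μ : ℕ} (hμ : μ ≠ 0) : m 4 μ ≤ m 7 μ + m 8 μ := by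
  classical
  have hB := h.bucket μ hμ
  rw [h.list.len_eq hμ, hB.base]
  refine le_trans (Finset.card_le_card (t := (G μ).base ∪ (G μ).touched) ?_)
    (le_trans (Finset.card_union_le _ _) (Nat.add_le_add_left hB.cnt _))
  intro e he
  rw [Finset.mem_filter] at he
  rw [Finset.mem_union]
  by_cases ht : e ∈ (G μ).touched
  · exact Or.inr ht
  · exact Or.inl ((hB.same e ht).2 he.2)

/-- Bucket `μ` is in order. -/
def Fixed (P : Par) (m : Mem) (G : ℕ → Hist P.n) (μ : ℕ) : Prop :=
  m 8 μ * P.D ≤ m 7 μ * P.e ∧ m 9 μ * P.D ≤ 2 * P.e * (G μ).cur.length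

/-- In a bucket in order there are at most `ε|base| ≤ n²` changes, and the dead entries belong to
one block; so the counters cannot overflow during the next update. -/
theorem Fixed.counters_le {m : Mem} {X : Edge P.n → ℕ} {G : ℕ → Hist P.n} {μ : ℕ}
    (hf : Fixed P m G μ) (h : BucketInv P m X μ (G μ)) : m 8 μ ≤ P.st ∧ m 9 μ ≤ P.st := by
  have hbase : (G μ).base.card ≤ P.n * P.n :=
    le_trans (Finset.card_le_univ _) (card_edge_le P.n)
  have hst : P.st = 4 * (P.n * P.n) + 4 := rfl
  constructor
  · have h1 := hf.1
    rw [h.base] at h1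
    have h2 := P.e_lt
    have h3 : m 8 μ * P.D ≤ (G μ).base.card * P.D :=
      le_trans h1 (Nat.mul_le_mul_left _ h2.le)
    have := Nat.le_of_mul_le_mul_right h3 (by omega)
    omega
  · have h1 : m 9 μ ≤ (G μ).cur.length := by
      rw [h.dead, deadCount]
      exact List.countP_le_length
    have h2 := h.blocks.flatten_le
    simp only [List.flatten_append, List.flatten_cons, List.length_append] at h2
    omega

/-- The cost of a change of a bucket. -/
noncomputable def Par.price (P : Par) (ts : ℝ) : ℝ := 200000 * (ts * (P.D / P.e))

/-- The potential. -/
noncomputable def potential (P : Par) (ts : ℝ) (m : Mem) (G : ℕ → Hist P.n) : ℝ :=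
  ∑ μ ∈ Finset.Icc 1 P.D, (P.price ts * m 8 μ - 20000 * ((G μ).passed.flatten.length : ℝ))

theorem Par.one_le_ratio (P : Par) : (1 : ℝ) ≤ P.D / P.e := by
  have he : (0 : ℝ) < P.e := by exact_mod_cast P.e_pos
  rw [le_div_iff₀ he, one_mul]
  exact_mod_cast P.e_lt.le

theorem BucketInv.passed_le_real {m : Mem} {X : Edge P.n → ℕ} {μ : ℕ} {G : Hist P.n}
    (h : BucketInv P m X μ G) :
    20000 * (G.passed.flatten.length : ℝ) ≤ 10000 * (P.D / P.e * m 8 μ) := by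
  have he : (0 : ℝ) < P.e := by exact_mod_cast P.e_pos
  have h1 : (2 * P.e * G.passed.flatten.length : ℝ) ≤ P.D * m 8 μ := by exact_mod_cast h.passed_le
  rw [div_mul_eq_mul_div, ← mul_div_assoc, le_div_iff₀ he]
  linarith

/-- Passing on has spent at most `20000 / (2ε)` per change (`BucketInv.passed_le`), and each change
has paid twenty times as much. -/
theorem DataInv.potential_nonneg {ts : ℝ} (hts : 1 ≤ ts) {m : Mem} {X : Edge P.n → ℕ}
    {G : ℕ → Hist P.n} (h : DataInv P m X G) : 0 ≤ potential P ts m G := by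
  refine Finset.sum_nonneg fun μ hμ => ?_
  have h1 := (h.bucket μ (by have := (Finset.mem_Icc.1 hμ).1; omega)).passed_le_real
  have h2 := P.one_le_ratio
  have h3 : (0 : ℝ) ≤ P.D / P.e * m 8 μ := by positivity
  have h4 : P.D / P.e * m 8 μ ≤ ts * (P.D / P.e * m 8 μ) := le_mul_of_one_le_left h3 hts
  have h5 : P.price ts * m 8 μ = 200000 * (ts * (P.D / P.e * m 8 μ)) := by
    rw [Par.price]
    ring
  rw [h5]
  linarith

theorem potential_update {ts : ℝ} {m m' : Mem} {G : ℕ → Hist P.n} {G' : Hist P.n} {μ : ℕ}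
    (hμ : μ ≠ 0) (hμD : μ ≤ P.D) (h : ∀ ν, ν ≠ μ → m' 8 ν = m 8 ν) :
    potential P ts m' (Function.update G μ G') = potential P ts m G +
      (P.price ts * m' 8 μ - 20000 * (G'.passed.flatten.length : ℝ)) -
      (P.price ts * m 8 μ - 20000 * ((G μ).passed.flatten.length : ℝ)) := by
  have hmem : μ ∈ Finset.Icc 1 P.D := Finset.mem_Icc.2 ⟨by omega, hμD⟩
  unfold potential
  rw [← Finset.add_sum_erase _ _ hmem, ← Finset.add_sum_erase (Finset.Icc 1 P.D)
    (fun ν => P.price ts * m 8 ν - 20000 * ((G ν).passed.flatten.length : ℝ)) hmem]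
  have : ∑ ν ∈ (Finset.Icc 1 P.D).erase μ, (P.price ts * m' 8 ν -
        20000 * ((Function.update G μ G' ν).passed.flatten.length : ℝ)) =
      ∑ ν ∈ (Finset.Icc 1 P.D).erase μ,
        (P.price ts * m 8 ν - 20000 * ((G ν).passed.flatten.length : ℝ)) := by
    refine Finset.sum_congr rfl fun ν hν => ?_
    have := Finset.ne_of_mem_erase hν
    rw [h ν this, Function.update_of_ne this]
  rw [this, Function.update_self]
  ring

/-- Let `y` be the number of changes divided by `ε`. At a rebuild both `|base|` and the number of
changes are at most `y`, so the time is `O(t_s y)`, and the price `200000 t_s y` less the at most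
`10000y` already spent covers it. Without a rebuild the time is, up to a constant, exactly what the
passed blocks take from the potential. -/
theorem FixPost.time_le {ts : ℝ} (hts : 1 ≤ ts) {m m' : Mem} {X : Edge P.n → ℕ}
    {G : ℕ → Hist P.n} {G' : Hist P.n} {μ t : ℕ} (hμ : μ ≠ 0) (hμD : μ ≤ P.D)
    (h : DataInv P m X G) (hf : FixPost P ts m X G μ m' G' t) :
    t + potential P ts m' (Function.update G μ G') ≤ potential P ts m G + 1000 := by
  rw [potential_update hμ hμD fun ν hν => (hf.other ν hν).2.1]
  rcases hf.time with ⟨h1, h2, h3, h4⟩ | ⟨-, h2, h3⟩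
  · rw [h2, h3]
    have h5 := (h.bucket μ hμ).passed_le_real
    have he : (0 : ℝ) < P.e := by exact_mod_cast P.e_pos
    have h6 : (m 7 μ : ℝ) ≤ P.D / P.e * m 8 μ := by
      rw [div_mul_eq_mul_div, le_div_iff₀ he, mul_comm (P.D : ℝ)]
      exact_mod_cast h1.le
    have h7 : (m 4 μ : ℝ) ≤ m 7 μ + m 8 μ := by exact_mod_cast h.len_le_add hμ
    have h8 : (1 : ℝ) ≤ m 8 μ := by
      have : m 8 μ ≠ 0 := by
        intro h0
        rw [h0] at h1
        omega
      exact_mod_cast Nat.pos_of_ne_zero this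
    have h9 := P.one_le_ratio
    have h10 : (m 8 μ : ℝ) ≤ P.D / P.e * m 8 μ := le_mul_of_one_le_left (by positivity) h9
    set y : ℝ := P.D / P.e * m 8 μ with hy
    have h11 : y ≤ ts * y := le_mul_of_one_le_left (by linarith) hts
    have h12 : (m 4 μ : ℝ) * ts ≤ 2 * (ts * y) := by nlinarith
    have h13 : P.price ts * m 8 μ = 200000 * (ts * y) := by
      rw [Par.price, hy]
      ring
    rw [h13]
    simp only [List.flatten_nil, List.length_nil, Nat.cast_zero, mul_zero]
    linarith
  · rw [h2]
    linarith

theorem FixPost.fixed {ts : ℝ} {m m' : Mem} {X : Edge P.n → ℕ} {G : ℕ → Hist P.n}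
    {G' : Hist P.n} {μ t : ℕ} (hf : FixPost P ts m X G μ m' G' t) :
    Fixed P m' (Function.update G μ G') μ := by
  refine ⟨hf.cnt, ?_⟩
  rw [Function.update_self]
  exact hf.dead

theorem FixPost.fixed_of {ts : ℝ} {m m' : Mem} {X : Edge P.n → ℕ} {G : ℕ → Hist P.n}
    {G' : Hist P.n} {μ t ν : ℕ} (hf : FixPost P ts m X G μ m' G' t) (h : Fixed P m G ν) :
    Fixed P m' (Function.update G μ G') ν := by
  by_cases hν : ν = μ
  · rw [hν]
    exact hf.fixed
  · obtain ⟨h7, h8, h9⟩ := hf.other ν hν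
    unfold Fixed
    rw [h7, h8, h9, Function.update_of_ne hν]
    exact h

theorem tri_fixP_amortized {S : Prog} {ts : ℝ} {p : ℝ≥0∞} (hW : Fits W P.M)
    (hS : IsStaticSplitAlgorithm S W P.n P.D P.g P.d ts p) (hts : 1 ≤ ts) {m : Mem}
    {X : Edge P.n → ℕ} (hX : IsFractionalMatching (fixedPoint P.D X)) {μ : ℕ} {G : ℕ → Hist P.n}
    (h : DataInv P m X G) (hμD : μ ≤ P.D) (h5 : m 14 5 = μ) :
    Tri W (fixP S) m p fun m' t => ∃ G', DataInv P m' X G' ∧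
      (∀ ν, ν ≠ 0 → ν = μ ∨ Fixed P m G ν → Fixed P m' G' ν) ∧
      t + potential P ts m' G' ≤ potential P ts m G + 1000 ∧
      ∀ i, i ∉ [6, 7, 8] → m' 14 i = m 14 i := by
  by_cases hμ : μ = 0
  · subst hμ
    refine tri_fixP_zero hW h.bdd h5 ⟨G, h, ?_, ?_, fun _ _ => rfl⟩
    · rintro ν hν (h0 | h0)
      · exact absurd h0 hν
      · exact h0
    · push_cast
      linarith
  · refine (tri_fixP hW hS hX h hμ hμD h5 (by linarith)).imp ?_
    rintro m' t ⟨G', hf⟩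
    refine ⟨_, hf.inv, ?_, hf.time_le hts hμ hμD h, hf.locals⟩
    rintro ν - (h0 | h0)
    · rw [h0]
      exact hf.fixed
    · exact hf.fixed_of h0

/-- The invariants between the operations. -/
structure Stable (P : Par) (m : Mem) (X : Edge P.n → ℕ) (G : ℕ → Hist P.n) : Prop where
  inv : DataInv P m X G
  fixed : ∀ μ, μ ≠ 0 → Fixed P m G μ

theorem touch_passed (G : ℕ → Hist P.n) (e : Edge P.n) (μ₁ μ₂ μ : ℕ) :
    (touch G e μ₁ μ₂ μ).passed = (G μ).passed := by
  unfold touch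
  split_ifs <;> rfl

theorem touch_cur (G : ℕ → Hist P.n) (e : Edge P.n) (μ₁ μ₂ μ : ℕ) :
    (touch G e μ₁ μ₂ μ).cur = (G μ).cur := by
  unfold touch
  split_ifs <;> rfl

theorem sum_indicator_le {s : Finset ℕ} {q : Prop} [Decidable q] {c : ℝ} (hc : 0 ≤ c) (k : ℕ) :
    ∑ μ ∈ s, c * ((if q ∧ μ = k then 1 else 0 : ℕ) : ℝ) ≤ c := by
  by_cases hq : q
  · simp only [hq, true_and, Nat.cast_ite, Nat.cast_one, Nat.cast_zero, mul_ite, mul_one, mul_zero]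
    rw [Finset.sum_ite_eq']
    split_ifs
    · exact le_rfl
    · exact hc
  · simpa [hq] using hc

theorem SetPost.potential_le {ts : ℝ} (hts : 1 ≤ ts) {m m' : Mem} {X : Edge P.n → ℕ} {e : Edge P.n}
    {ν : ℕ} (G : ℕ → Hist P.n) (h : SetPost P m X e ν m') :
    potential P ts m' (touch G e (P.bk (X e)) (P.bk ν)) ≤
      potential P ts m G + 2 * P.price ts := by
  have hp : 0 ≤ P.price ts := by
    unfold Par.price
    positivity
  unfold potential
  have h1 : ∀ μ, P.price ts * (m' 8 μ : ℝ) - 20000 *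
      ((touch G e (P.bk (X e)) (P.bk ν) μ).passed.flatten.length : ℝ) =
      (P.price ts * m 8 μ - 20000 * ((G μ).passed.flatten.length : ℝ)) +
      (P.price ts * ((if P.bk (X e) ≠ 0 ∧ μ = P.bk (X e) then 1 else 0 : ℕ) : ℝ) +
      P.price ts * ((if P.bk ν ≠ 0 ∧ μ = P.bk ν then 1 else 0 : ℕ) : ℝ)) := by
    intro μ
    rw [touch_passed, h.cnt, Nat.cast_add, Nat.cast_add]
    ring
  rw [Finset.sum_congr rfl fun μ _ => h1 μ, Finset.sum_add_distrib, Finset.sum_add_distrib, two_mul]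
  exact add_le_add le_rfl (add_le_add (sum_indicator_le hp _) (sum_indicator_le hp _))

theorem SetPost.fixed {m m' : Mem} {X : Edge P.n → ℕ} {e : Edge P.n} {ν : ℕ} {G : ℕ → Hist P.n}
    (h : SetPost P m X e ν m') {μ : ℕ} (h₁ : μ ≠ P.bk (X e)) (h₂ : μ ≠ P.bk ν)
    (hf : Fixed P m G μ) : Fixed P m' (touch G e (P.bk (X e)) (P.bk ν)) μ := by
  unfold Fixed at hf ⊢
  rw [h.cnt, h.dcur, h.frame 7 (by decide), touch_cur]
  simpa [h₁, h₂] using hf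

/-- Only the old and the new bucket of the edge can get out of order. Each is repaired by one call
of `fixP`, which leaves the order of all other buckets intact; this gives the failure probability `p
+ p`. The two changes pay `2 * price` into the potential. -/
theorem tri_updateP {S : Prog} {ts : ℝ} {p : ℝ≥0∞} (hW : Fits W P.M)
    (hS : IsStaticSplitAlgorithm S W P.n P.D P.g P.d ts p) (hts : 1 ≤ ts) {m : Mem}
    {X : Edge P.n → ℕ} {G : ℕ → Hist P.n} (h : Stable P m X G) {e : Edge P.n} {ν : ℕ}
    (hν : ν ≤ P.D) (hX : IsFractionalMatching (fixedPoint P.D (Function.update X e ν))) :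
    Tri W (updateP S) (m.setList 0 [(e.1.1 : ℕ), (e.1.2 : ℕ), ν]) (p + p) fun m' t =>
      ∃ G', Stable P m' (Function.update X e ν) G' ∧
        t + potential P ts m' G' ≤ potential P ts m G + (10000 + 2 * P.price ts) := by
  have hDM := P.D_le
  have hnM := P.n_le'
  have hst := P.st_le
  have he1 := e.1.1.2
  have he2 := e.1.2.2
  have hnn : P.n ≤ P.n * P.n := Nat.le_mul_self _
  have hstd : P.st = 4 * (P.n * P.n) + 4 := rfl
  set m₀ := m.setList 0 [(e.1.1 : ℕ), (e.1.2 : ℕ), ν] with hm₀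
  have hb₀ : MemBdd P.M m₀ := by
    refine setList_bdd h.inv.bdd (by simp; omega) ?_
    intro x hx
    simp only [List.mem_cons, List.not_mem_nil, or_false] at hx
    rcases hx with rfl | rfl | rfl <;> omega
  have hf₀ : ∀ a, a ≠ 0 → m₀ a = m a := fun a ha => setList_ne _ _ ha
  have h01 : m₀ 0 1 = e.1.1 := rfl
  have h02 : m₀ 0 2 = e.1.2 := rfl
  have h03 : m₀ 0 3 = ν := rfl
  have hp₀ : P.InMem m₀ := h.inv.par.congr (hf₀ 2 (by decide))
  have haddr := addr_lt e
  unfold updateP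
  refine Tri.store_seq hW hb₀ 0 (addr e) rfl (by simp [pv, hp₀.n, h01, h02, addr]) (by omega)
    fun hb => ?_
  refine Tri.store_seq hW hb 1 ν rfl (by simp [Mem.set_apply, h03]) (by omega) fun hb => ?_
  set m₁ := (m₀.set 14 0 (addr e)).set 14 1 ν with hm₁
  have hf₁ : ∀ a, a ∉ [0, 14] → m₁ a = m a := by
    intro a ha
    simp only [List.mem_cons, not_or, List.not_mem_nil] at ha
    rw [← hf₀ a ha.1]
    funext i
    simp [hm₁, Mem.set_apply, ha.2.1]
  have hD₁ : DataInv P m₁ X G := h.inv.frame hb hf₁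
  have hF₁ : ∀ μ, μ ≠ 0 → Fixed P m₁ G μ := by
    intro μ hμ
    unfold Fixed
    rw [hf₁ 7 (by decide), hf₁ 8 (by decide), hf₁ 9 (by decide)]
    exact h.fixed μ hμ
  have hpot₁ : potential P ts m₁ G = potential P ts m G := by
    unfold potential
    rw [hf₁ 8 (by decide)]
  refine Tri.seq_det (tri_setP hW hD₁.par hb hD₁.vec (hD₁.le e) hD₁.list
    (by simp [hm₁, Mem.set_apply]) (by simp [hm₁, Mem.set_apply]) hν
    fun μ hμ => (hF₁ μ hμ).counters_le (hD₁.bucket μ hμ)) ?_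
  rintro m₂ t₂ ⟨ht₂, hs⟩
  have hD₂ := hD₁.change hν hs
  have hpot₂ := hs.potential_le hts G
  have hF₂ : ∀ μ, μ ≠ 0 → μ = P.bk (X e) ∨ μ = P.bk ν ∨
      Fixed P m₂ (touch G e (P.bk (X e)) (P.bk ν)) μ := by
    intro μ hμ
    by_cases h₁ : μ = P.bk (X e)
    · exact Or.inl h₁
    by_cases h₂ : μ = P.bk ν
    · exact Or.inr (Or.inl h₂)
    exact Or.inr (Or.inr (hs.fixed h₁ h₂ (hF₁ μ hμ)))
  have hbk₁ : P.bk (X e) ≤ P.D := le_trans (P.bk_le _) (h.inv.le e)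
  have hbk₂ : P.bk ν ≤ P.D := le_trans (P.bk_le _) hν
  refine Tri.store_seq hW hD₂.bdd 5 (P.bk (X e)) rfl (by simp [tv, hs.old]) (by omega)
    fun hb₃ => ?_
  set m₃ := m₂.set 14 5 (P.bk (X e)) with hm₃
  have hf₃ : ∀ a, a ≠ 14 → m₃ a = m₂ a := by
    intro a ha
    funext i
    simp [hm₃, Mem.set_apply, ha]
  have hD₃ := hD₂.frame hb₃ fun a ha => hf₃ a (by simp at ha; tauto)
  refine Tri.seq (tri_fixP_amortized hW hS hts hX hD₃ hbk₁ (by simp [hm₃, Mem.set_apply])) ?_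
  rintro m₄ t₄ ⟨G₄, hD₄, hF₄, hpot₄, hl₄⟩
  refine Tri.store_seq hW hD₄.bdd 5 (P.bk ν) rfl ?_ (by omega) fun hb₅ => ?_
  · simp [tv, hl₄ 3 (by decide), hm₃, Mem.set_apply, hs.new]
  set m₅ := m₄.set 14 5 (P.bk ν) with hm₅
  have hf₅ : ∀ a, a ≠ 14 → m₅ a = m₄ a := by
    intro a ha
    funext i
    simp [hm₅, Mem.set_apply, ha]
  have hD₅ := hD₄.frame hb₅ fun a ha => hf₅ a (by simp at ha; tauto)
  refine (tri_fixP_amortized hW hS hts hX hD₅ hbk₂ (by simp [hm₅, Mem.set_apply])).imp ?_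
  rintro m₆ t₆ ⟨G₆, hD₆, hF₆, hpot₆, -⟩
  refine ⟨G₆, ⟨hD₆, ?_⟩, ?_⟩
  · intro μ hμ
    refine hF₆ μ hμ ?_
    rcases hF₂ μ hμ with h₁ | h₂ | h₃
    · right
      unfold Fixed
      rw [hf₅ 7 (by decide), hf₅ 8 (by decide), hf₅ 9 (by decide)]
      exact hF₄ μ hμ (Or.inl h₁)
    · exact Or.inl h₂
    · right
      unfold Fixed
      rw [hf₅ 7 (by decide), hf₅ 8 (by decide), hf₅ 9 (by decide)]
      refine hF₄ μ hμ (Or.inr ?_)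
      unfold Fixed
      rw [hf₃ 7 (by decide), hf₃ 8 (by decide), hf₃ 9 (by decide)]
      exact h₃
  · have hpot₃ : potential P ts m₃ (touch G e (P.bk (X e)) (P.bk ν)) =
        potential P ts m₂ (touch G e (P.bk (X e)) (P.bk ν)) := by
      unfold potential
      rw [hf₃ 8 (by decide)]
    have hpot₅ : potential P ts m₅ G₄ = potential P ts m₄ G₄ := by
      unfold potential
      rw [hf₅ 8 (by decide)]
    have ht₂' : (t₂ : ℝ) ≤ 5000 := by exact_mod_cast ht₂
    push_cast
    linarith

end Amortization

/-! ### Initialization. -/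

section Init

variable {P : Par} {W : ℕ}

theorem IsFractionalMatching.le_denominator {n D : ℕ} (hD : 0 < D) {X : Edge n → ℕ}
    (h : IsFractionalMatching (fixedPoint D X)) (e : Edge n) : X e ≤ D := by
  have h1 : fixedPoint D X e ≤ vertexSum (fixedPoint D X) e.1.1 := by
    unfold vertexSum
    refine le_trans (le_of_eq ?_) (Finset.single_le_sum
      (f := fun e' : Edge n => if e'.1.1 = e.1.1 ∨ e'.1.2 = e.1.1 then fixedPoint D X e' else 0)
      (fun e' _ => ?_) (Finset.mem_univ e))
    · simp
    · split_ifs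
      · exact h.nonneg e'
      · exact le_rfl
  have h2 := h1.trans (h.degree _)
  have hDR : (0 : ℝ) < D := by exact_mod_cast hD
  unfold fixedPoint at h2
  rw [div_le_one hDR] at h2
  exact_mod_cast h2

/-- The total number of changes since the last rebuilds. -/
noncomputable def changes (P : Par) (m : Mem) : ℝ := ∑ μ ∈ Finset.Icc 1 P.D, (m 8 μ : ℝ)

theorem changes_update {m m' : Mem} {μ : ℕ} (hμ : μ ≠ 0) (hμD : μ ≤ P.D)
    (h : ∀ ν, ν ≠ μ → m' 8 ν = m 8 ν) : changes P m' = changes P m + m' 8 μ - m 8 μ := by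
  have hmem : μ ∈ Finset.Icc 1 P.D := Finset.mem_Icc.2 ⟨by omega, hμD⟩
  unfold changes
  rw [← Finset.add_sum_erase _ _ hmem, ← Finset.add_sum_erase (Finset.Icc 1 P.D)
    (fun ν => (m 8 ν : ℝ)) hmem]
  have : ∑ ν ∈ (Finset.Icc 1 P.D).erase μ, (m' 8 ν : ℝ) =
      ∑ ν ∈ (Finset.Icc 1 P.D).erase μ, (m 8 ν : ℝ) := by
    refine Finset.sum_congr rfl fun ν hν => ?_
    rw [h ν (Finset.ne_of_mem_erase hν)]
  rw [this]
  ring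

/-- No block has been passed on, and the bucket has been empty, or not been changed, since the last
rebuild. -/
def New (m : Mem) (G : ℕ → Hist P.n) (μ : ℕ) : Prop :=
  (G μ).passed.flatten.length = 0 ∧ (m 8 μ = 0 ∨ m 7 μ = 0)

/-- A bucket that has been empty at its last rebuild contains at most as many edges as it has had
changes, so a rebuild costs `O(t_s)` per change. As the rebuild resets the counter, a bucket that
occurs for many entries is paid for only once; later visits take constant time. -/
theorem tri_fixP_new {S : Prog} {ts : ℝ} {p : ℝ≥0∞} (hW : Fits W P.M)
    (hS : IsStaticSplitAlgorithm S W P.n P.D P.g P.d ts p) (hts : 1 ≤ ts) {m : Mem}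
    {X : Edge P.n → ℕ} (hX : IsFractionalMatching (fixedPoint P.D X)) {μ : ℕ} {G : ℕ → Hist P.n}
    (h : DataInv P m X G) (hμD : μ ≤ P.D) (h5 : m 14 5 = μ) (hn : ∀ ν, ν ≠ 0 → New m G ν) :
    Tri W (fixP S) m p fun m' t => ∃ G', DataInv P m' X G' ∧ (∀ ν, ν ≠ 0 → New m' G' ν) ∧
      (∀ ν, ν ≠ 0 → ν = μ ∨ Fixed P m G ν → Fixed P m' G' ν) ∧
      t + 61000 * ts * changes P m' ≤ 61000 * ts * changes P m + 1000 ∧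
      (∀ i, i ∉ [6, 7, 8] → m' 14 i = m 14 i) ∧ m' 0 = m 0 := by
  by_cases hμ : μ = 0
  · subst hμ
    refine tri_fixP_zero hW h.bdd h5 ⟨G, h, hn, ?_, ?_, fun _ _ => rfl, rfl⟩
    · rintro ν hν (h0 | h0)
      · exact absurd h0 hν
      · exact h0
    · push_cast
      linarith
  refine (tri_fixP hW hS hX h hμ hμD h5 (by linarith)).imp ?_
  rintro m' t ⟨G', hf⟩
  refine ⟨_, hf.inv, ?_, ?_, ?_, hf.locals, hf.frame 0 (by decide)⟩
  · intro ν hν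
    by_cases hνμ : ν = μ
    · subst hνμ
      rcases hf.time with ⟨-, h2, h3, -⟩ | ⟨h1, h2, -⟩
      · exact ⟨by simp [h3], Or.inl h2⟩
      · have h8 : m' 8 ν = 0 := by
          rw [h2]
          rcases (hn ν hν).2 with h0 | h0
          · exact h0
          · rw [h0, zero_mul] at h1
            have hD := P.e_lt
            rcases Nat.mul_eq_zero.1 (Nat.le_zero.1 h1) with h4 | h4
            · exact h4
            · omega
        refine ⟨?_, Or.inl h8⟩
        have hp := (hf.inv.bucket ν hν).passed_le
        rw [h8, mul_zero, Nat.le_zero, Nat.mul_eq_zero] at hp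
        rcases hp with h4 | h4
        · have := P.e_pos
          omega
        · exact h4
    · obtain ⟨h7, h8, -⟩ := hf.other ν hνμ
      unfold New
      rw [h7, h8, Function.update_of_ne hνμ]
      exact hn ν hν
  · rintro ν - (h0 | h0)
    · rw [h0]
      exact hf.fixed
    · exact hf.fixed_of h0
  · rw [changes_update hμ hμD fun ν hν => (hf.other ν hν).2.1]
    obtain ⟨hn1, hn2⟩ := hn μ hμ
    rcases hf.time with ⟨h1, h2, h3, h4⟩ | ⟨h1, h2, h3⟩
    · have h80 : m 8 μ ≠ 0 := by
        intro h0
        rw [h0] at h1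
        omega
      have h70 := hn2.resolve_left h80
      have h7 : (m 4 μ : ℝ) ≤ m 8 μ := by
        have := h.len_le_add hμ
        rw [h70, zero_add] at this
        exact_mod_cast this
      have h8 : (1 : ℝ) ≤ m 8 μ := by exact_mod_cast Nat.pos_of_ne_zero h80
      rw [h70] at h4
      rw [h2]
      push_cast at h4 ⊢
      have h9 : (m 4 μ : ℝ) * ts ≤ m 8 μ * ts := by gcongr
      have h10 : (m 8 μ : ℝ) ≤ m 8 μ * ts := le_mul_of_one_le_right (by linarith) hts
      nlinarith
    · have hp : (G'.passed.flatten.length : ℝ) ≤ 0 := by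
        have hb := (hf.inv.bucket μ hμ).passed_le_real
        rw [Function.update_self] at hb
        have h8 : m 8 μ = 0 := by
          rcases hn2 with h0 | h0
          · exact h0
          · rw [h0, zero_mul] at h1
            have hD := P.e_lt
            rcases Nat.mul_eq_zero.1 (Nat.le_zero.1 h1) with h4 | h4
            · exact h4
            · omega
        rw [h2, h8] at hb
        simp only [Nat.cast_zero, mul_zero] at hb
        linarith
      rw [hn1] at h3
      push_cast at h3
      rw [h2]
      linarith

open Classical in
/-- The vector of the first `i` entries of `l`. -/
noncomputable def prefixVec {n : ℕ} (l : List (Edge n × ℕ)) (X : Edge n → ℕ) (i : ℕ) :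
    Edge n → ℕ :=
  fun e => if e ∈ (l.take i).map Prod.fst then X e else 0

theorem prefixVec_zero {n : ℕ} (l : List (Edge n × ℕ)) (X : Edge n → ℕ) :
    prefixVec l X 0 = fun _ => 0 := by
  funext e
  simp [prefixVec]

theorem prefixVec_length {n : ℕ} {l : List (Edge n × ℕ)} {X : Edge n → ℕ} (h : ListsEntries l X) :
    prefixVec l X l.length = X := by
  funext e
  unfold prefixVec
  rw [List.take_length]
  split_ifs with he
  · rfl
  · rw [h.mem_keys] at he
    exact (not_not.1 he).symm

theorem prefixVec_succ {n : ℕ} {l : List (Edge n × ℕ)} {X : Edge n → ℕ} (h : ListsEntries l X)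
    {i : ℕ} (hi : i < l.length) :
    prefixVec l X (i + 1) = Function.update (prefixVec l X i) l[i].1 l[i].2 := by
  funext e
  have hx : X l[i].1 = l[i].2 := ((h.2 l[i].1 l[i].2).1 (List.getElem_mem hi)).1
  have hk : e ∈ (l.take (i + 1)).map Prod.fst ↔ e ∈ (l.take i).map Prod.fst ∨ e = l[i].1 := by
    rw [List.take_succ_eq_append_getElem hi, List.map_append, List.mem_append]
    simp only [List.map_cons, List.map_nil, List.mem_singleton]
  by_cases he : e = l[i].1
  · subst he
    simp only [prefixVec, hk, or_true, if_true, Function.update_self, hx]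
  · simp only [prefixVec, hk, he, or_false, Function.update_of_ne he]

theorem prefixVec_getElem {n : ℕ} {l : List (Edge n × ℕ)} {X : Edge n → ℕ} (h : ListsEntries l X)
    {i : ℕ} (hi : i < l.length) : prefixVec l X i l[i].1 = 0 := by
  have hnd := h.nodup_keys
  unfold prefixVec
  rw [if_neg]
  intro hm
  rw [List.map_take, List.mem_take_iff_getElem] at hm
  obtain ⟨j, hj, he⟩ := hm
  rw [List.getElem_map] at he
  have hji : j < i := by
    have := lt_min_iff.1 hj
    exact this.1
  have := (List.Nodup.getElem_inj_iff hnd (i := j) (j := i) (hi := by simp; omega)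
    (hj := by simpa using hi)).1 (by simpa using he)
  omega

/-- The input of `init` is at the beginning of array `0`. -/
structure Input (P : Par) (a : ℕ → ℕ) (l : List (Edge P.n × ℕ)) : Prop where
  len : a 0 = 5 + 3 * l.length
  params : a 1 = P.n ∧ a 2 = P.D ∧ a 3 = P.g ∧ a 4 = P.d ∧ a 5 = P.e
  fst : ∀ i (h : i < l.length), a (6 + 3 * i) = l[i].1.1.1
  snd : ∀ i (h : i < l.length), a (7 + 3 * i) = l[i].1.1.2
  val : ∀ i (h : i < l.length), a (8 + 3 * i) = l[i].2

theorem Input.of_setList (m : Mem) (l : List (Edge P.n × ℕ)) :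
    Input P ((m.setList 0 ([P.n, P.D] ++ [P.g, P.d, P.e] ++ encodeVec l)) 0) l := by
  have h := setList_holds m 0 ([P.n, P.D] ++ [P.g, P.d, P.e] ++ encodeVec l)
  generalize (m.setList 0 ([P.n, P.D] ++ [P.g, P.d, P.e] ++ encodeVec l)) 0 = a at h ⊢
  have hlen := encodeVec_length l
  simp only [List.cons_append, List.nil_append, holds_cons, List.length_cons, hlen] at h
  obtain ⟨h0, h1, h2, h3, h4, h5, h6⟩ := h
  rw [holds_encodeVec] at h6
  refine ⟨by rw [h0]; omega, ⟨h1, h2, h3, h4, h5⟩, ?_, ?_, ?_⟩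
  · intro i hi
    exact (h6 i hi).1
  · intro i hi
    rw [← (h6 i hi).2.1]
    congr 1
    omega
  · intro i hi
    rw [← (h6 i hi).2.2]
    congr 1
    omega

theorem ListsEntries.length_le {l : List (Edge P.n × ℕ)} {X : Edge P.n → ℕ}
    (h : ListsEntries l X) : l.length ≤ P.n * P.n := by
  rw [← List.length_map (f := Prod.fst), ← List.toFinset_card_of_nodup h.nodup_keys]
  exact le_trans (Finset.card_le_univ _) (card_edge_le P.n)

/-- The state after the insertion of the first `i` entries of `l`. -/
structure Loaded (P : Par) (l : List (Edge P.n × ℕ)) (X : Edge P.n → ℕ) (i : ℕ) (m : Mem)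
    (G : ℕ → Hist P.n) : Prop where
  inv : DataInv P m (prefixVec l X i) G
  base : ∀ μ, m 7 μ = 0
  dead : ∀ μ, m 9 μ = 0
  passed : ∀ μ, (G μ).passed = []
  cnt : ∀ μ, m 8 μ ≤ i
  changes : changes P m ≤ i
  used : ∀ μ, m 8 μ ≠ 0 → ∃ j, ∃ h : j < l.length, P.bk l[j].2 = μ

theorem Loaded.congr {l : List (Edge P.n × ℕ)} {X : Edge P.n → ℕ} {i : ℕ} {m m' : Mem}
    {G : ℕ → Hist P.n} (h : Loaded P l X i m G) (hb : MemBdd P.M m')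
    (hf : ∀ a, a ∉ [0, 14] → m' a = m a) : Loaded P l X i m' G := by
  refine ⟨h.inv.frame hb hf, ?_, ?_, h.passed, ?_, ?_, ?_⟩
  · rw [hf 7 (by decide)]
    exact h.base
  · rw [hf 9 (by decide)]
    exact h.dead
  · rw [hf 8 (by decide)]
    exact h.cnt
  · have := h.changes
    unfold _root_.changes at this ⊢
    rwa [hf 8 (by decide)]
  · rw [hf 8 (by decide)]
    exact h.used

theorem Loaded.succ {l : List (Edge P.n × ℕ)} {X : Edge P.n → ℕ} (hl : ListsEntries l X) {i : ℕ}
    (hi : i < l.length) {m m' : Mem} {G : ℕ → Hist P.n} (h : Loaded P l X i m G)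
    (hν : l[i].2 ≤ P.D) (hs : SetPost P m (prefixVec l X i) l[i].1 l[i].2 m') :
    ∃ G', Loaded P l X (i + 1) m' G' := by
  have hbk : P.bk (prefixVec l X i l[i].1) = 0 := by
    rw [prefixVec_getElem hl hi]
    exact Nat.le_zero.1 (P.bk_le 0)
  have hcnt := hs.cnt
  simp only [hbk, ne_eq, not_true_eq_false, false_and, if_false, add_zero] at hcnt
  refine ⟨touch G l[i].1 (P.bk (prefixVec l X i l[i].1)) (P.bk l[i].2), ?_, ?_, ?_, ?_, ?_, ?_, ?_⟩
  · rw [prefixVec_succ hl hi]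
    exact h.inv.change hν hs
  · rw [hs.frame 7 (by decide)]
    exact h.base
  · intro μ
    rw [hs.dcur, hbk, h.dead]
    simp
  · intro μ
    rw [touch_passed]
    exact h.passed μ
  · intro μ
    rw [hcnt]
    have := h.cnt μ
    split_ifs <;> omega
  · have h1 : _root_.changes P m' ≤ _root_.changes P m + 1 := by
      unfold _root_.changes
      have h2 : ∀ μ, (m' 8 μ : ℝ) = m 8 μ + 1 *
          ((if P.bk l[i].2 ≠ 0 ∧ μ = P.bk l[i].2 then 1 else 0 : ℕ) : ℝ) := by
        intro μ
        rw [hcnt, Nat.cast_add, one_mul]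
      rw [Finset.sum_congr rfl fun μ _ => h2 μ, Finset.sum_add_distrib]
      exact add_le_add le_rfl (sum_indicator_le zero_le_one _)
    have := h.changes
    push_cast
    linarith
  · intro μ hμ
    by_cases h8 : m 8 μ = 0
    · rw [hcnt, h8] at hμ
      split_ifs at hμ with hc
      · exact ⟨i, hi, hc.2.symm⟩
      · exact absurd rfl hμ
    · exact h.used μ h8

/-- Loading only inserts: each edge comes from bucket `0`, so nothing becomes dead, and the counters
stay below the number of entries. No bucket is repaired in between, since repairs during the growth
would be repeated. -/
theorem tri_load (hW : Fits W P.M) {l : List (Edge P.n × ℕ)} {X : Edge P.n → ℕ}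
    (hl : ListsEntries l X) (hX : ∀ e, X e ≤ P.D) {m : Mem} (hin : Input P (m 0) l)
    (h9 : m 14 9 = 5) {G : ℕ → Hist P.n} (h : Loaded P l X 0 m G) :
    Tri W (.loop (ltE (tv 9) (.load 0 (.const 0)))
      (.seq (.store 14 (.const 0) (.load 0 (tv 9 + .const 1) * pv 0 + .load 0 (tv 9 + .const 2)))
      (.seq (.store 14 (.const 1) (.load 0 (tv 9 + .const 3)))
      (.seq setP
      (.store 14 (.const 9) (tv 9 + .const 3)))))) m 0 fun m' t =>
        t ≤ 7000 * l.length + 101 ∧ m' 0 = m 0 ∧ ∃ G', Loaded P l X l.length m' G' := by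
  have hlen := hl.length_le
  have hst := P.st_le
  have hDM := P.D_le
  have hstd : P.st = 4 * (P.n * P.n) + 4 := rfl
  let I : ℕ → Mem → ℕ → Prop := fun k m' t => ∃ i, i + k = l.length ∧ t ≤ 7000 * i ∧
    m' 14 9 = 5 + 3 * i ∧ m' 0 = m 0 ∧ ∃ G', Loaded P l X i m' G'
  refine Tri.loop_det hW (I := I) (k := l.length) rfl (by decide) ?_
    ⟨0, by omega, by omega, h9, rfl, G, h⟩
  rintro k m' t ⟨i, hik, ht, h9', h0, G', hL⟩
  have hb := hL.inv.bdd
  refine ⟨hb, ?_⟩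
  have hcond : (ltE (tv 9) (.load 0 (.const 0))).val m' = if i < l.length then 1 else 0 := by
    simp only [tv, val_ltE, val_load, val_const, h9', h0, hin.len]
    by_cases hi : i < l.length
    · rw [if_pos hi, if_pos (by omega)]
    · rw [if_neg hi, if_neg (by omega)]
  rw [hcond]
  rcases Nat.lt_or_ge i l.length with hi | hi
  · right
    refine ⟨by simp [hi], k - 1, by omega, ?_⟩
    have hval : X l[i].1 = l[i].2 := ((hl.2 l[i].1 l[i].2).1 (List.getElem_mem hi)).1
    have hν : l[i].2 ≤ P.D := by
      rw [← hval]
      exact hX _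
    have haddr := addr_lt l[i].1
    refine Tri.store_seq hW hb 0 (addr l[i].1) rfl ?_ (by omega) fun hb₁ => ?_
    · simp only [tv, pv, val_add, val_mul, val_load, val_const, h9', h0, hL.inv.par.n]
      rw [show 5 + 3 * i + 1 = 6 + 3 * i by omega, show 5 + 3 * i + 2 = 7 + 3 * i by omega,
        hin.fst i hi, hin.snd i hi]
      rfl
    refine Tri.store_seq hW hb₁ 1 l[i].2 rfl ?_ (by omega) fun hb₂ => ?_
    · have h9₁ : (m'.set 14 0 (addr l[i].1)) 14 9 = 5 + 3 * i := by simp [Mem.set_apply, h9']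
      have h0₁ : (m'.set 14 0 (addr l[i].1)) 0 = m 0 := by
        rw [← h0]
        funext j
        simp [Mem.set_apply]
      simp only [tv, val_add, val_load, val_const, h9₁, h0₁]
      rw [show 5 + 3 * i + 3 = 8 + 3 * i by omega, hin.val i hi]
    set m₁ := (m'.set 14 0 (addr l[i].1)).set 14 1 l[i].2 with hm₁
    have hf₁ : ∀ a, a ∉ [14] → m₁ a = m' a := by
      intro a ha
      simp only [List.mem_cons, not_or, List.not_mem_nil] at ha
      funext i
      simp [hm₁, Mem.set_apply, ha.1]
    have hL₁ : Loaded P l X i m₁ G' := hL.congr hb₂ fun a ha => hf₁ a (by simp at ha ⊢; tauto)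
    refine Tri.seq_det (tri_setP hW (e := l[i].1) hL₁.inv.par hb₂ hL₁.inv.vec
      (hL₁.inv.le _) hL₁.inv.list
      (by simp [hm₁, Mem.set_apply]) (by simp [hm₁, Mem.set_apply]) hν fun μ _ => ?_) ?_
    · have := hL₁.cnt μ
      rw [hL₁.dead μ]
      omega
    rintro m₂ t₂ ⟨ht₂, hs⟩
    obtain ⟨G₂, hL₂⟩ := hL₁.succ hl hi hν hs
    have h92 : m₂ 14 9 = 5 + 3 * i := by
      rw [hs.ptr, hm₁]
      simp [Mem.set_apply, h9']
    refine Tri.store hW hL₂.inv.bdd 9 (5 + 3 * (i + 1)) rfl ?_ (by omega) fun hb₃ => ?_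
    · simp only [tv, val_add, val_load, val_const, h92]
      omega
    refine ⟨k - 1, le_rfl, i + 1, by omega, by omega, by simp [Mem.set_apply], ?_, G₂,
      hL₂.congr hb₃ ?_⟩
    · rw [← h0, ← hf₁ 0 (by decide), ← hs.frame 0 (by decide)]
      funext j
      simp [Mem.set_apply]
    · intro a ha
      simp only [List.mem_cons, not_or, List.not_mem_nil] at ha
      funext j
      simp [Mem.set_apply, ha.2.1]
  · left
    have : i = l.length := by omega
    subst this
    exact ⟨by simp, by omega, h0, G', hL⟩

theorem changes_congr {m m' : Mem} (h : m' 8 = m 8) : changes P m' = changes P m := by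
  unfold changes
  rw [h]

/-- Every bucket out of order contains a listed entry that has not been visited yet. One possible
call of `S` per entry gives the failure probability `l.length * p`; the quantity `changes` serves as
the potential for the time. -/
theorem tri_build {S : Prog} {ts : ℝ} {p : ℝ≥0∞} (hW : Fits W P.M)
    (hS : IsStaticSplitAlgorithm S W P.n P.D P.g P.d ts p) (hts : 1 ≤ ts)
    {l : List (Edge P.n × ℕ)} {X : Edge P.n → ℕ} (hl : ListsEntries l X)
    (hX : IsFractionalMatching (fixedPoint P.D X)) {m : Mem} (hin : Input P (m 0) l)
    (h9 : m 14 9 = 5) {G : ℕ → Hist P.n} (h : DataInv P m X G)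
    (hn : ∀ ν, ν ≠ 0 → New m G ν)
    (hF : ∀ ν, ν ≠ 0 → Fixed P m G ν ∨ ∃ j, ∃ h : j < l.length, P.bk l[j].2 = ν) :
    Tri W (.loop (ltE (tv 9) (.load 0 (.const 0)))
      (.seq (.store 14 (.const 5) (bucketE (.load 0 (tv 9 + .const 3))))
      (.seq (fixP S)
      (.store 14 (.const 9) (tv 9 + .const 3))))) m (l.length * p) fun m' t =>
        t ≤ 61000 * ts * changes P m + 2000 * l.length + 101 ∧ ∃ G', Stable P m' X G' ∧
          ∀ ν, ν ≠ 0 → New m' G' ν := by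
  have hlen := hl.length_le
  have hst := P.st_le
  have hDM := P.D_le
  have hstd : P.st = 4 * (P.n * P.n) + 4 := rfl
  let I : ℕ → Mem → ℕ → Prop := fun k m' t => ∃ i, i + k = l.length ∧
    t + 61000 * ts * changes P m' ≤ 61000 * ts * changes P m + 2000 * i ∧
    m' 14 9 = 5 + 3 * i ∧ m' 0 = m 0 ∧ ∃ G', DataInv P m' X G' ∧ (∀ ν, ν ≠ 0 → New m' G' ν) ∧
    ∀ ν, ν ≠ 0 → Fixed P m' G' ν ∨ ∃ j, i ≤ j ∧ ∃ h : j < l.length, P.bk l[j].2 = ν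
  have hI : I l.length m 0 := ⟨0, by omega, by simp, h9, rfl, G, h, hn, fun ν hν =>
    (hF ν hν).imp_right fun ⟨j, hj⟩ => ⟨j, Nat.zero_le _, hj⟩⟩
  refine (Tri.loop hW (I := I) (Q := fun m' t =>
    (t : ℝ) ≤ 61000 * ts * changes P m + 2000 * l.length + 101 ∧ ∃ G', Stable P m' X G' ∧
      ∀ ν, ν ≠ 0 → New m' G' ν) rfl (by decide) ?_ hI).imp fun m' t h => by
        rwa [zero_add] at h
  rintro k m' t ⟨i, hik, ht, h9', h0, G', hD, hN, hF'⟩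
  refine ⟨hD.bdd, ?_⟩
  have hcond : (ltE (tv 9) (.load 0 (.const 0))).val m' = if i < l.length then 1 else 0 := by
    simp only [tv, val_ltE, val_load, val_const, h9', h0, hin.len]
    by_cases hi : i < l.length
    · rw [if_pos hi, if_pos (by omega)]
    · rw [if_neg hi, if_neg (by omega)]
  rw [hcond]
  rcases Nat.lt_or_ge i l.length with hi | hi
  · right
    refine ⟨by simp [hi], k - 1, by omega, ?_⟩
    have hval : X l[i].1 = l[i].2 := ((hl.2 l[i].1 l[i].2).1 (List.getElem_mem hi)).1
    have hbk : P.bk l[i].2 ≤ P.D := by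
      rw [← hval]
      exact le_trans (P.bk_le _) (hD.le _)
    refine Tri.store_seq hW hD.bdd 5 (P.bk l[i].2) rfl ?_ (by omega) fun hb₁ => ?_
    · rw [hD.par.bucketE]
      simp only [tv, val_add, val_load, val_const, h9', h0]
      rw [show 5 + 3 * i + 3 = 8 + 3 * i by omega, hin.val i hi]
    set m₁ := m'.set 14 5 (P.bk l[i].2) with hm₁
    have hf₁ : ∀ a, a ≠ 14 → m₁ a = m' a := by
      intro a ha
      funext j
      simp [hm₁, Mem.set_apply, ha]
    have hD₁ := hD.frame hb₁ fun a ha => hf₁ a (by simp at ha; tauto)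
    have hN₁ : ∀ ν, ν ≠ 0 → New m₁ G' ν := by
      intro ν hν
      unfold New
      rw [hf₁ 7 (by decide), hf₁ 8 (by decide)]
      exact hN ν hν
    refine Tri.mono (q := p + 0) (Tri.seq (tri_fixP_new hW hS hts hX hD₁ hbk
      (by simp [hm₁, Mem.set_apply]) hN₁) ?_) (by simp) (fun m' t h => ⟨t, le_rfl, h⟩)
    rintro m₂ t₂ ⟨G₂, hD₂, hN₂, hF₂, ht₂, hl₂, h0₂⟩
    have h92 : m₂ 14 9 = 5 + 3 * i := by
      rw [hl₂ 9 (by decide), hm₁]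
      simp [Mem.set_apply, h9']
    refine Tri.store hW hD₂.bdd 9 (5 + 3 * (i + 1)) rfl ?_ (by omega) fun hb₃ => ?_
    · simp only [tv, val_add, val_load, val_const, h92]
      omega
    set m₃ := m₂.set 14 9 (5 + 3 * (i + 1)) with hm₃
    have hf₃ : ∀ a, a ≠ 14 → m₃ a = m₂ a := by
      intro a ha
      funext j
      simp [hm₃, Mem.set_apply, ha]
    refine ⟨k - 1, le_rfl, i + 1, by omega, ?_, by simp [hm₃, Mem.set_apply], ?_, G₂,
      hD₂.frame hb₃ fun a ha => hf₃ a (by simp at ha; tauto), ?_, ?_⟩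
    · rw [changes_congr (hf₃ 8 (by decide))]
      rw [changes_congr (hf₁ 8 (by decide))] at ht₂
      push_cast
      linarith
    · rw [hf₃ 0 (by decide), h0₂, hf₁ 0 (by decide), h0]
    · intro ν hν
      unfold New
      rw [hf₃ 7 (by decide), hf₃ 8 (by decide)]
      exact hN₂ ν hν
    · intro ν hν
      have hfix : ν = P.bk l[i].2 ∨ Fixed P m' G' ν → Fixed P m₃ G₂ ν := by
        intro h'
        unfold Fixed
        rw [hf₃ 7 (by decide), hf₃ 8 (by decide), hf₃ 9 (by decide)]
        refine hF₂ ν hν (h'.imp_right fun h' => ?_)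
        unfold Fixed
        rw [hf₁ 7 (by decide), hf₁ 8 (by decide), hf₁ 9 (by decide)]
        exact h'
      rcases hF' ν hν with h' | ⟨j, hij, hj, hjν⟩
      · exact Or.inl (hfix (Or.inr h'))
      · rcases hij.eq_or_lt with rfl | hlt
        · exact Or.inl (hfix (Or.inl hjν.symm))
        · exact Or.inr ⟨j, hlt, hj, hjν⟩
  · left
    have : i = l.length := by omega
    subst this
    have h0c : 0 ≤ changes P m' := Finset.sum_nonneg fun μ _ => Nat.cast_nonneg _
    have : 0 ≤ 61000 * ts * changes P m' := by positivity
    refine ⟨by simp, by push_cast; linarith, G', ⟨hD, fun ν hν => ?_⟩, hN⟩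
    rcases hF' ν hν with h' | ⟨j, hij, hj, -⟩
    · exact h'
    · omega

theorem Loaded.zero {l : List (Edge P.n × ℕ)} {X : Edge P.n → ℕ} {m : Mem} (hp : P.InMem m)
    (hb : MemBdd P.M m) (h : ∀ a, a ∉ [0, 2, 14] → m a = fun _ => 0) :
    Loaded P l X 0 m fun _ => ⟨∅, ∅, [], [], []⟩ := by
  have hbk : P.bk 0 = 0 := Nat.le_zero.1 (P.bk_le 0)
  refine ⟨?_, ?_, ?_, fun _ => rfl, ?_, ?_, ?_⟩
  · rw [prefixVec_zero]
    refine ⟨hp, hb, ?_, fun _ => Nat.zero_le _, ?_, ?_, ?_, ?_⟩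
    · simp [h 3 (by decide)]
    · refine ⟨fun e he => absurd hbk he, fun μ _ j hj => ?_⟩
      rw [h 4 (by decide)] at hj
      exact absurd hj (Nat.not_lt_zero _)
    · simp [h 1 (by decide)]
    · simp [h 1 (by decide)]
    · intro μ hμ
      refine ⟨by simp [h 7 (by decide)], by simp, ?_, ?_, ?_, ?_, by simp, ?_, by simp, ?_⟩
      · intro e _
        simp [hbk, hμ.symm]
      · rw [encodeVecs_cons, holds_cons]
        simp [h 11 (by decide), encodeVec, encodeVecs, holds_nil]
      · simp [h 10 (by decide), encodeVec, encodeVecs, Par.st]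
      · refine ⟨by simp, by simp, Or.inl ⟨rfl, ?_⟩⟩
        have := P.g_pos
        right
        right
        simpa using this
      · intro e he
        exact absurd (he.symm.trans hbk) hμ
      · simp [h 9 (by decide), deadCount]
  · simp [h 7 (by decide)]
  · simp [h 9 (by decide)]
  · simp [h 8 (by decide)]
  · simp [_root_.changes, h 8 (by decide)]
  · simp [h 8 (by decide)]

/-- With an empty base, order permits no changes at all. So the potential is not positive when the
updates start. -/
theorem New.cnt_eq_zero {m : Mem} {G : ℕ → Hist P.n} {μ : ℕ} (h : New m G μ)
    (hf : Fixed P m G μ) : m 8 μ = 0 := by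
  rcases h.2 with h0 | h0
  · exact h0
  · have h1 := hf.1
    rw [h0, zero_mul] at h1
    have hD := P.e_lt
    rcases Nat.mul_eq_zero.1 (Nat.le_zero.1 h1) with h4 | h4
    · exact h4
    · omega

theorem tri_initP {S : Prog} {ts : ℝ} {p : ℝ≥0∞} (hW : Fits W P.M)
    (hS : IsStaticSplitAlgorithm S W P.n P.D P.g P.d ts p) (hts : 1 ≤ ts)
    {l : List (Edge P.n × ℕ)} {X : Edge P.n → ℕ} (hl : ListsEntries l X)
    (hX : IsFractionalMatching (fixedPoint P.D X)) :
    Tri W (initP S)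
      (Mem.setList (fun _ _ => 0) 0 ([P.n, P.D] ++ [P.g, P.d, P.e] ++ encodeVec l))
      (l.length * p) fun m' t => ∃ G', Stable P m' X G' ∧ potential P ts m' G' ≤ 0 ∧
        t ≤ 80000 * (ts * max 1 (l.length : ℝ)) := by
  have hlen := hl.length_le
  have hst := P.st_le
  have hDM := P.D_le
  have hnM := P.n_le'
  have hdM := P.d_le
  have hgD := P.g_lt
  have heD := P.e_lt
  have hstd : P.st = 4 * (P.n * P.n) + 4 := rfl
  have hXD : ∀ e, X e ≤ P.D := hX.le_denominator (by omega)
  have hin := Input.of_setList (P := P) (fun _ _ => 0) l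
  set m₀ := Mem.setList (fun _ _ => 0) 0 ([P.n, P.D] ++ [P.g, P.d, P.e] ++ encodeVec l) with hm₀
  have hz : ∀ a, a ≠ 0 → m₀ a = fun _ => 0 := fun a ha => setList_ne _ _ ha
  have hnn : P.n ≤ P.n * P.n := Nat.le_mul_self _
  have hb₀ : MemBdd P.M m₀ := by
    refine setList_bdd (fun _ _ => Nat.zero_le _) ?_ ?_
    · simp only [List.length_append, List.length_cons, List.length_nil, encodeVec_length]
      omega
    · intro x hx
      simp only [List.cons_append, List.nil_append, List.mem_cons] at hx
      rcases hx with rfl | rfl | rfl | rfl | rfl | hx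
      iterate 5 omega
      obtain ⟨r, hr, hx⟩ := List.mem_flatMap.1 hx
      simp only [List.mem_cons, List.not_mem_nil, or_false] at hx
      have h1 := r.1.1.1.2
      have h2 := r.1.1.2.2
      rcases hx with rfl | rfl | rfl
      · omega
      · omega
      · have := ((hl.2 r.1 r.2).1 hr).1
        rw [← this]
        exact le_trans (hXD _) hDM
  obtain ⟨h1, h2, h3, h4, h5⟩ := hin.params
  unfold initP
  refine Tri.store_seq hW hb₀ 0 P.n rfl (by simp [h1]) (by omega) fun hb => ?_
  refine Tri.store_seq hW hb 1 P.D rfl (by simp [Mem.set_apply, h2]) (by omega) fun hb => ?_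
  refine Tri.store_seq hW hb 2 P.g rfl (by simp [Mem.set_apply, h3]) (by omega) fun hb => ?_
  refine Tri.store_seq hW hb 3 P.d rfl (by simp [Mem.set_apply, h4]) (by omega) fun hb => ?_
  refine Tri.store_seq hW hb 4 P.e rfl (by simp [Mem.set_apply, h5]) (by omega) fun hb => ?_
  refine Tri.store_seq hW hb 5 P.st rfl (by simp [pv, Mem.set_apply, hstd]) (by omega)
    fun hb => ?_
  refine Tri.store_seq hW hb 9 5 rfl rfl (by omega) fun hb => ?_
  set m₁ := (((((((m₀.set 2 0 P.n).set 2 1 P.D).set 2 2 P.g).set 2 3 P.d).set 2 4 P.e).set 2 5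
    P.st).set 14 9 5) with hm₁
  have hp₁ : P.InMem m₁ := by
    constructor <;> simp [hm₁, Mem.set_apply]
  have h0₁ : m₁ 0 = m₀ 0 := by
    funext j
    simp [hm₁, Mem.set_apply]
  have hz₁ : ∀ a, a ∉ [0, 2, 14] → m₁ a = fun _ => 0 := by
    intro a ha
    simp only [List.mem_cons, not_or, List.not_mem_nil] at ha
    rw [← hz a ha.1]
    funext j
    simp [hm₁, Mem.set_apply, ha]
  refine Tri.seq_det (tri_load hW hl hXD (by rw [h0₁]; exact hin) (by simp [hm₁, Mem.set_apply])
    (Loaded.zero (l := l) (X := X) hp₁ hb hz₁)) ?_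
  rintro m₂ t₂ ⟨ht₂, h0₂, G₂, hL⟩
  refine Tri.store_seq hW hL.inv.bdd 9 5 rfl rfl (by omega) fun hb₃ => ?_
  set m₃ := m₂.set 14 9 5 with hm₃
  have hf₃ : ∀ a, a ≠ 14 → m₃ a = m₂ a := by
    intro a ha
    funext j
    simp [hm₃, Mem.set_apply, ha]
  have hL₃ := hL.congr hb₃ fun a ha => hf₃ a (by simp at ha; tauto)
  have hD₃ := hL₃.inv
  rw [prefixVec_length hl] at hD₃
  refine (tri_build hW hS hts hl hX (by rw [hf₃ 0 (by decide), h0₂, h0₁]; exact hin)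
    (by simp [hm₃, Mem.set_apply]) hD₃ ?_ ?_).imp ?_
  · intro ν _
    exact ⟨by simp [hL₃.passed], Or.inr (hL₃.base ν)⟩
  · intro ν _
    by_cases h8 : m₃ 8 ν = 0
    · left
      constructor <;> simp [h8, hL₃.dead]
    · exact Or.inr (hL₃.used ν h8)
  · rintro m₄ t₄ ⟨ht₄, G₄, hS₄, hN₄⟩
    refine ⟨G₄, hS₄, ?_, ?_⟩
    · refine Finset.sum_nonpos fun μ hμ => ?_
      have hμ0 : μ ≠ 0 := by
        have := (Finset.mem_Icc.1 hμ).1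
        omega
      rw [(hN₄ μ hμ0).cnt_eq_zero (hS₄.fixed μ hμ0), (hN₄ μ hμ0).1]
      simp
    · have h1 := hL₃.changes
      have ht₂' : (t₂ : ℝ) ≤ 7000 * l.length + 101 := by exact_mod_cast ht₂
      set y : ℝ := max 1 (l.length : ℝ) with hy
      have h2 : (l.length : ℝ) ≤ y := le_max_right _ _
      have h3 : (1 : ℝ) ≤ y := le_max_left _ _
      have h4 : y ≤ ts * y := le_mul_of_one_le_left (by linarith) hts
      have h5 : ts * changes P m₃ ≤ ts * y := by
        gcongr
        linarith
      push_cast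
      linarith

end Init

/-! ### The game against the adversary. -/

section Play

theorem play_zero {n : ℕ} (C : DynAlg) (W fuel : ℕ) (input : List ℕ) (A : Adversary n) :
    C.play W fuel input A 0 = (C.init.run W fuel (MState.start (fun _ _ => 0) input)).map
      (Option.map fun r => (⟨(r.1.mem, r.2), []⟩ : Trace)) := rfl

theorem play_succ {n : ℕ} (C : DynAlg) (W fuel : ℕ) (input : List ℕ) (A : Adversary n) (T : ℕ) :
    C.play W fuel input A (T + 1) = obind (C.play W fuel input A T) fun tr =>
      (C.update.run W fuel (MState.start tr.mem
        [((A tr).1.1.1 : ℕ), ((A tr).1.1.2 : ℕ), (A tr).2])).map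
        (Option.map fun r => (⟨tr.first, (r.1.mem, r.2) :: tr.later⟩ : Trace)) := by
  rw [DynAlg.play, obind]
  congr 1
  funext o
  cases o <;> rfl

theorem play_optLE {n : ℕ} (C : DynAlg) (W : ℕ) (input : List ℕ) (A : Adversary n) {f f' : ℕ}
    (h : f ≤ f') (T : ℕ) : OptLE (C.play W f input A T) (C.play W f' input A T) := by
  induction T with
  | zero =>
    rw [play_zero, play_zero]
    exact (run_optLE h _ _).map _
  | succ T ih =>
    rw [play_succ, play_succ]
    exact ih.obind fun tr => (run_optLE h _ _).map _

theorem play_support_finite {n : ℕ} (C : DynAlg) (W fuel : ℕ) (input : List ℕ) (A : Adversary n)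
    (T : ℕ) : (C.play W fuel input A T).support.Finite := by
  induction T with
  | zero =>
    rw [play_zero]
    exact map_support_finite (run_support_finite _ _ _)
  | succ T ih =>
    rw [play_succ]
    exact obind_support_finite ih fun tr => map_support_finite (run_support_finite _ _ _)

variable {P : Par} {W : ℕ}

/-- The claim is strengthened by the stable state and by the bound for time plus potential, so that
the induction on `T` goes through. The adversary may look at the whole trace because `tri_updateP`
applies to every stable state and every legal update: the bound `p + p` holds conditionally on each
history. -/
theorem exists_fuel_play {S : Prog} {ts : ℝ} {p : ℝ≥0∞} (hW : Fits W P.M)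
    (hS : IsStaticSplitAlgorithm S W P.n P.D P.g P.d ts p) (hts : 1 ≤ ts)
    {l : List (Edge P.n × ℕ)} {X : Edge P.n → ℕ} (hl : ListsEntries l X) {A : Adversary P.n}
    (hA : A.Legal P.D X) {K : ℝ} (hK : 1000000 ≤ K) (T : ℕ) :
    ∃ fuel, failProb ((coarseningAlg S).play W fuel
      ([P.n, P.D] ++ [P.g, P.d, P.e] ++ encodeVec l) A T)
      (fun tr => tr.Good P.D (K * (P.e / P.D + P.g / P.D * (P.e / P.D : ℝ)⁻¹ * P.L)) (P.d / P.D)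
          (K * ts) (K * ((P.e / P.D : ℝ)⁻¹ * ts)) A X ∧
        ∃ G, Stable P tr.mem (A.vector X tr.first tr.later) G ∧
          tr.updateTime + potential P ts tr.mem G ≤
            tr.later.length * (K * ((P.e / P.D : ℝ)⁻¹ * ts))) ≤ l.length * p + T * (p + p) := by
  have hDp : 0 < P.D := by
    have := P.e_lt
    omega
  induction T with
  | zero =>
    have hX : IsFractionalMatching (fixedPoint P.D X) := hA (fun _ _ => 0, 0) []
    obtain ⟨f, hf⟩ := tri_initP hW hS hts hl hX []
    refine ⟨f, ?_⟩
    rw [play_zero, failProb_map, Nat.cast_zero, zero_mul, add_zero]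
    refine le_trans (failProb_mono ?_) hf
    rintro ⟨s, t⟩ ⟨t', htt, G, hG, hpot, ht⟩
    simp only at htt hG hpot
    have hG' : Stable P (Trace.mem ⟨(s.mem, t), []⟩) (A.vector X (s.mem, t) []) G := hG
    refine ⟨⟨?_, ?_, ?_⟩, G, hG', ?_⟩
    · rw [hl.length_eq hDp]
      have h1 : (t : ℝ) ≤ t' := by exact_mod_cast htt
      have h2 : 0 ≤ ts * max 1 (l.length : ℝ) :=
        mul_nonneg (by linarith) (le_trans zero_le_one (le_max_left _ _))
      calc (t : ℝ) ≤ 80000 * (ts * max 1 (l.length : ℝ)) := h1.trans ht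
        _ ≤ K * (ts * max 1 (l.length : ℝ)) := mul_le_mul_of_nonneg_right (by linarith) h2
        _ = K * ts * max 1 (l.length : ℝ) := by ring
    · intro l' hl'
      rw [List.suffix_nil.1 hl']
      exact hG'.inv.isCoarsening (fun μ hμ => (hG'.fixed μ hμ).1)
        (fun μ hμ => (hG'.fixed μ hμ).2) (by linarith)
    · intro l' hl'
      rw [List.suffix_nil.1 hl']
      simp [Trace.updateTime]
    · simpa [Trace.updateTime, Trace.mem] using hpot
  | succ T ih =>
    have hstep := exists_fuel_obind
      (μ := fun f => (coarseningAlg S).play W f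
        ([P.n, P.D] ++ [P.g, P.d, P.e] ++ encodeVec l) A T)
      (κ := fun f tr => ((coarseningAlg S).update.run W f (MState.start tr.mem
        [((A tr).1.1.1 : ℕ), ((A tr).1.1.2 : ℕ), (A tr).2])).map
        (Option.map fun r => (⟨tr.first, (r.1.mem, r.2) :: tr.later⟩ : Trace)))
      (Q := fun tr => tr.Good P.D (K * (P.e / P.D + P.g / P.D * (P.e / P.D : ℝ)⁻¹ * P.L))
          (P.d / P.D) (K * ts) (K * ((P.e / P.D : ℝ)⁻¹ * ts)) A X ∧
        ∃ G, Stable P tr.mem (A.vector X tr.first tr.later) G ∧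
          tr.updateTime + potential P ts tr.mem G ≤
            tr.later.length * (K * ((P.e / P.D : ℝ)⁻¹ * ts)))
      (q₂ := p + p)
      (fun f f' h => play_optLE _ _ _ _ h _) (fun f => play_support_finite _ _ _ _ _ _)
      (fun f f' h tr => (run_optLE h _ _).map _) ih ?_
    · obtain ⟨f, hf⟩ := hstep
      refine ⟨f, ?_⟩
      rw [play_succ]
      refine hf.trans (le_of_eq ?_)
      push_cast
      ring
    · rintro tr ⟨hgood, G, hG, htime⟩
      have hleg : IsFractionalMatching (fixedPoint P.D (Function.update
          (A.vector X tr.first tr.later) (A tr).1 (A tr).2)) :=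
        -- The vector after the update depends only on the trace before it, so any dummy result of
        -- this update will do.
        hA tr.first ((fun _ _ => 0, 0) :: tr.later)
      have hν : (A tr).2 ≤ P.D := by
        have := hleg.le_denominator hDp (A tr).1
        rwa [Function.update_self] at this
      obtain ⟨f, hf⟩ := tri_updateP hW hS hts hG hν hleg []
      refine ⟨f, ?_⟩
      rw [failProb_map]
      refine le_trans (failProb_mono ?_) hf
      rintro ⟨s, t⟩ ⟨t', htt, G', hG', hpot⟩
      simp only at htt hG' hpot
      have hG₁ : Stable P (Trace.mem ⟨tr.first, (s.mem, t) :: tr.later⟩)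
        (A.vector X tr.first ((s.mem, t) :: tr.later)) G' := hG'
      have hnew : (Trace.updateTime ⟨tr.first, (s.mem, t) :: tr.later⟩ : ℝ) + potential P ts s.mem G' ≤
          ((s.mem, t) :: tr.later).length * (K * ((P.e / P.D : ℝ)⁻¹ * ts)) := by
        have h1 : (t : ℝ) ≤ t' := by exact_mod_cast htt
        have h2 : Trace.updateTime ⟨tr.first, (s.mem, t) :: tr.later⟩ = t + tr.updateTime := rfl
        have h3 := P.one_le_ratio
        have h4 : P.price ts = 200000 * ((P.e / P.D : ℝ)⁻¹ * ts) := by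
          rw [inv_div, Par.price]
          ring
        have h5 : 1 ≤ (P.e / P.D : ℝ)⁻¹ * ts := by
          rw [inv_div]
          exact one_le_mul_of_one_le_of_one_le h3 hts
        have h6 : 1000000 * ((P.e / P.D : ℝ)⁻¹ * ts) ≤ K * ((P.e / P.D : ℝ)⁻¹ * ts) := by
          gcongr
        rw [h4] at hpot
        rw [h2, List.length_cons]
        push_cast
        linarith
      have hpos := hG₁.inv.potential_nonneg hts
      refine ⟨⟨hgood.initTime, ?_, ?_⟩, G', hG₁, hnew⟩
      · intro l' hl'
        rcases List.suffix_cons_iff.1 hl' with rfl | hl'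
        · exact hG₁.inv.isCoarsening (fun μ hμ => (hG₁.fixed μ hμ).1)
            (fun μ hμ => (hG₁.fixed μ hμ).2) (by linarith)
        · exact hgood.coarsening l' hl'
      · intro l' hl'
        rcases List.suffix_cons_iff.1 hl' with rfl | hl'
        · have : 0 ≤ potential P ts s.mem G' := hpos
          linarith
        · exact hgood.updateTime l' hl'

end Play

/-! ### Conclusion. -/

theorem lemma4p2 :
    ∃ K : ℕ, 0 < K ∧ ∀ S : Prog, ∃ C : DynAlg, (S.Deterministic → C.Deterministic) ∧
      ∀ (n D g d e W : ℕ) (ts : ℝ) (p : ℝ≥0∞) (γ δ ε : ℝ),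
        0 < g → g < D → 0 < d → 0 < e → e < D →
        γ = (g : ℝ) / D → δ = (d : ℝ) / D → ε = (e : ℝ) / D →
        1 ≤ ts → (n + D + d + 2) ^ K ≤ 2 ^ W →
        IsStaticSplitAlgorithm S W n D g d ts p →
        IsDynamicCoarseningAlgorithm C W n D [g, d, e]
          (K * (ε + γ * ε⁻¹ * Real.log (γ⁻¹ * n))) δ (K * ts) (K * (ε⁻¹ * ts))
          (fun s T => K * (s + T) * p) := by
  -- Only this lower bound is used: for the word length, for `η` and for the times. The value itself
  -- is kept abstract.
  obtain ⟨K, hK⟩ : ∃ K : ℕ, 1000000 ≤ K := ⟨_, le_rfl⟩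
  refine ⟨K, by omega, fun S => ⟨coarseningAlg S, coarseningAlg_deterministic, ?_⟩⟩
  intro n D g d e W ts p γ δ ε hg hgD hd he heD hγ hδ hε hts hpow hS
  subst hγ hδ hε
  intro X l hl _ A hA T
  -- An adversary names an edge, and there is none on fewer than two vertices.
  have hn : 2 ≤ n := by
    have h1 := (A ⟨(fun _ _ => 0, 0), []⟩).1.2
    have h2 := (A ⟨(fun _ _ => 0, 0), []⟩).1.1.2.2
    have h3 := Fin.lt_def.1 h1
    omega
  let P : Par := ⟨n, D, g, d, e, hn, hg, hgD, hd, he, heD⟩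
  have hW : Fits W P.M := P.fits (by omega) hpow
  have hKR : (1000000 : ℝ) ≤ K := by exact_mod_cast hK
  obtain ⟨f, hf⟩ := exists_fuel_play (P := P) hW hS hts hl hA hKR T
  refine ⟨f, ?_⟩
  have h1 : failProb ((coarseningAlg S).play W f ([n, D] ++ [g, d, e] ++ encodeVec l) A T)
      (fun tr => tr.Good D (K * ((e : ℝ) / D + g / D * ((e : ℝ) / D)⁻¹ *
        Real.log (((g : ℝ) / D)⁻¹ * n))) (d / D) (K * ts) (K * (((e : ℝ) / D)⁻¹ * ts)) A X) ≤
      l.length * p + T * (p + p) := le_trans (failProb_mono fun tr h => h.1) hf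
  refine le_trans h1 ?_
  rw [hl.length_eq (by omega)]
  have h2 : (2 : ℝ≥0∞) ≤ K := by exact_mod_cast (by omega : 2 ≤ K)
  calc (l.length : ℝ≥0∞) * p + T * (p + p) ≤ l.length * (p + p) + T * (p + p) := by
        gcongr
        exact le_self_add
    _ = 2 * (l.length + T) * p := by ring
    _ ≤ K * (l.length + T) * p := by gcongr
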